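/- Let $N\ge 2$, $p\in(1,2)$, $s_1\in(0,1)$, $s_p\in\left(\frac{p-1}{p},1\right)$ and $\gamma\in(0,1)$. For $q\ge 1$, $\sigma\in(0,1)$ and $S\subseteq\mathbb{R}^N$ put $$[u]_{W^{\sigma,q}(S)}=\Big(\int_S\int_S\frac{|u(x)-u(y)|^q}{|x-y|^{N+\sigma q}}\,dx\,dy\Big)^{1/q},$$ and let $W^{\sigma,q}(S)$ be the set of $u\in L^q(S)$ with $[u]_{W^{\sigma,q}(S)}<\infty$; $W^{\sigma,q}_{\mathrm{loc}}(\Omega)$ consists of the functions lying in $W^{\sigma,q}(U)$ for every open $U\subset\subset\Omega$. Put $$\mathrm{Tail}(u;x_0,R)=\Big(R^{s_pp}\int_{\mathbb{R}^N\setminus B_R(x_0)}\frac{|u(x)|^{p-1}}{|x-x_0|^{N+s_pp}}\,dx\Big)^{\frac1{p-1}},\qquad [v]_{C^{0,\gamma}(B)}=\sup_{x,y\in B,\ x\neq y}\frac{|v(x)-v(y)|}{|x-y|^\gamma}.$$ For a bounded domain $\Omega\subset\mathbb{R}^N$, a weak solution of $$(-\Delta_1)^{s_1}u+(-\Delta_p)^{s_p}u=0\quad\text{in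 }\Omega$$ is a function $u\in W^{s_1,1}_{\mathrm{loc}}(\Omega)\cap W^{s_p,p}_{\mathrm{loc}}(\Omega)\cap L^p_{\mathrm{loc}}(\mathbb{R}^N)$ with $\int_{\mathbb{R}^N}\frac{|u(x)|^{p-1}}{(1+|x|)^{N+s_pp}}\,dx<\infty$ for which there is a $Z\in L^\infty(\mathbb{R}^N\times\mathbb{R}^N)$ such that $Z(x,y)\in\mathrm{sgn}(u(x)-u(y))$ for a.e. $(x,y)$ (where $\mathrm{sgn}(a)=\{a/|a|\}$ for $a\ne0$ and $\mathrm{sgn}(0)=[-1,1]$) and $$0=\int_{\mathbb{R}^N}\int_{\mathbb{R}^N}Z(x,y)\frac{\varphi(x)-\varphi(y)}{|x-y|^{N+s_1}}\,dx\,dy+\int_{\mathbb{R}^N}\int_{\mathbb{R}^N}\frac{|u(x)-u(y)|^{p-2}(u(x)-u(y))(\varphi(x)-\varphi(y))}{|x-y|^{N+s_pp}}\,dx\,dy$$ for every $\varphi\in W^{s_1,1}(\mathbb{R}^N)\cap W^{s_p,p}(\mathbb{R}^N)$ with compact support in $\Omega$. Then there are constants $C,\kappa>0$, depending only on $N,p,s_1,s_p,\gamma$,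 such that for every bounded domain $\Omega\subset\mathbb{R}^N$ and every weak solution $u\in L^\infty_{\mathrm{loc}}(\Omega)$ the following holds. The function $u$ agrees a.e. in $\Omega$ with a function $v\in C^{0,\gamma}_{\mathrm{loc}}(\Omega)$, i.e. $[v]_{C^{0,\gamma}(B)}<\infty$ for every ball $B\subset\subset\Omega$; and for every ball $B_R=B_R(x_0)\subset\subset\Omega$ with $R\in(0,1)$ and every $r\in(0,R)$, with $B_r=B_r(x_0)$, $$[v]_{C^{0,\gamma}(B_r)}\le\frac{C\left(\|u\|_{L^\infty(B_R)}+\mathrm{Tail}(u;x_0,R)+[u]_{W^{s_p,p}(B_R)}+1\right)}{(R-r)^\kappa}.$$ -/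

import Mathlib

open MeasureTheory Set
open scoped ENNReal

noncomputable section

namespace FracOneP

/-- The Euclidean space `ℝ^N`, with the Euclidean norm and the Lebesgue measure. -/
abbrev E (N : ℕ) : Type := EuclideanSpace ℝ (Fin N)

/-- The Gagliardo seminorm
`[u]_{W^{γ,q}(S)} = (∫_S ∫_S |u(x) - u(y)|^q / |x - y|^{N + γ q} dx dy)^{1/q}`,
with values in `[0, ∞]`. -/
def gagliardo {N : ℕ} (γ q : ℝ) (u : E N → ℝ) (S : Set (E N)) : ℝ≥0∞ :=
  (∫⁻ z in S ×ˢ S,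
    ENNReal.ofReal (|u z.1 - u z.2| ^ q / ‖z.1 - z.2‖ ^ ((N : ℝ) + γ * q))) ^ (1 / q)

/-- `u ∈ W^{γ,q}(S)`, where `0 < γ < 1 ≤ q`. -/
def MemW {N : ℕ} (γ q : ℝ) (u : E N → ℝ) (S : Set (E N)) : Prop :=
  MemLp u (ENNReal.ofReal q) (volume.restrict S) ∧ gagliardo γ q u S < ∞

/-- `u ∈ W^{γ,q}_loc(Ω)`: `u ∈ W^{γ,q}(U)` for every open `U ⊂⊂ Ω`. -/
def MemWLoc {N : ℕ} (γ q : ℝ) (u : E N → ℝ) (Ω : Set (E N)) : Prop :=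
  ∀ U : Set (E N), IsOpen U → IsCompact (closure U) → closure U ⊆ Ω → MemW γ q u U

/-- `u ∈ L^q_loc(Ω)`, `q ∈ [1, ∞]`: `u ∈ L^q(K)` for every compact `K ⊆ Ω`. -/
def MemLpLoc {N : ℕ} (q : ℝ≥0∞) (u : E N → ℝ) (Ω : Set (E N)) : Prop :=
  ∀ K : Set (E N), IsCompact K → K ⊆ Ω → MemLp u q (volume.restrict K)

/-- The tail space `L^{p-1}_{s p}(ℝ^N)`: all `u ∈ L^p_loc(ℝ^N)` such that
`∫ |u|^{p-1} / (1 + |x|)^{N + s p} dx < ∞`. -/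
def MemTailSpace {N : ℕ} (s p : ℝ) (u : E N → ℝ) : Prop :=
  MemLpLoc (ENNReal.ofReal p) u univ ∧
    ∫⁻ x, ENNReal.ofReal (|u x| ^ (p - 1) / (1 + ‖x‖) ^ ((N : ℝ) + s * p)) < ∞

/-- The nonlocal tail
`Tail(u; x₀, R) = (R^{s p} ∫_{ℝ^N \ B_R(x₀)} |u|^{p-1} / |x - x₀|^{N + s p} dx)^{1/(p-1)}`. -/
def tail {N : ℕ} (s p : ℝ) (u : E N → ℝ) (x₀ : E N) (R : ℝ) : ℝ≥0∞ :=
  (ENNReal.ofReal (R ^ (s * p)) *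
    ∫⁻ x in (Metric.ball x₀ R)ᶜ,
      ENNReal.ofReal (|u x| ^ (p - 1) / ‖x - x₀‖ ^ ((N : ℝ) + s * p))) ^ (1 / (p - 1))

/-- The set-valued sign: `{1}` for `a > 0`, `{-1}` for `a < 0`, and `[-1, 1]` for `a = 0`. -/
def sgnSet (a : ℝ) : Set ℝ :=
  {z | (0 < a → z = 1) ∧ (a < 0 → z = -1) ∧ z ∈ Icc (-1 : ℝ) 1}

/-- The test functions on `Ω` for the pair `(s₁, 1)`, `(s, p)`: functions in
`W^{s₁,1}(ℝ^N) ∩ W^{s,p}(ℝ^N)` with compact support in `Ω`. They belong to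
`W^{s₁,1}_0(Ω) ∩ W^{s,p}_0(Ω)` for each of the usual definitions of these spaces, and both double
integrals in the weak formulation below converge absolutely for them. -/
structure IsTest {N : ℕ} (s₁ s p : ℝ) (Ω : Set (E N)) (φ : E N → ℝ) : Prop where
  memW_one : MemW s₁ 1 φ univ
  memW : MemW s p φ univ
  hasCompactSupport : HasCompactSupport φ
  tsupport_subset : tsupport φ ⊆ Ω

/-- `u` is a weak solution of `(-Δ_1)^{s₁} u + (-Δ_p)^{s} u = 0` in `Ω`. -/
structure IsWeakSolution {N : ℕ} (s₁ s p : ℝ) (Ω : Set (E N)) (u : E N → ℝ) : Prop where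
  memWLoc_one : MemWLoc s₁ 1 u Ω
  memWLoc : MemWLoc s p u Ω
  memTailSpace : MemTailSpace s p u
  weak : ∃ Z : E N × E N → ℝ, MemLp Z ∞ volume ∧
    (∀ᵐ z : E N × E N, Z z ∈ sgnSet (u z.1 - u z.2)) ∧
    ∀ φ : E N → ℝ, IsTest s₁ s p Ω φ →
      0 = (∫ z : E N × E N, Z z * ((φ z.1 - φ z.2) / ‖z.1 - z.2‖ ^ ((N : ℝ) + s₁))) +
        ∫ z : E N × E N, |u z.1 - u z.2| ^ (p - 2) * (u z.1 - u z.2) * (φ z.1 - φ z.2) /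
          ‖z.1 - z.2‖ ^ ((N : ℝ) + s * p)

/-- The Hölder seminorm `[w]_{C^{0,γ}(S)} = sup_{x, y ∈ S, x ≠ y} |w(x) - w(y)| / |x - y|^γ`,
with values in `[0, ∞]`. -/
def holderSeminorm {N : ℕ} (γ : ℝ) (w : E N → ℝ) (S : Set (E N)) : ℝ≥0∞ :=
  ⨆ (x ∈ S) (y ∈ S) (_ : x ≠ y), ENNReal.ofReal (|w x - w y| / ‖x - y‖ ^ γ)

/-- `w ∈ C^{0,γ}_loc(Ω)`: `w ∈ C^{0,γ}(B_R(x₀))` for every ball `B_R(x₀) ⊂⊂ Ω`. -/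
def MemHolderLoc {N : ℕ} (γ : ℝ) (w : E N → ℝ) (Ω : Set (E N)) : Prop :=
  ∀ (x₀ : E N) (R : ℝ), 0 < R → Metric.closedBall x₀ R ⊆ Ω →
    holderSeminorm γ w (Metric.ball x₀ R) < ∞

end FracOneP

end

open FracOneP

/-! Write δ_h u(x) = u(x+h) - u(x), and s for s_p. The equation is differentiated discretely: it is
tested with φ = |δ_h u|^{β-1} δ_h u · η and with the translate of φ by h, and the two identities are
subtracted. The sign graph is monotone, so apart from cutoff terms the contribution of the
1-Laplacian has the good sign and is dropped. Its cutoff terms carry the factor η(x) - η(y), which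
gains one power of |x-y| and makes the kernel |x-y|^{-N-s₁} integrable. The singular operator thus
costs only an error of the size of ∫|δ_h u|^β, uniformly in a coefficient l ∈ [0,1] in front of it.
The p-part is coercive (`spow_mul_ge`) and bounds the degenerate energy of density (|a|+|b|)^{p-2}
|δ_h u(x) - δ_h u(y)|^{β+1}, where a = u(x+h) - u(y+h) and b = u(x) - u(y) (`NormSol.energy_le`).

Take β = q+1-p and suppose that u has the modulus |h|^θ in L^q (`Nik`). Every error is then
O(|h|^{θβ}) (`exists_energy_bound`), and restricting the energy to pairs with |x-y| < 2|h| yields a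
further |h|^{sp}. Cutting at the relative scale |h|^δ removes the degenerate weight
(`rpow_le_energy`), and second differences gain the order δ whenever δ(q+2-p) ≤ sp - θ(p-1)
(`exists_second_difference_le`). Below order one, second differences control first differences
(`exists_first_difference_le`). For θ < 1 the right-hand side exceeds sp - (p-1), which is positive
exactly because s > (p-1)/p. The gain therefore does not degenerate, and finitely many steps reach
every θ < 1 (`NikBound.raise`).

The iteration starts from the finite energy, that is from θ = s and q = p (`NikBound.base`). For
bounded u, differentiability can be traded for integrability: order θ in L^q gives order θq/q' in
L^{q'} (`NikBound.change_exponent`). Raising θ from s to a value below 1 and trading back down to s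
multiplies q by a factor that may be any ρ < 1/s, so every q is reached (`nikBound_all`). Once γ +
N/q < 1, a Campanato–Morrey argument on dyadic averages gives the Hölder bound
(`exists_holder_bound_of_le`).

General solutions are divided by the sum M of their norms and 1. The two operators have homogeneity
0 and p-1, so the quotient solves the equation with l = M^{1-p} ≤ 1
(`IsWeakSolution.exists_normSol`). Uniformity in l is what makes the final estimate linear in M. -/

noncomputable section

namespace FracOneP

/-! ### Elementary inequalities for signed powers -/

/-- The odd power `|a|^e a`. -/
def spow (e a : ℝ) : ℝ := |a| ^ e * a

lemma spow_zero (e : ℝ) : spow e 0 = 0 := by simp [spow]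

lemma spow_neg (e a : ℝ) : spow e (-a) = -spow e a := by simp [spow]

lemma spow_of_pos {e a : ℝ} (ha : 0 < a) : spow e a = a ^ (e + 1) := by
  rw [spow, abs_of_pos ha, Real.rpow_add_one ha.ne']

lemma spow_of_nonneg {e a : ℝ} (he : e + 1 ≠ 0) (ha : 0 ≤ a) : spow e a = a ^ (e + 1) := by
  rcases ha.eq_or_lt with rfl | ha
  · rw [spow_zero, Real.zero_rpow he]
  · exact spow_of_pos ha

lemma abs_spow {e : ℝ} (he : e + 1 ≠ 0) (a : ℝ) : |spow e a| = |a| ^ (e + 1) := by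
  rw [spow, abs_mul, abs_of_nonneg (by positivity)]
  have := spow_of_nonneg he (abs_nonneg a)
  rwa [spow, abs_abs] at this

lemma measurable_spow (e : ℝ) : Measurable (spow e) := by
  unfold spow; fun_prop

/-- Bernoulli's inequality for the concave power t ↦ t^{p-1}, applied to b/a, gives the bound with
a^{p-2}; the exponent p-2 is negative, so enlarging a to a+b only decreases this weight. -/
lemma spow_sub_ge_of_nonneg {p a b : ℝ} (hp : p ∈ Ioo (1 : ℝ) 2) (hb : 0 ≤ b) (hab : b ≤ a) :
    (p - 1) * (|a| + |b|) ^ (p - 2) * (a - b) ≤ spow (p - 2) a - spow (p - 2) b := by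
  obtain ⟨h1, h2⟩ := hp
  rcases (hb.trans hab).eq_or_lt with ha | ha
  · have : b = a := le_antisymm hab (ha ▸ hb)
    simp [this]
  · rw [spow_of_pos ha, spow_of_nonneg (by linarith) hb, abs_of_pos ha, abs_of_nonneg hb]
    have e : p - 2 + 1 = p - 1 := by ring
    rw [e]
    have k1 : (a + b) ^ (p - 2) ≤ a ^ (p - 2) :=
      Real.rpow_le_rpow_of_nonpos ha (by linarith) (by linarith)
    have k2 : b ^ (p - 1) ≤ a ^ (p - 1) * (1 + (p - 1) * (b / a - 1)) := by
      have := rpow_one_add_le_one_add_mul_self (s := b / a - 1) (by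
        have : 0 ≤ b / a := by positivity
        linarith) (p := p - 1) (by linarith) (by linarith)
      rw [add_sub_cancel, Real.div_rpow hb ha.le, div_le_iff₀ (by positivity)] at this
      linarith
    have k3 : a ^ (p - 1) = a ^ (p - 2) * a := by
      rw [← Real.rpow_add_one ha.ne', e]
    have k4 : a ^ (p - 1) * (1 + (p - 1) * (b / a - 1)) =
        a ^ (p - 1) - (p - 1) * a ^ (p - 2) * (a - b) := by
      rw [k3]; field_simp; ring
    have k5 : (p - 1) * (a + b) ^ (p - 2) * (a - b) ≤ (p - 1) * a ^ (p - 2) * (a - b) := by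
      apply mul_le_mul_of_nonneg_right _ (by linarith)
      apply mul_le_mul_of_nonneg_left k1 (by linarith)
    linarith

/-- Oddness reduces equal signs to the nonnegative case. For opposite signs |a|+|b| = a-b, and
subadditivity of t ↦ t^{p-1} gives the bound even without the factor p-1 < 1. -/
lemma spow_sub_ge {p a b : ℝ} (hp : p ∈ Ioo (1 : ℝ) 2) (hab : b ≤ a) :
    (p - 1) * (|a| + |b|) ^ (p - 2) * (a - b) ≤ spow (p - 2) a - spow (p - 2) b := by
  obtain ⟨h1, h2⟩ := id hp
  rcases le_or_gt 0 b with hb | hb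
  · exact spow_sub_ge_of_nonneg hp hb hab
  rcases le_or_gt a 0 with ha | ha
  · have := spow_sub_ge_of_nonneg hp (a := -b) (b := -a) (by linarith) (by linarith)
    rw [spow_neg, spow_neg, abs_neg, abs_neg, add_comm |b|] at this
    linarith
  · have hb' : spow (p - 2) b = -(-b) ^ (p - 1) := by
      have := spow_of_pos (e := p - 2) (a := -b) (by linarith)
      rw [spow_neg] at this
      rw [show p - 1 = p - 2 + 1 by ring, ← this]; ring
    rw [hb', spow_of_pos ha, abs_of_pos ha, abs_of_neg hb, show p - 2 + 1 = p - 1 by ring]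
    have k1 := Real.rpow_add_le_add_rpow ha.le (by linarith : 0 ≤ -b) (p := p - 1) (by linarith)
      (by linarith)
    have k2 : (a + -b) ^ (p - 1) = (a + -b) ^ (p - 2) * (a - b) := by
      rw [← sub_eq_add_neg, ← Real.rpow_add_one (by linarith)]; ring_nf
    have k3 : 0 ≤ (a + -b) ^ (p - 1) := by apply Real.rpow_nonneg; linarith
    nlinarith

lemma abs_spow_sub_le {p : ℝ} (hp : 1 < p) (a b : ℝ) :
    |spow (p - 2) a - spow (p - 2) b| ≤ |a| ^ (p - 1) + |b| ^ (p - 1) := by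
  refine (abs_sub _ _).trans ?_
  rw [abs_spow (by linarith), abs_spow (by linarith), show p - 2 + 1 = p - 1 by ring]

lemma abs_sub_rpow_le {p : ℝ} (hp : p ∈ Ioo (1 : ℝ) 2) (a b : ℝ) :
    |a - b| ^ (p - 1) ≤ |a| ^ (p - 1) + |b| ^ (p - 1) := by
  obtain ⟨h1, h2⟩ := hp
  exact (Real.rpow_le_rpow (abs_nonneg _) (abs_sub _ _) (by linarith)).trans
    (Real.rpow_add_le_add_rpow (abs_nonneg _) (abs_nonneg _) (by linarith) (by linarith))

/-- For equal signs this is superadditivity of t ↦ t^β, with constant 1. The factor 2^{1-β} comes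
from opposite signs, where convexity bounds (a-b)^β by 2^{β-1}(a^β + (-b)^β). -/
lemma spow_sub_ge_pow {β a b : ℝ} (hβ : 1 ≤ β) (hab : b ≤ a) :
    2 ^ (1 - β) * (a - b) ^ β ≤ spow (β - 1) a - spow (β - 1) b := by
  have key : ∀ {a b : ℝ}, 0 ≤ b → b ≤ a →
      2 ^ (1 - β) * (a - b) ^ β ≤ spow (β - 1) a - spow (β - 1) b := by
    intro a b hb hab
    rw [spow_of_nonneg (by linarith) hb, spow_of_nonneg (by linarith) (hb.trans hab),
      sub_add_cancel]
    have := Real.add_rpow_le_rpow_add (sub_nonneg.2 hab) hb hβ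
    rw [sub_add_cancel] at this
    have h2 : (2 : ℝ) ^ (1 - β) ≤ 1 := Real.rpow_le_one_of_one_le_of_nonpos (by norm_num)
      (by linarith)
    have h3 : 0 ≤ (a - b) ^ β := Real.rpow_nonneg (by linarith) _
    nlinarith
  rcases le_or_gt 0 b with hb | hb
  · exact key hb hab
  rcases le_or_gt a 0 with ha | ha
  · have := key (a := -b) (b := -a) (by linarith) (by linarith)
    rw [spow_neg, spow_neg, show -b - -a = a - b by ring] at this
    linarith
  · have hb' : spow (β - 1) b = -(-b) ^ β := by
      have := spow_of_pos (e := β - 1) (a := -b) (by linarith)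
      rw [spow_neg, sub_add_cancel] at this
      rw [← this]; ring
    rw [hb', spow_of_pos ha, sub_add_cancel]
    have : (a - b) ^ β ≤ 2 ^ (β - 1) * (a ^ β + (-b) ^ β) := by
      have := NNReal.rpow_add_le_mul_rpow_add_rpow ⟨a, ha.le⟩ ⟨-b, by linarith⟩ hβ
      rw [sub_eq_add_neg]
      exact_mod_cast this
    have h2 : (2 : ℝ) ^ (1 - β) * 2 ^ (β - 1) = 1 := by
      rw [← Real.rpow_add (by norm_num)]; simp
    have h3 : (0 : ℝ) < 2 ^ (1 - β) := by positivity
    calc _ ≤ (2 : ℝ) ^ (1 - β) * (2 ^ (β - 1) * (a ^ β + (-b) ^ β)) := by gcongr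
      _ = _ := by rw [← mul_assoc, h2]; ring

lemma spow_mono {β a b : ℝ} (hβ : 1 ≤ β) (hab : b ≤ a) : spow (β - 1) b ≤ spow (β - 1) a := by
  have := spow_sub_ge_pow hβ hab
  have h2 : 0 ≤ (2 : ℝ) ^ (1 - β) * (a - b) ^ β :=
    mul_nonneg (by positivity) (Real.rpow_nonneg (by linarith) _)
  linarith

/-- Bernoulli for the convex power. The constant is not sharp: the bound serves only to show that
the test function has finite energy, and its value never enters the estimates. -/
lemma spow_sub_le {β a b M : ℝ} (hβ : 1 ≤ β) (hab : b ≤ a) (hb : |b| ≤ M) (ha : |a| ≤ M) :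
    spow (β - 1) a - spow (β - 1) b ≤ 2 * β * M ^ (β - 1) * (a - b) := by
  have hM : 0 ≤ M := (abs_nonneg _).trans ha
  have key : ∀ {a b : ℝ}, 0 ≤ b → b ≤ a → a ≤ M →
      spow (β - 1) a - spow (β - 1) b ≤ β * M ^ (β - 1) * (a - b) := by
    intro a b hb hab hM
    rcases (hb.trans hab).eq_or_lt with ha | ha
    · have : b = a := le_antisymm hab (ha ▸ hb)
      simp [this]
    rw [spow_of_nonneg (by linarith) hb, spow_of_pos ha, sub_add_cancel]
    have := one_add_mul_self_le_rpow_one_add (s := b / a - 1) (by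
        have : 0 ≤ b / a := by positivity
        linarith) hβ
    rw [add_sub_cancel, Real.div_rpow hb ha.le, le_div_iff₀ (by positivity)] at this
    have k3 : a ^ β = a ^ (β - 1) * a := by
      rw [← Real.rpow_add_one ha.ne', sub_add_cancel]
    have k4 : (1 + β * (b / a - 1)) * a ^ β = a ^ β - β * a ^ (β - 1) * (a - b) := by
      rw [k3]; field_simp; ring
    have k5 : β * a ^ (β - 1) * (a - b) ≤ β * M ^ (β - 1) * (a - b) := by
      have : a ^ (β - 1) ≤ M ^ (β - 1) := Real.rpow_le_rpow ha.le hM (by linarith)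
      have : 0 ≤ a - b := by linarith
      gcongr
    linarith
  have hP : 0 ≤ β * M ^ (β - 1) := by positivity
  rcases le_or_gt 0 b with h | h
  · have := key h hab ((le_abs_self _).trans ha)
    nlinarith
  rcases le_or_gt a 0 with h' | h'
  · have := key (a := -b) (b := -a) (by linarith) (by linarith) ((neg_le_abs _).trans hb)
    rw [spow_neg, spow_neg] at this
    nlinarith
  · have k1 := key le_rfl h'.le ((le_abs_self _).trans ha)
    have k2 := key le_rfl (a := -b) (by linarith) ((neg_le_abs _).trans hb)
    rw [spow_zero] at k1 k2
    rw [spow_neg] at k2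
    nlinarith

lemma abs_spow_sub_le_lipschitz {β a b M : ℝ} (hβ : 1 ≤ β) (hb : |b| ≤ M) (ha : |a| ≤ M) :
    |spow (β - 1) a - spow (β - 1) b| ≤ 2 * β * M ^ (β - 1) * |a - b| := by
  rcases le_total b a with h | h
  · rw [abs_of_nonneg (sub_nonneg.2 (spow_mono hβ h)), abs_of_nonneg (sub_nonneg.2 h)]
    exact spow_sub_le hβ h hb ha
  · rw [abs_of_nonpos (sub_nonpos.2 (spow_mono hβ h)), abs_of_nonpos (sub_nonpos.2 h), neg_sub,
      neg_sub]
    exact spow_sub_le hβ h ha hb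

/-- Young's inequality with a scale, by comparison of the two terms. -/
lemma rpow_mul_rpow_le {x y τ m n : ℝ} (hx : 0 ≤ x) (hy : 0 ≤ y) (hτ : 0 < τ) (hm : 0 ≤ m)
    (hn : 0 < n) :
    x ^ m * y ^ n ≤ τ ^ n * x ^ (m + n) + τ ^ (-m) * y ^ (m + n) := by
  rcases le_or_gt y (τ * x) with h | h
  · have : x ^ m * y ^ n ≤ τ ^ n * x ^ (m + n) := by
      calc x ^ m * y ^ n ≤ x ^ m * (τ * x) ^ n := by gcongr
        _ = τ ^ n * x ^ (m + n) := by
          rw [Real.mul_rpow hτ.le hx, Real.rpow_add_of_nonneg hx hm hn.le]; ring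
    have : 0 ≤ τ ^ (-m) * y ^ (m + n) := by positivity
    linarith
  · have : x ^ m * y ^ n ≤ τ ^ (-m) * y ^ (m + n) := by
      have hx' : x ≤ y / τ := by rw [le_div_iff₀ hτ]; linarith
      calc x ^ m * y ^ n ≤ (y / τ) ^ m * y ^ n := by gcongr
        _ = τ ^ (-m) * y ^ (m + n) := by
          rw [Real.div_rpow hy hτ.le, Real.rpow_add_of_nonneg hy hm hn.le, Real.rpow_neg hτ.le]
          field_simp
    have : 0 ≤ τ ^ n * x ^ (m + n) := by positivity
    linarith

lemma rpow_le_scale {x τ q m : ℝ} (hx : 0 ≤ x) (hτ : 0 < τ) (hm : 0 ≤ m) (hmq : m ≤ q) :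
    x ^ m ≤ τ ^ m + τ ^ (m - q) * x ^ q := by
  rcases le_or_gt x τ with h | h
  · have : x ^ m ≤ τ ^ m := Real.rpow_le_rpow hx h hm
    have : 0 ≤ τ ^ (m - q) * x ^ q := by positivity
    linarith
  · have hx0 : 0 < x := hτ.trans h
    have : x ^ m ≤ τ ^ (m - q) * x ^ q := by
      calc x ^ m = x ^ (m - q) * x ^ q := by rw [← Real.rpow_add hx0]; ring_nf
        _ ≤ _ := by
          gcongr ?_ * _
          exact Real.rpow_le_rpow_of_nonpos hτ h.le (by linarith)
    have : 0 ≤ τ ^ m := by positivity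
    linarith

/-- Splitting a power of a difference into the degenerate energy density and a remainder. -/
lemma rpow_le_energy {d S τ p q : ℝ} (hd : 0 ≤ d) (hdS : d ≤ S) (hτ : 0 < τ) (hp : p < 2)
    (hq : 0 < q) :
    d ^ q ≤ τ ^ (p - 2) * (S ^ (p - 2) * d ^ (q + 2 - p)) + τ ^ q * S ^ q := by
  rcases hd.eq_or_lt with rfl | hd
  · rw [Real.zero_rpow hq.ne']; positivity
  have hS : 0 < S := hd.trans_le hdS
  rcases le_or_gt d (τ * S) with h | h
  · have : d ^ q ≤ τ ^ q * S ^ q := by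
      rw [← Real.mul_rpow hτ.le hS.le]; gcongr
    have : 0 ≤ τ ^ (p - 2) * (S ^ (p - 2) * d ^ (q + 2 - p)) := by positivity
    linarith
  · have : d ^ q ≤ τ ^ (p - 2) * (S ^ (p - 2) * d ^ (q + 2 - p)) := by
      rw [← mul_assoc, ← Real.mul_rpow hτ.le hS.le]
      calc d ^ q = d ^ (p - 2) * d ^ (q + 2 - p) := by rw [← Real.rpow_add hd]; ring_nf
        _ ≤ _ := by
          gcongr ?_ * _
          exact Real.rpow_le_rpow_of_nonpos (by positivity) h.le (by linarith)
    have : 0 ≤ τ ^ q * S ^ q := by positivity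
    linarith

/-- The pointwise inequality behind the energy estimate for difference quotients. -/
lemma spow_mul_ge {p β a b A B e f : ℝ} (hp : p ∈ Ioo (1 : ℝ) 2) (hβ : 1 ≤ β)
    (hab : a - b = A - B) (he : 0 ≤ e) (hf : 0 ≤ f) :
    (p - 1) * 2 ^ (1 - β) * ((|a| + |b|) ^ (p - 2) * |A - B| ^ (β + 1)) * ((e + f) / 2) -
      (|a| ^ (p - 1) + |b| ^ (p - 1)) * (|A| ^ β + |B| ^ β) * (|e - f| / 2) ≤
    (spow (p - 2) a - spow (p - 2) b) * (spow (β - 1) A * e - spow (β - 1) B * f) := by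
  have hp1 := hp.1
  -- Discrete product rule: the averaged cutoff multiplies a product of two monotone differences,
  -- and only the remainder sees e - f.
  have hsplit : spow (β - 1) A * e - spow (β - 1) B * f =
      (spow (β - 1) A - spow (β - 1) B) * ((e + f) / 2) +
        (spow (β - 1) A + spow (β - 1) B) * ((e - f) / 2) := by ring
  rw [hsplit, mul_add]
  have hgood : (p - 1) * 2 ^ (1 - β) * ((|a| + |b|) ^ (p - 2) * |A - B| ^ (β + 1)) ≤
      (spow (p - 2) a - spow (p - 2) b) * (spow (β - 1) A - spow (β - 1) B) := by
    have key : ∀ {a b A B : ℝ}, a - b = A - B → b ≤ a →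
      (p - 1) * 2 ^ (1 - β) * ((|a| + |b|) ^ (p - 2) * |A - B| ^ (β + 1)) ≤
      (spow (p - 2) a - spow (p - 2) b) * (spow (β - 1) A - spow (β - 1) B) := by
      intro a b A B hab h
      have hAB : B ≤ A := by linarith
      have k1 := spow_sub_ge hp h
      have k2 := spow_sub_ge_pow hβ hAB
      have hnn : 0 ≤ A - B := by linarith
      have k3 : |A - B| ^ (β + 1) = (A - B) ^ β * (A - B) := by
        rw [abs_of_nonneg hnn]
        exact Real.rpow_add_one' hnn (by linarith)
      calc _ = ((p - 1) * (|a| + |b|) ^ (p - 2) * (a - b)) * (2 ^ (1 - β) * (A - B) ^ β) := by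
            rw [k3, hab]; ring
        _ ≤ _ := by
          apply mul_le_mul k1 k2
          · exact mul_nonneg (by positivity) (Real.rpow_nonneg hnn _)
          · refine le_trans ?_ k1
            exact mul_nonneg (mul_nonneg (by linarith) (by positivity)) (by linarith)
    rcases le_total b a with h | h
    · exact key hab h
    · have := key (a := b) (b := a) (A := B) (B := A) (by linarith) h
      rw [add_comm |b|, abs_sub_comm B A] at this
      linarith
  have hbad : -((|a| ^ (p - 1) + |b| ^ (p - 1)) * (|A| ^ β + |B| ^ β) * (|e - f| / 2)) ≤
      (spow (p - 2) a - spow (p - 2) b) *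
        ((spow (β - 1) A + spow (β - 1) B) * ((e - f) / 2)) := by
    apply neg_le_of_abs_le
    rw [abs_mul, abs_mul, abs_div, abs_two, ← mul_assoc]
    gcongr
    · exact abs_spow_sub_le hp1 a b
    · refine (abs_add_le _ _).trans ?_
      rw [abs_spow (by linarith), abs_spow (by linarith), sub_add_cancel]
  have := mul_le_mul_of_nonneg_right hgood (by linarith : 0 ≤ (e + f) / 2)
  nlinarith

/-- The corresponding inequality for the sign graph. -/
lemma sgn_mul_ge {β a b A B e f z w : ℝ} (hβ : 1 ≤ β) (hab : a - b = A - B)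
    (hz : z ∈ sgnSet a) (hw : w ∈ sgnSet b) (he : 0 ≤ e) (hf : 0 ≤ f) :
    -((|A| ^ β + |B| ^ β) * |e - f|) ≤
      (z - w) * (spow (β - 1) A * e - spow (β - 1) B * f) := by
  obtain ⟨hz1, hz2, hz3⟩ := hz
  obtain ⟨hw1, hw2, hw3⟩ := hw
  rw [mem_Icc] at hz3 hw3
  -- Monotonicity of the sign graph: any selections z, w are ordered like a, b, hence like A, B,
  -- because a - b = A - B.
  have hgood : 0 ≤ (z - w) * (spow (β - 1) A - spow (β - 1) B) := by
    rcases lt_trichotomy a b with h | h | h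
    · have : z ≤ w := by
        rcases lt_or_ge a 0 with h0 | h0
        · rw [hz2 h0]; exact hw3.1
        · rw [hw1 (by linarith)]; exact hz3.2
      have := spow_mono hβ (by linarith : A ≤ B)
      nlinarith
    · have : A = B := by linarith
      simp [this]
    · have : w ≤ z := by
        rcases lt_or_ge 0 a with h0 | h0
        · rw [hz1 h0]; exact hw3.2
        · rw [hw2 (by linarith)]; exact hz3.1
      have := spow_mono hβ (by linarith : B ≤ A)
      nlinarith
  have hbad : -((|A| ^ β + |B| ^ β) * |e - f|) ≤
      (z - w) * ((spow (β - 1) A + spow (β - 1) B) * ((e - f) / 2)) := by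
    apply neg_le_of_abs_le
    rw [abs_mul, abs_mul, abs_div, abs_two]
    have h1 : |z - w| ≤ 2 := by rw [abs_le]; constructor <;> linarith
    have h2 : |spow (β - 1) A + spow (β - 1) B| ≤ |A| ^ β + |B| ^ β := by
      refine (abs_add_le _ _).trans ?_
      rw [abs_spow (by linarith), abs_spow (by linarith), sub_add_cancel]
    calc _ ≤ 2 * ((|A| ^ β + |B| ^ β) * (|e - f| / 2)) := by gcongr
      _ = _ := by ring
  have := mul_nonneg hgood (by linarith : 0 ≤ (e + f) / 2)
  nlinarith

lemma add_rpow_le_two_rpow {x y q : ℝ} (hx : 0 ≤ x) (hy : 0 ≤ y) (hq : 0 ≤ q) :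
    (x + y) ^ q ≤ 2 ^ q * (x ^ q + y ^ q) := by
  wlog h : x ≤ y generalizing x y
  · rw [add_comm, add_comm (x ^ q)]; exact this hy hx (by linarith)
  calc (x + y) ^ q ≤ (2 * y) ^ q := by gcongr; linarith
    _ = 2 ^ q * y ^ q := Real.mul_rpow (by norm_num) hy
    _ ≤ _ := by gcongr; have : 0 ≤ x ^ q := by positivity
                linarith

open Metric

variable {N : ℕ}

/-! ### Integrals of powers and of differences -/

lemma lintegral_ball_rpow_lt_top (hN : 1 ≤ N) {e : ℝ} (he : e < N) (ρ : ℝ) :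
    ∫⁻ z in ball (0 : E N) ρ, ENNReal.ofReal (‖z‖ ^ (-e)) < ∞ := by
  have h := integrableOn_ball_of_norm_le_rpow (μ := (volume : Measure (E N)))
    (f := fun z : E N => ‖z‖ ^ (-e)) (C := 1) (α := e) (r := ρ) (by simpa using hN)
    (by simpa using he) (by
      refine Filter.Eventually.of_forall fun x => ?_
      rw [Real.norm_of_nonneg (by positivity), one_mul]) (by
      exact (measurable_norm.pow_const _).aestronglyMeasurable)
  have := h.hasFiniteIntegral
  rw [hasFiniteIntegral_iff_ofReal] at this
  · exact this
  · exact Filter.Eventually.of_forall fun x => by positivity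

/-- On the set of integration δ ≤ 1 gives (δ/2)(1+|x-y|) ≤ |x-y|, so the kernel is compared with the
integrable function (1+|z|)^{-e}. The power δ^{-e} is not the sharp δ^{N-e}, but any negative power
is absorbed in the final exponent κ. -/
lemma exists_lintegral_compl_ball_rpow_le {e : ℝ} (he : N < e) :
    ∃ C : ℝ, 0 ≤ C ∧ ∀ δ : ℝ, 0 < δ → δ ≤ 1 → ∀ x : E N,
      ∫⁻ y in {y | δ ≤ ‖x - y‖}, ENNReal.ofReal (‖x - y‖ ^ (-e)) ≤
        ENNReal.ofReal (C * δ ^ (-e)) := by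
  have he0 : 0 < e := lt_of_le_of_lt (Nat.cast_nonneg _) he
  have hfin := finite_integral_one_add_norm (E := E N) (μ := volume) (r := e) (by simpa using he)
  refine ⟨2 ^ e * (∫⁻ z : E N, ENNReal.ofReal ((1 + ‖z‖) ^ (-e))).toReal, by positivity, ?_⟩
  intro δ hδ hδ1 x
  calc ∫⁻ y in {y | δ ≤ ‖x - y‖}, ENNReal.ofReal (‖x - y‖ ^ (-e))
      ≤ ∫⁻ y in {y | δ ≤ ‖x - y‖},
          ENNReal.ofReal (2 ^ e * δ ^ (-e)) * ENNReal.ofReal ((1 + ‖x - y‖) ^ (-e)) := by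
        refine setLIntegral_mono' (measurableSet_le measurable_const (by fun_prop)) ?_
        intro y hy
        rw [mem_ofPred_eq] at hy
        rw [← ENNReal.ofReal_mul (by positivity)]
        apply ENNReal.ofReal_le_ofReal
        have h0 : 0 < ‖x - y‖ := hδ.trans_le hy
        have h1 : δ / 2 * (1 + ‖x - y‖) ≤ ‖x - y‖ := by nlinarith
        calc ‖x - y‖ ^ (-e) ≤ (δ / 2 * (1 + ‖x - y‖)) ^ (-e) :=
              Real.rpow_le_rpow_of_nonpos (by positivity) h1 (by linarith)
          _ = _ := by
            rw [Real.mul_rpow (by positivity) (by positivity), Real.div_rpow hδ.le (by norm_num),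
              Real.rpow_neg (by norm_num : (0 : ℝ) ≤ 2) e]
            field_simp
    _ ≤ ∫⁻ y, ENNReal.ofReal (2 ^ e * δ ^ (-e)) * ENNReal.ofReal ((1 + ‖x - y‖) ^ (-e)) :=
        setLIntegral_le_lintegral _ _
    _ = ENNReal.ofReal (2 ^ e * δ ^ (-e)) * ∫⁻ y : E N, ENNReal.ofReal ((1 + ‖y‖) ^ (-e)) := by
        rw [lintegral_const_mul _ (by fun_prop)]
        congr 1
        exact lintegral_sub_left_eq_self (fun y : E N => ENNReal.ofReal ((1 + ‖y‖) ^ (-e))) x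
    _ = _ := by
        rw [show ∀ c : ℝ, 2 ^ e * c * δ ^ (-e) = 2 ^ e * δ ^ (-e) * c by intro c; ring,
          ENNReal.ofReal_mul (p := 2 ^ e * δ ^ (-e)) (by positivity),
          ENNReal.ofReal_toReal hfin.ne]

lemma setLIntegral_ball_add_le (G : E N → ℝ≥0∞) (x₀ h : E N) (r : ℝ) :
    ∫⁻ x in ball x₀ r, G (x + h) ≤ ∫⁻ x in ball x₀ (r + ‖h‖), G x := by
  rw [← lintegral_indicator measurableSet_ball, ← lintegral_indicator measurableSet_ball,
    ← lintegral_add_right_eq_self ((ball x₀ (r + ‖h‖)).indicator G) h]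
  refine lintegral_mono fun x => ?_
  by_cases hx : x ∈ ball x₀ r
  · have : x + h ∈ ball x₀ (r + ‖h‖) := by
      rw [mem_ball, dist_eq_norm] at *
      calc ‖x + h - x₀‖ = ‖(x - x₀) + h‖ := by congr 1; abel
        _ ≤ ‖x - x₀‖ + ‖h‖ := norm_add_le _ _
        _ < _ := by linarith
    simp [hx, this]
  · simp [hx]

/-- Tonelli after the substitution y = x + k. It turns integrals over pairs into integrals over
increments, the form in which a modulus of continuity in L^q can be inserted. -/
lemma setLIntegral_pair_eq {B : Set (E N)} (hB : MeasurableSet B) {f : E N → E N → ℝ≥0∞}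
    (hf : Measurable (Function.uncurry f)) :
    ∫⁻ x in B, ∫⁻ y in B, f x y = ∫⁻ k, ∫⁻ x in B ∩ {x | x + k ∈ B}, f x (x + k) := by
  have hm : Measurable fun z : E N × E N =>
      B.indicator (fun x => B.indicator (f x) (x + z.1)) z.2 := by
    have : (fun z : E N × E N => B.indicator (fun x => B.indicator (f x) (x + z.1)) z.2) =
        ({z : E N × E N | z.2 ∈ B} ∩ {z | z.2 + z.1 ∈ B}).indicator
          (fun z => f z.2 (z.2 + z.1)) := by
      ext z
      by_cases h1 : z.2 ∈ B <;> by_cases h2 : z.2 + z.1 ∈ B <;> simp [indicator, h1, h2]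
    rw [this]
    refine Measurable.indicator ?_ ?_
    · exact hf.comp (measurable_snd.prodMk (measurable_snd.add measurable_fst))
    · exact (measurable_snd hB).inter ((measurable_snd.add measurable_fst) hB)
  calc ∫⁻ x in B, ∫⁻ y in B, f x y
      = ∫⁻ x in B, ∫⁻ k, B.indicator (f x) (x + k) := by
        refine lintegral_congr fun x => ?_
        rw [← lintegral_indicator hB]
        exact (lintegral_add_left_eq_self _ x).symm
    _ = ∫⁻ x, ∫⁻ k, B.indicator (fun x => B.indicator (f x) (x + k)) x := by
        rw [← lintegral_indicator hB]
        refine lintegral_congr fun x => ?_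
        by_cases hx : x ∈ B <;> simp [hx]
    _ = ∫⁻ k, ∫⁻ x, B.indicator (fun x => B.indicator (f x) (x + k)) x :=
        lintegral_lintegral_swap (hm.comp measurable_swap).aemeasurable
    _ = _ := by
        refine lintegral_congr fun k => ?_
        have : MeasurableSet (B ∩ {x | x + k ∈ B}) :=
          hB.inter ((measurable_id.add_const k) hB)
        rw [← lintegral_indicator this]
        refine lintegral_congr fun x => ?_
        by_cases h1 : x ∈ B <;> by_cases h2 : x + k ∈ B <;> simp [indicator, h1, h2]

/-- `L^q` modulus of continuity of order `θ` on `B`. -/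
def Nik (u : E N → ℝ) (B : Set (E N)) (θ q K : ℝ) : Prop :=
  ∀ k : E N, ∫⁻ x in B ∩ {x | x + k ∈ B}, ENNReal.ofReal (|u (x + k) - u x| ^ q) ≤
    ENNReal.ofReal (K * ‖k‖ ^ (θ * q))

/-- With y = x + k the weight depends on k only and leaves the inner integral, to which the modulus
applies. Two points of a ball of radius at most 1 differ by less than 2, hence the domain of k. -/
lemma Nik.lintegral_pair_le {u : E N → ℝ} {x₀ : E N} {r θ q K : ℝ}
    (h : Nik u (ball x₀ r) θ q K) (hu : Measurable u) (hr : r ≤ 1) {W : ℝ → ℝ≥0∞}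
    (hW : Measurable W) :
    ∫⁻ x in ball x₀ r, ∫⁻ y in ball x₀ r, ENNReal.ofReal (|u x - u y| ^ q) * W ‖x - y‖ ≤
      ∫⁻ k in ball (0 : E N) 2, ENNReal.ofReal (K * ‖k‖ ^ (θ * q)) * W ‖k‖ := by
  rw [setLIntegral_pair_eq measurableSet_ball (by unfold Function.uncurry; fun_prop),
    ← lintegral_indicator measurableSet_ball]
  refine lintegral_mono fun k => ?_
  by_cases hk : k ∈ ball (0 : E N) 2
  · rw [indicator_of_mem hk]
    have : ∀ x : E N, ENNReal.ofReal (|u x - u (x + k)| ^ q) * W ‖x - (x + k)‖ =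
        ENNReal.ofReal (|u (x + k) - u x| ^ q) * W ‖k‖ := by
      intro x
      rw [abs_sub_comm, sub_add_cancel_left, norm_neg]
    simp_rw [this]
    rw [lintegral_mul_const _ (by fun_prop)]
    gcongr
    exact h k
  · have : ball x₀ r ∩ {x | x + k ∈ ball x₀ r} = ∅ := by
      ext x
      simp only [mem_inter_iff, mem_ofPred_eq, mem_empty_iff_false, iff_false, not_and]
      intro h1 h2
      apply hk
      rw [mem_ball, dist_eq_norm] at *
      calc ‖k - 0‖ = ‖(x + k - x₀) - (x - x₀)‖ := by congr 1; abel
        _ ≤ ‖x + k - x₀‖ + ‖x - x₀‖ := norm_sub_le _ _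
        _ < 2 := by linarith
    rw [this]
    simp

lemma lintegral_const_mul_add {α : Type*} [MeasurableSpace α] (c : ℝ≥0∞) {f g : α → ℝ≥0∞}
    (hf : Measurable f) (hg : Measurable g) (μ : Measure α) :
    ∫⁻ x, c * (f x + g x) ∂μ = c * ((∫⁻ x, f x ∂μ) + ∫⁻ x, g x ∂μ) := by
  rw [← lintegral_add_left hf]
  exact lintegral_const_mul c (hf.add hg)

/-- A difference is controlled by the differences over all pairs of nearby points. -/
lemma lintegral_diff_le_pair {A : E N → ℝ} (hA : Measurable A) (x₀ h : E N) (r : ℝ) {q : ℝ}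
    (hq : 0 ≤ q) :
    volume (ball (0 : E N) ‖h‖) * ∫⁻ x in ball x₀ r, ENNReal.ofReal (|A (x + h) - A x| ^ q) ≤
      ENNReal.ofReal (2 ^ q) * (2 * ∫⁻ x in ball x₀ (r + ‖h‖), ∫⁻ y in ball x₀ (r + ‖h‖),
        ENNReal.ofReal (|A x - A y| ^ q) * (Iio (2 * ‖h‖)).indicator 1 ‖x - y‖) := by
  set F : E N → E N → ℝ≥0∞ := fun x y =>
    ENNReal.ofReal (|A x - A y| ^ q) * (Iio (2 * ‖h‖)).indicator 1 ‖x - y‖ with hF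
  have hind : Measurable ((Iio (2 * ‖h‖)).indicator (1 : ℝ → ℝ≥0∞)) :=
    measurable_one.indicator measurableSet_Iio
  have hFm : Measurable (Function.uncurry F) := by
    unfold Function.uncurry
    refine Measurable.mul (by fun_prop) (hind.comp (by fun_prop))
  set G : E N → ℝ≥0∞ := fun x => ∫⁻ y in ball x₀ (r + ‖h‖), F x y with hG
  have hGm : Measurable G := hFm.lintegral_prod_right'
  have hF1 : ∀ x, Measurable (F x) := fun x => hFm.of_uncurry_left
  -- For every y within |h| of x, the difference A(x+h) - A(x) is split through A(y); both pairs
  -- have distance below 2|h|. The inequality is then integrated over such y.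
  have key : ∀ x ∈ ball x₀ r, volume (ball (0 : E N) ‖h‖) * ENNReal.ofReal (|A (x + h) - A x| ^ q) ≤
      ENNReal.ofReal (2 ^ q) * (G (x + h) + G x) := by
    intro x hx
    rw [mem_ball, dist_eq_norm] at hx
    calc _ = ∫⁻ y in ball x ‖h‖, ENNReal.ofReal (|A (x + h) - A x| ^ q) := by
          rw [setLIntegral_const, Measure.addHaar_ball_center volume x, mul_comm]
      _ ≤ ∫⁻ y in ball x ‖h‖, ENNReal.ofReal (2 ^ q) * (F (x + h) y + F x y) := by
          refine setLIntegral_mono' measurableSet_ball fun y hy => ?_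
          rw [mem_ball, dist_eq_norm] at hy
          have h1 : ‖x - y‖ < 2 * ‖h‖ := by
            rw [norm_sub_rev]; linarith [norm_nonneg h]
          have h2 : ‖x + h - y‖ < 2 * ‖h‖ := by
            calc ‖x + h - y‖ = ‖h - (y - x)‖ := by congr 1; abel
              _ ≤ ‖h‖ + ‖y - x‖ := norm_sub_le _ _
              _ < _ := by linarith
          rw [hF]
          simp only [indicator_of_mem (mem_Iio.2 h1), indicator_of_mem (mem_Iio.2 h2),
            Pi.one_apply, mul_one]
          rw [← ENNReal.ofReal_add (by positivity) (by positivity),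
            ← ENNReal.ofReal_mul (by positivity)]
          apply ENNReal.ofReal_le_ofReal
          refine le_trans ?_ (add_rpow_le_two_rpow (abs_nonneg _) (abs_nonneg _) hq)
          refine Real.rpow_le_rpow (abs_nonneg _) ?_ hq
          rw [abs_sub_comm (A x)]
          refine le_trans (le_of_eq ?_) (abs_add_le _ _)
          congr 1; ring
      _ = ENNReal.ofReal (2 ^ q) * ((∫⁻ y in ball x ‖h‖, F (x + h) y) + ∫⁻ y in ball x ‖h‖, F x y) := by
          exact lintegral_const_mul_add _ (hF1 _) (hF1 _) _
      _ ≤ _ := by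
          have : ball x ‖h‖ ⊆ ball x₀ (r + ‖h‖) := ball_subset_ball' (by
            rw [dist_eq_norm]; linarith)
          gcongr
          · exact lintegral_mono_set this
          · exact lintegral_mono_set this
  change _ ≤ ENNReal.ofReal (2 ^ q) * (2 * ∫⁻ x in ball x₀ (r + ‖h‖), G x)
  clear_value G
  have hAm : Measurable fun x => ENNReal.ofReal (|A (x + h) - A x| ^ q) := by fun_prop
  have hGh : Measurable fun x => G (x + h) := hGm.comp (measurable_id.add_const h)
  calc volume (ball (0 : E N) ‖h‖) * ∫⁻ x in ball x₀ r, ENNReal.ofReal (|A (x + h) - A x| ^ q)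
      = ∫⁻ x in ball x₀ r,
        volume (ball (0 : E N) ‖h‖) * ENNReal.ofReal (|A (x + h) - A x| ^ q) := by
        rw [lintegral_const_mul _ hAm]
    _ ≤ ∫⁻ x in ball x₀ r, ENNReal.ofReal (2 ^ q) * (G (x + h) + G x) :=
        setLIntegral_mono' measurableSet_ball key
    _ = ENNReal.ofReal (2 ^ q) * ((∫⁻ x in ball x₀ r, G (x + h)) + ∫⁻ x in ball x₀ r, G x) := by
        exact lintegral_const_mul_add _ hGh hGm _
    _ ≤ _ := by
        rw [two_mul]
        refine mul_le_mul_right (add_le_add (setLIntegral_ball_add_le G x₀ h r)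
          (lintegral_mono_set (ball_subset_ball (le_add_of_nonneg_right (norm_nonneg h))))) _

lemma two_mul_ofReal (a : ℝ) : 2 * ENNReal.ofReal a = ENNReal.ofReal (2 * a) := by
  rw [ENNReal.ofReal_mul (by norm_num), ENNReal.ofReal_ofNat]

/-- The tail of a bounded function with controlled tail, seen from an interior point. -/
lemma exists_tail_le {p e : ℝ} (hp : 1 < p) (he : N < e) :
    ∃ C : ℝ, 0 ≤ C ∧ ∀ (u : E N → ℝ) (x₀ : E N) (R T : ℝ), 0 ≤ T → R ≤ 1 →
      (∀ x ∈ ball x₀ R, |u x| ≤ 1) →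
      ∫⁻ y in (ball x₀ R)ᶜ, ENNReal.ofReal (|u y| ^ (p - 1) / ‖y - x₀‖ ^ e) ≤ ENNReal.ofReal T →
      ∀ x ∈ ball x₀ R, ∀ δ : ℝ, 0 < δ → δ ≤ 1 →
        ∫⁻ y in {y | δ ≤ ‖x - y‖}, ENNReal.ofReal ((1 + |u y| ^ (p - 1)) * ‖x - y‖ ^ (-e)) ≤
          ENNReal.ofReal (C * δ ^ (-e) * (1 + T)) := by
  obtain ⟨C, hC, hCle⟩ := exists_lintegral_compl_ball_rpow_le he
  have he0 : 0 < e := lt_of_le_of_lt (Nat.cast_nonneg _) he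
  refine ⟨2 * C + 2 ^ e, by positivity, ?_⟩
  intro u x₀ R T hT hR hu htail x hx δ hδ hδ1
  set S : Set (E N) := {y | δ ≤ ‖x - y‖}
  have hS : MeasurableSet S := measurableSet_le measurable_const (by fun_prop)
  calc ∫⁻ y in S, ENNReal.ofReal ((1 + |u y| ^ (p - 1)) * ‖x - y‖ ^ (-e))
      ≤ ∫⁻ y in S, (2 * ENNReal.ofReal (‖x - y‖ ^ (-e)) + (ball x₀ R)ᶜ.indicator (fun y =>
          ENNReal.ofReal (2 ^ e * δ ^ (-e)) * ENNReal.ofReal (|u y| ^ (p - 1) / ‖y - x₀‖ ^ e)) y) := by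
        refine setLIntegral_mono' hS fun y hy => ?_
        have h0 : 0 < ‖x - y‖ := hδ.trans_le hy
        by_cases hyB : y ∈ ball x₀ R
        · rw [indicator_of_notMem (by simpa using hyB), add_zero, two_mul_ofReal]
          apply ENNReal.ofReal_le_ofReal
          have : |u y| ^ (p - 1) ≤ 1 := Real.rpow_le_one (abs_nonneg _) (hu y hyB) (by linarith)
          gcongr
          linarith
        · rw [indicator_of_mem (by simpa using hyB), add_mul, one_mul,
            ENNReal.ofReal_add (by positivity) (by positivity)]
          refine add_le_add (le_mul_of_one_le_left (by positivity) (by norm_num)) ?_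
          rw [← ENNReal.ofReal_mul (by positivity)]
          apply ENNReal.ofReal_le_ofReal
          rw [div_eq_mul_inv, ← Real.rpow_neg (norm_nonneg _)]
          have hyS : δ ≤ ‖x - y‖ := hy
          -- Since |x - x₀| < R ≤ 1 and δ ≤ 1, moving the centre of the tail from x₀ to x costs only
          -- a factor 2/δ.
          have hle : δ / 2 * ‖y - x₀‖ ≤ ‖x - y‖ := by
            rw [mem_ball, dist_eq_norm] at hx
            have : ‖y - x₀‖ ≤ ‖x - y‖ + 1 := by
              calc ‖y - x₀‖ = ‖(x - x₀) - (x - y)‖ := by congr 1; abel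
                _ ≤ ‖x - x₀‖ + ‖x - y‖ := norm_sub_le _ _
                _ ≤ _ := by linarith
            nlinarith
          have hpos : 0 < ‖y - x₀‖ := by
            rw [mem_ball, dist_eq_norm, not_lt] at hyB
            have : 0 < R := by
              rw [mem_ball] at hx; exact dist_nonneg.trans_lt hx
            linarith
          have : ‖x - y‖ ^ (-e) ≤ 2 ^ e * δ ^ (-e) * ‖y - x₀‖ ^ (-e) := by
            calc ‖x - y‖ ^ (-e) ≤ (δ / 2 * ‖y - x₀‖) ^ (-e) :=
                  Real.rpow_le_rpow_of_nonpos (by positivity) hle (by linarith)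
              _ = _ := by
                rw [Real.mul_rpow (by positivity) (by positivity),
                  Real.div_rpow hδ.le (by norm_num), Real.rpow_neg (by norm_num : (0 : ℝ) ≤ 2) e]
                field_simp
          calc _ ≤ |u y| ^ (p - 1) * (2 ^ e * δ ^ (-e) * ‖y - x₀‖ ^ (-e)) := by gcongr
            _ = _ := by ring
    _ = 2 * (∫⁻ y in S, ENNReal.ofReal (‖x - y‖ ^ (-e))) + ∫⁻ y in S, (ball x₀ R)ᶜ.indicator
          (fun y => ENNReal.ofReal (2 ^ e * δ ^ (-e)) *
            ENNReal.ofReal (|u y| ^ (p - 1) / ‖y - x₀‖ ^ e)) y := by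
        rw [lintegral_add_left (by fun_prop), lintegral_const_mul _ (by fun_prop)]
    _ ≤ 2 * ENNReal.ofReal (C * δ ^ (-e)) +
          ENNReal.ofReal (2 ^ e * δ ^ (-e)) * ENNReal.ofReal T := by
        gcongr
        · exact hCle δ hδ hδ1 x
        · refine (setLIntegral_le_lintegral _ _).trans ?_
          rw [lintegral_indicator measurableSet_ball.compl,
            lintegral_const_mul' _ _ ENNReal.ofReal_ne_top]
          gcongr
    _ ≤ _ := by
        rw [two_mul_ofReal,
          ← ENNReal.ofReal_mul (by positivity), ← ENNReal.ofReal_add (by positivity)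
            (by positivity)]
        apply ENNReal.ofReal_le_ofReal
        have h1 : 0 ≤ C * δ ^ (-e) := by positivity
        have h2 : 0 ≤ 2 ^ e * δ ^ (-e) := by positivity
        nlinarith [mul_nonneg h1 hT, mul_nonneg h2 hT]

/-! ### Double integrals and test functions -/

/-- The double integral `∫_S ∫_S |u(x) - u(y)|^q / |x - y|^e dx dy`. -/
def pairEnergy (e q : ℝ) (u : E N → ℝ) (S : Set (E N)) : ℝ≥0∞ :=
  ∫⁻ x in S, ∫⁻ y in S, ENNReal.ofReal (|u x - u y| ^ q) * ENNReal.ofReal (‖x - y‖ ^ (-e))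

lemma ofReal_div_rpow {a t : ℝ} (ha : 0 ≤ a) (ht : 0 ≤ t) (e : ℝ) :
    ENNReal.ofReal (a / t ^ e) = ENNReal.ofReal a * ENNReal.ofReal (t ^ (-e)) := by
  rw [← ENNReal.ofReal_mul ha, Real.rpow_neg ht, div_eq_mul_inv]

lemma setLIntegral_prod_eq {S : Set (E N)} {f : E N × E N → ℝ≥0∞} (hf : Measurable f) :
    ∫⁻ z in S ×ˢ S, f z = ∫⁻ x in S, ∫⁻ y in S, f (x, y) := by
  rw [Measure.volume_eq_prod, ← Measure.prod_restrict, lintegral_prod _ hf.aemeasurable]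

lemma lintegral_prod_self_eq {f : E N × E N → ℝ≥0∞} (hf : Measurable f) :
    ∫⁻ z, f z = ∫⁻ x, ∫⁻ y, f (x, y) := by
  rw [Measure.volume_eq_prod, lintegral_prod _ hf.aemeasurable]

lemma setLIntegral_gagliardo_eq {u : E N → ℝ} (hu : Measurable u) (S : Set (E N)) (e q : ℝ) :
    ∫⁻ z in S ×ˢ S, ENNReal.ofReal (|u z.1 - u z.2| ^ q / ‖z.1 - z.2‖ ^ e) =
      pairEnergy e q u S := by
  rw [setLIntegral_prod_eq (by fun_prop)]
  unfold pairEnergy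
  simp_rw [ofReal_div_rpow (Real.rpow_nonneg (abs_nonneg _) q) (norm_nonneg _)]

/-- A double integral splits into its part over `S × S` and two symmetric cross parts. -/
lemma lintegral_pair_le_split {S : Set (E N)} (hS : MeasurableSet S) {F F₁ F₂ : E N → E N → ℝ≥0∞}
    (hF : Measurable (Function.uncurry F)) (hF₂ : Measurable (Function.uncurry F₂))
    (h₁ : ∀ x ∈ S, ∀ y ∈ S, F x y ≤ F₁ x y) (h₂ : ∀ x ∈ S, ∀ y ∉ S, F x y ≤ F₂ x y)
    (h₃ : ∀ x ∈ S, ∀ y ∉ S, F y x ≤ F₂ x y) (h₀ : ∀ x ∉ S, ∀ y ∉ S, F x y = 0) :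
    ∫⁻ x, ∫⁻ y, F x y ≤
      (∫⁻ x in S, ∫⁻ y in S, F₁ x y) + 2 * ∫⁻ x in S, ∫⁻ y in Sᶜ, F₂ x y := by
  have hin : ∀ T : Set (E N), Measurable fun x => ∫⁻ y in T, F x y := fun T =>
    hF.lintegral_prod_right'
  have e1 : ∫⁻ x, ∫⁻ y, F x y =
      ((∫⁻ x in S, ∫⁻ y in S, F x y) + ∫⁻ x in S, ∫⁻ y in Sᶜ, F x y) +
      ((∫⁻ x in Sᶜ, ∫⁻ y in S, F x y) + ∫⁻ x in Sᶜ, ∫⁻ y in Sᶜ, F x y) := by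
    rw [← lintegral_add_left (hin S), ← lintegral_add_left (hin S), ← lintegral_add_compl _ hS]
    simp_rw [lintegral_add_compl _ hS]
  have e2 : ∫⁻ x in S, ∫⁻ y in S, F x y ≤ ∫⁻ x in S, ∫⁻ y in S, F₁ x y :=
    setLIntegral_mono' hS fun x hx => setLIntegral_mono' hS fun y hy => h₁ x hx y hy
  have e3 : ∫⁻ x in S, ∫⁻ y in Sᶜ, F x y ≤ ∫⁻ x in S, ∫⁻ y in Sᶜ, F₂ x y :=
    setLIntegral_mono' hS fun x hx => setLIntegral_mono' hS.compl fun y hy => h₂ x hx y hy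
  have e4 : ∫⁻ x in Sᶜ, ∫⁻ y in S, F x y ≤ ∫⁻ x in S, ∫⁻ y in Sᶜ, F₂ x y := by
    calc ∫⁻ x in Sᶜ, ∫⁻ y in S, F x y ≤ ∫⁻ x in Sᶜ, ∫⁻ y in S, F₂ y x :=
          setLIntegral_mono' hS.compl fun x hx => setLIntegral_mono' hS fun y hy => h₃ y hy x hx
      _ = _ := lintegral_lintegral_swap (hF₂.comp measurable_swap).aemeasurable
  have e5 : ∫⁻ x in Sᶜ, ∫⁻ y in Sᶜ, F x y = 0 := by
    rw [setLIntegral_congr_fun hS.compl (g := fun _ => 0), lintegral_zero]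
    intro x hx
    change ∫⁻ y in Sᶜ, F x y = 0
    rw [setLIntegral_congr_fun hS.compl (g := fun _ => 0), lintegral_zero]
    intro y hy
    exact h₀ x hx y hy
  rw [e1, e5, add_zero, two_mul, add_assoc]
  gcongr

lemma le_norm_sub_of_mem_of_notMem {x₀ x y : E N} {ρ r : ℝ} (hx : x ∈ closedBall x₀ ρ)
    (hy : y ∉ ball x₀ r) : r - ρ ≤ ‖x - y‖ := by
  rw [mem_closedBall, dist_eq_norm] at hx
  rw [mem_ball, dist_eq_norm, not_lt] at hy
  have : ‖y - x₀‖ ≤ ‖x - x₀‖ + ‖x - y‖ := by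
    calc ‖y - x₀‖ = ‖(x - x₀) - (x - y)‖ := by congr 1; abel
      _ ≤ _ := norm_sub_le _ _
  linarith

/-- The double integral of a weight vanishing at small distances. -/
lemma lintegral_cross_lt_top {e : ℝ} (he : N < e) (x₀ : E N) {ρ r : ℝ} (hρ : ρ < r) :
    ∫⁻ x in ball x₀ r, ∫⁻ y in (ball x₀ r)ᶜ, (closedBall x₀ ρ).indicator 1 x *
      ENNReal.ofReal (‖x - y‖ ^ (-e)) < ∞ := by
  obtain ⟨C, hC, hCle⟩ := exists_lintegral_compl_ball_rpow_le he
  set δ := min (r - ρ) 1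
  have hδ : 0 < δ := lt_min (by linarith) one_pos
  calc _ ≤ ∫⁻ x in ball x₀ r, ENNReal.ofReal (C * δ ^ (-e)) := by
        refine lintegral_mono fun x => ?_
        by_cases hx : x ∈ closedBall x₀ ρ
        · simp only [indicator_of_mem hx, Pi.one_apply, one_mul]
          refine le_trans (lintegral_mono_set ?_) (hCle δ hδ (min_le_right _ _) x)
          intro y hy
          exact (min_le_left _ _).trans (le_norm_sub_of_mem_of_notMem hx hy)
        · simp [indicator_of_notMem hx]
    _ < ∞ := by
        rw [setLIntegral_const]
        exact ENNReal.mul_lt_top ENNReal.ofReal_lt_top measure_ball_lt_top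

lemma pairEnergy_id_lt_top (hN : 1 ≤ N) {e m : ℝ} (he : e - m < N) (hm : 0 < m) (x₀ : E N) (r : ℝ) :
    ∫⁻ x in ball x₀ r, ∫⁻ y in ball x₀ r,
      ENNReal.ofReal (‖x - y‖ ^ m) * ENNReal.ofReal (‖x - y‖ ^ (-e)) < ∞ := by
  have hfin := lintegral_ball_rpow_lt_top hN he (2 * r)
  calc _ ≤ ∫⁻ x in ball x₀ r, ∫⁻ z in ball (0 : E N) (2 * r), ENNReal.ofReal (‖z‖ ^ (-(e - m))) := by
        refine setLIntegral_mono' measurableSet_ball fun x hx => ?_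
        rw [← lintegral_indicator measurableSet_ball, ← lintegral_indicator measurableSet_ball,
          ← lintegral_sub_left_eq_self _ x]
        refine lintegral_mono fun y => ?_
        by_cases hy : x - y ∈ ball x₀ r
        · have : y ∈ ball (0 : E N) (2 * r) := by
            rw [mem_ball, dist_eq_norm] at *
            calc ‖y - 0‖ = ‖(x - x₀) - (x - y - x₀)‖ := by congr 1; abel
              _ ≤ _ := norm_sub_le _ _
              _ < _ := by linarith
          rw [indicator_of_mem hy, indicator_of_mem this, ← ENNReal.ofReal_mul (by positivity),
            sub_sub_cancel]
          apply ENNReal.ofReal_le_ofReal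
          rcases (norm_nonneg y).eq_or_lt with h0 | h0
          · rw [← h0, Real.zero_rpow hm.ne', zero_mul]
            positivity
          · rw [← Real.rpow_add h0]
            apply le_of_eq; ring_nf
        · rw [indicator_of_notMem hy]
          positivity
    _ < ∞ := by
        rw [setLIntegral_const]
        exact ENNReal.mul_lt_top hfin measure_ball_lt_top

lemma abs_mul_sub_mul_le {a b e f M L d : ℝ} (he : |e| ≤ 1) (hb : |b| ≤ M) (hef : |e - f| ≤ L * d) :
    |a * e - b * f| ≤ |a - b| + M * (L * d) := by
  calc |a * e - b * f| = |(a - b) * e + b * (e - f)| := by congr 1; ring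
    _ ≤ |a - b| * |e| + |b| * |e - f| := by
        rw [← abs_mul, ← abs_mul]; exact abs_add_le _ _
    _ ≤ |a - b| * 1 + M * (L * d) := by
        have : 0 ≤ M := (abs_nonneg _).trans hb
        gcongr
    _ = _ := by ring

/-- Multiplication by a Lipschitz cutoff preserves finite Gagliardo energy. -/
lemma pairEnergy_mul_cutoff_lt_top (hN : 1 ≤ N) {σ m M L ρ r : ℝ} (hσ : σ ∈ Ioo (0 : ℝ) 1)
    (hm : 1 ≤ m) {x₀ : E N} {f η : E N → ℝ} (hf : Measurable f) (hη : Measurable η)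
    (hfM : ∀ x ∈ ball x₀ r, |f x| ≤ M) (hfE : pairEnergy (N + σ * m) m f (ball x₀ r) < ∞)
    (hL : 0 ≤ L) (hηL : ∀ x y, |η x - η y| ≤ L * ‖x - y‖) (hη1 : ∀ x, |η x| ≤ 1)
    (hη0 : ∀ x ∉ closedBall x₀ ρ, η x = 0) (hρ : ρ < r) :
    pairEnergy (N + σ * m) m (fun x => f x * η x) univ < ∞ := by
  obtain ⟨hσ0, hσ1⟩ := hσ
  have hm0 : 0 < m := by linarith
  set e : ℝ := N + σ * m with he
  have heN : N < e := by rw [he]; nlinarith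
  have hsub : closedBall x₀ ρ ⊆ ball x₀ r := closedBall_subset_ball hρ
  -- A negative M forces `ball x₀ r` to be empty, and then f η vanishes identically.
  rcases lt_or_ge M 0 with hM | hM
  · have hz : ∀ x, f x * η x = 0 := fun x => by
      by_cases hx : x ∈ closedBall x₀ ρ
      · exact absurd (hfM x (hsub hx)) (not_le.2 (hM.trans_le (abs_nonneg _)))
      · rw [hη0 x hx, mul_zero]
    simp [pairEnergy, hz, Real.zero_rpow hm0.ne']
  unfold pairEnergy
  simp only [Measure.restrict_univ]
  set F₁ : E N → E N → ℝ≥0∞ := fun x y =>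
    ENNReal.ofReal (2 ^ m) * (ENNReal.ofReal (|f x - f y| ^ m) * ENNReal.ofReal (‖x - y‖ ^ (-e)) +
      ENNReal.ofReal ((M * L) ^ m) * (ENNReal.ofReal (‖x - y‖ ^ m) *
        ENNReal.ofReal (‖x - y‖ ^ (-e))))
  set F₂ : E N → E N → ℝ≥0∞ := fun x y => ENNReal.ofReal (M ^ m) *
    ((closedBall x₀ ρ).indicator 1 x * ENNReal.ofReal (‖x - y‖ ^ (-e)))
  have hind : Measurable fun z : E N × E N => (closedBall x₀ ρ).indicator (1 : E N → ℝ≥0∞) z.1 :=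
    (measurable_one.indicator measurableSet_closedBall).comp measurable_fst
  have hcross : ∀ x ∈ ball x₀ r, ∀ y ∉ ball x₀ r, |f x * η x - f y * η y| ^ m ≤
      M ^ m * (closedBall x₀ ρ).indicator 1 x := by
    intro x hx y hy
    rw [hη0 y (fun h => hy (hsub h)), mul_zero, sub_zero]
    by_cases hx' : x ∈ closedBall x₀ ρ
    · rw [indicator_of_mem hx', Pi.one_apply, mul_one, abs_mul]
      gcongr
      calc |f x| * |η x| ≤ M * 1 := by gcongr; exacts [hfM x hx, hη1 x]
        _ = M := mul_one M
    · rw [hη0 x hx']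
      simp [Real.zero_rpow hm0.ne', hx']
  have hcross' : ∀ x ∈ ball x₀ r, ∀ y ∉ ball x₀ r,
      ENNReal.ofReal (|f x * η x - f y * η y| ^ m) * ENNReal.ofReal (‖x - y‖ ^ (-e)) ≤ F₂ x y := by
    intro x hx y hy
    simp only [F₂]
    rw [← mul_assoc]
    gcongr
    refine (ENNReal.ofReal_le_ofReal (hcross x hx y hy)).trans ?_
    rw [ENNReal.ofReal_mul (by positivity)]
    gcongr
    by_cases hx' : x ∈ closedBall x₀ ρ <;> simp [hx']
  refine lt_of_le_of_lt (lintegral_pair_le_split (S := ball x₀ r) measurableSet_ball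
    (F₁ := F₁) (F₂ := F₂) (by unfold Function.uncurry; fun_prop) ?_ ?_ hcross' ?_ ?_) ?_
  · unfold Function.uncurry
    exact (hind.mul (by fun_prop)).const_mul _
  · intro x hx y hy
    have : |f x * η x - f y * η y| ^ m ≤ 2 ^ m * (|f x - f y| ^ m + (M * L) ^ m * ‖x - y‖ ^ m) := by
      rw [← Real.mul_rpow (by positivity) (norm_nonneg _)]
      refine le_trans ?_ (add_rpow_le_two_rpow (abs_nonneg _) (by positivity) hm0.le)
      gcongr
      rw [mul_assoc]
      exact abs_mul_sub_mul_le (hη1 x) (hfM y hy) (hηL x y)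
    calc _ ≤ ENNReal.ofReal (2 ^ m * (|f x - f y| ^ m + (M * L) ^ m * ‖x - y‖ ^ m)) *
          ENNReal.ofReal (‖x - y‖ ^ (-e)) := by gcongr
      _ = F₁ x y := by
        rw [ENNReal.ofReal_mul (by positivity), ENNReal.ofReal_add (by positivity) (by positivity),
          ENNReal.ofReal_mul (p := (M * L) ^ m) (by positivity)]
        simp only [F₁]; ring
  · intro x hx y hy
    rw [abs_sub_comm, norm_sub_rev]
    exact hcross' x hx y hy
  · intro x hx y hy
    rw [hη0 y (fun h => hy (hsub h)), hη0 x (fun h => hx (hsub h))]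
    simp [Real.zero_rpow hm0.ne']
  · refine ENNReal.add_lt_top.2 ⟨?_, ENNReal.mul_lt_top (by norm_num) ?_⟩
    · have h1 : ∀ x, ∫⁻ y in ball x₀ r, F₁ x y = ENNReal.ofReal (2 ^ m) *
          ((∫⁻ y in ball x₀ r, ENNReal.ofReal (|f x - f y| ^ m) * ENNReal.ofReal (‖x - y‖ ^ (-e))) +
          ENNReal.ofReal ((M * L) ^ m) * ∫⁻ y in ball x₀ r, (ENNReal.ofReal (‖x - y‖ ^ m) *
            ENNReal.ofReal (‖x - y‖ ^ (-e)))) := by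
        intro x
        rw [← lintegral_const_mul _ (by fun_prop)]
        exact lintegral_const_mul_add _ (by fun_prop) (by fun_prop) _
      simp_rw [h1]
      have hm1 : Measurable fun x => ∫⁻ y in ball x₀ r,
          ENNReal.ofReal (|f x - f y| ^ m) * ENNReal.ofReal (‖x - y‖ ^ (-e)) :=
        Measurable.lintegral_prod_right' (f := fun z : E N × E N =>
          ENNReal.ofReal (|f z.1 - f z.2| ^ m) * ENNReal.ofReal (‖z.1 - z.2‖ ^ (-e))) (by fun_prop)
      have hm2 : Measurable fun x : E N => ∫⁻ y in ball x₀ r, ENNReal.ofReal (‖x - y‖ ^ m) *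
            ENNReal.ofReal (‖x - y‖ ^ (-e)) :=
        Measurable.lintegral_prod_right' (f := fun z : E N × E N =>
          ENNReal.ofReal (‖z.1 - z.2‖ ^ m) * ENNReal.ofReal (‖z.1 - z.2‖ ^ (-e))) (by fun_prop)
      rw [lintegral_const_mul_add _ hm1 (hm2.const_mul _), lintegral_const_mul _ hm2]
      refine ENNReal.mul_lt_top ENNReal.ofReal_lt_top (ENNReal.add_lt_top.2 ⟨hfE,
        ENNReal.mul_lt_top ENNReal.ofReal_lt_top (pairEnergy_id_lt_top hN ?_ hm0 _ _)⟩)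
      rw [he]; nlinarith
    · simp only [F₂]
      simp_rw [lintegral_const_mul' _ _ ENNReal.ofReal_ne_top]
      exact ENNReal.mul_lt_top ENNReal.ofReal_lt_top (lintegral_cross_lt_top heN x₀ hρ)

/-- Translates of a function have the same energy on the whole space. -/
lemma pairEnergy_translate (e q : ℝ) (u : E N → ℝ) (h : E N) :
    pairEnergy e q (fun x => u (x - h)) univ = pairEnergy e q u univ := by
  unfold pairEnergy
  simp only [Measure.restrict_univ]
  rw [← lintegral_sub_right_eq_self (fun x => ∫⁻ y, ENNReal.ofReal (|u x - u y| ^ q) *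
    ENNReal.ofReal (‖x - y‖ ^ (-e))) h]
  refine lintegral_congr fun x => ?_
  rw [← lintegral_sub_right_eq_self (fun y => ENNReal.ofReal (|u (x - h) - u y| ^ q) *
    ENNReal.ofReal (‖x - h - y‖ ^ (-e))) h]
  refine lintegral_congr fun y => ?_
  rw [sub_sub_sub_cancel_right]

lemma memW_univ_of_bounded {σ m M ρ : ℝ} {x₀ : E N} {φ : E N → ℝ} (hφ : Measurable φ)
    (hM : ∀ x, |φ x| ≤ M) (hφ0 : ∀ x ∉ closedBall x₀ ρ, φ x = 0) (hm : 0 < m)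
    (hE : pairEnergy (N + σ * m) m φ univ < ∞) : MemW σ m φ univ := by
  refine ⟨?_, ?_⟩
  · rw [Measure.restrict_univ]
    have hsupp : HasCompactSupport φ :=
      HasCompactSupport.intro (isCompact_closedBall x₀ ρ) hφ0
    have h1 : MemLp φ (ENNReal.ofReal m) (volume.restrict (closedBall x₀ ρ)) := by
      have : IsFiniteMeasure ((volume : Measure (E N)).restrict (closedBall x₀ ρ)) :=
        isFiniteMeasure_restrict.2 measure_closedBall_lt_top.ne
      exact MemLp.of_bound hφ.aestronglyMeasurable M
        (Filter.Eventually.of_forall fun x => by rw [Real.norm_eq_abs]; exact hM x)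
    have h2 := (memLp_indicator_iff_restrict (μ := (volume : Measure (E N))) (f := φ)
      (p := ENNReal.ofReal m) (measurableSet_closedBall (x := x₀) (ε := ρ))).2 h1
    convert h2 using 1
    ext x
    by_cases hx : x ∈ closedBall x₀ ρ
    · rw [indicator_of_mem hx]
    · rw [indicator_of_notMem hx, hφ0 x hx]
  · unfold gagliardo
    rw [setLIntegral_gagliardo_eq hφ]
    exact ENNReal.rpow_lt_top_of_nonneg (by positivity) hE.ne

lemma isTest_of_bounded {s₁ s p M ρ R : ℝ} {x₀ : E N} {φ : E N → ℝ} (hφ : Measurable φ)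
    (hM : ∀ x, |φ x| ≤ M) (hφ0 : ∀ x ∉ closedBall x₀ ρ, φ x = 0) (hρ : ρ < R) (hp : 0 < p)
    (hE₁ : pairEnergy (N + s₁ * 1) 1 φ univ < ∞) (hE : pairEnergy (N + s * p) p φ univ < ∞) :
    IsTest s₁ s p (ball x₀ R) φ where
  memW_one := memW_univ_of_bounded hφ hM hφ0 one_pos hE₁
  memW := memW_univ_of_bounded hφ hM hφ0 hp hE
  hasCompactSupport := HasCompactSupport.intro (isCompact_closedBall x₀ ρ) hφ0
  tsupport_subset := by
    refine (closure_minimal ?_ isClosed_closedBall).trans (closedBall_subset_ball hρ)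
    intro x hx
    by_contra h
    exact hx (hφ0 x h)

/-! ### The energy estimate for difference quotients -/

lemma pairEnergy_mono_set {e q : ℝ} {u : E N → ℝ} {S T : Set (E N)} (h : S ⊆ T) :
    pairEnergy e q u S ≤ pairEnergy e q u T :=
  (lintegral_mono_set h).trans (lintegral_mono fun _ => lintegral_mono_set h)

lemma pairEnergy_shift_le (e q : ℝ) (u : E N → ℝ) (x₀ h : E N) (r : ℝ) :
    pairEnergy e q (fun x => u (x + h)) (ball x₀ r) ≤ pairEnergy e q u (ball x₀ (r + ‖h‖)) := by
  unfold pairEnergy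
  refine le_trans ?_ (setLIntegral_ball_add_le _ x₀ h r)
  refine lintegral_mono fun x => ?_
  refine le_trans (le_of_eq ?_) (setLIntegral_ball_add_le _ x₀ h r)
  refine lintegral_congr fun y => ?_
  rw [add_sub_add_right_eq_sub]

/-- A function that is Lipschitz on the range preserves finite fractional energy. With G an odd
power and f, g the translate of u and u itself, this makes |δ_h u|^{β-1} δ_h u admissible as a
factor of the test function. -/
lemma pairEnergy_comp_sub_le {e q L M : ℝ} (hq : 0 ≤ q) (hL : 0 ≤ L) {f g : E N → ℝ}
    (hf : Measurable f) (hg : Measurable g) {G : ℝ → ℝ} {S : Set (E N)} (hS : MeasurableSet S)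
    (hfg : ∀ x ∈ S, |f x - g x| ≤ M)
    (hG : ∀ a b, |a| ≤ M → |b| ≤ M → |G a - G b| ≤ L * |a - b|) :
    pairEnergy e q (fun x => G (f x - g x)) S ≤
      ENNReal.ofReal ((2 * L) ^ q) * (pairEnergy e q f S + pairEnergy e q g S) := by
  unfold pairEnergy
  have hm : ∀ u : E N → ℝ, Measurable u → Measurable fun x => ∫⁻ y in S,
          ENNReal.ofReal (|u x - u y| ^ q) * ENNReal.ofReal (‖x - y‖ ^ (-e)) := fun u hu =>
    Measurable.lintegral_prod_right' (f := fun z : E N × E N =>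
          ENNReal.ofReal (|u z.1 - u z.2| ^ q) * ENNReal.ofReal (‖z.1 - z.2‖ ^ (-e))) (by fun_prop)
  rw [← lintegral_const_mul_add _ (hm f hf) (hm g hg)]
  refine setLIntegral_mono' hS fun x hx => ?_
  rw [← lintegral_const_mul_add _ (by fun_prop) (by fun_prop)]
  refine setLIntegral_mono' hS fun y hy => ?_
  rw [← add_mul, ← mul_assoc, ← ENNReal.ofReal_add (by positivity) (by positivity),
    ← ENNReal.ofReal_mul (p := (2 * L) ^ q) (by positivity)]
  refine mul_le_mul_left (ENNReal.ofReal_le_ofReal ?_) _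
  calc |G (f x - g x) - G (f y - g y)| ^ q ≤ (L * (|f x - f y| + |g x - g y|)) ^ q := by
        gcongr
        refine (hG _ _ (hfg x hx) (hfg y hy)).trans ?_
        gcongr
        rw [show f x - g x - (f y - g y) = (f x - f y) - (g x - g y) by ring]
        exact abs_sub _ _
    _ = L ^ q * (|f x - f y| + |g x - g y|) ^ q := Real.mul_rpow hL (by positivity)
    _ ≤ L ^ q * (2 ^ q * (|f x - f y| ^ q + |g x - g y| ^ q)) := by
        gcongr
        exact add_rpow_le_two_rpow (abs_nonneg _) (abs_nonneg _) hq
    _ = _ := by rw [Real.mul_rpow (by norm_num) hL]; ring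

/-- A bounded weak solution of `l (-Δ_1)^{s₁} u + (-Δ_p)^s u = 0` in a ball, `0 ≤ l ≤ 1`,
with normalised size. -/
structure NormSol (s₁ s p l : ℝ) (x₀ : E N) (R : ℝ) (u : E N → ℝ) (Z : E N × E N → ℝ) : Prop where
  l_mem : l ∈ Icc (0 : ℝ) 1
  measurable_u : Measurable u
  measurable_Z : Measurable Z
  sgn : ∀ z : E N × E N, Z z ∈ sgnSet (u z.1 - u z.2)
  abs_le_one : ∀ x ∈ ball x₀ R, |u x| ≤ 1
  energy_one : pairEnergy (N + s₁ * 1) 1 u (ball x₀ R) < ∞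
  energy : pairEnergy (N + s * p) p u (ball x₀ R) ≤ 1
  tail_le : ∫⁻ x in (ball x₀ R)ᶜ, ENNReal.ofReal (|u x| ^ (p - 1) / ‖x - x₀‖ ^ ((N : ℝ) + s * p)) ≤
    ENNReal.ofReal (R ^ (-(s * p)))
  weak : ∀ φ : E N → ℝ, IsTest s₁ s p (ball x₀ R) φ →
    0 = l * (∫ z : E N × E N, Z z * ((φ z.1 - φ z.2) / ‖z.1 - z.2‖ ^ ((N : ℝ) + s₁))) +
      ∫ z : E N × E N, spow (p - 2) (u z.1 - u z.2) * (φ z.1 - φ z.2) /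
        ‖z.1 - z.2‖ ^ ((N : ℝ) + s * p)

variable {s₁ s p l R : ℝ} {x₀ : E N} {u : E N → ℝ} {Z : E N × E N → ℝ}

lemma NormSol.abs_Z_le (H : NormSol s₁ s p l x₀ R u Z) (z : E N × E N) : |Z z| ≤ 1 :=
  abs_le.2 (H.sgn z).2.2

lemma integrable_kernel_one (hZ : Measurable Z) (hZ1 : ∀ z, |Z z| ≤ 1) {φ : E N → ℝ}
    (hφ : Measurable φ) (hE : pairEnergy (N + s₁ * 1) 1 φ univ < ∞) :
    Integrable fun z : E N × E N => Z z * ((φ z.1 - φ z.2) / ‖z.1 - z.2‖ ^ ((N : ℝ) + s₁)) := by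
  have h : Integrable fun z : E N × E N => (φ z.1 - φ z.2) / ‖z.1 - z.2‖ ^ ((N : ℝ) + s₁) := by
    refine ⟨Measurable.aestronglyMeasurable (by fun_prop), ?_⟩
    rw [hasFiniteIntegral_iff_norm, lintegral_prod_self_eq (by fun_prop)]
    unfold pairEnergy at hE
    simp only [Measure.restrict_univ, mul_one, Real.rpow_one] at hE
    refine lt_of_eq_of_lt (lintegral_congr fun x => lintegral_congr fun y => ?_) hE
    rw [norm_div, Real.norm_eq_abs, Real.norm_of_nonneg (by positivity),
      ofReal_div_rpow (abs_nonneg _) (norm_nonneg _)]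
  refine h.bdd_mul (c := 1) hZ.aestronglyMeasurable (Filter.Eventually.of_forall fun z => ?_)
  rw [Real.norm_eq_abs]
  exact hZ1 z

/-- Inside the ball, Young's inequality with exponents p-1 and 1 dominates the integrand by the
p-energy densities of u and φ. Across its boundary, the support of φ keeps |x-y| bounded below, and
|u(x)-u(y)|^{p-1} ≤ 1 + |u(y)|^{p-1} leaves an integral controlled by the tail. -/
lemma NormSol.integrable_kernel_p (H : NormSol s₁ s p l x₀ R u Z) (hp : p ∈ Ioo (1 : ℝ) 2)
    (hs : 0 < s) (hR : R ≤ 1) {ρ M : ℝ} (hρ : ρ < R) {φ : E N → ℝ} (hφ : Measurable φ)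
    (hM : ∀ x, |φ x| ≤ M) (hφ0 : ∀ x ∉ closedBall x₀ ρ, φ x = 0)
    (hE : pairEnergy (N + s * p) p φ univ < ∞) :
    Integrable fun z : E N × E N => spow (p - 2) (u z.1 - u z.2) * (φ z.1 - φ z.2) /
        ‖z.1 - z.2‖ ^ ((N : ℝ) + s * p) := by
  have hu := H.measurable_u
  have hp1 := hp.1
  have hsub : closedBall x₀ ρ ⊆ ball x₀ R := closedBall_subset_ball hρ
  have hM0 : 0 ≤ M := (abs_nonneg _).trans (hM x₀)
  have heN : (N : ℝ) < N + s * p := by nlinarith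
  set e : ℝ := N + s * p
  have hJ : Measurable fun z : E N × E N => spow (p - 2) (u z.1 - u z.2) :=
    (measurable_spow _).comp (by fun_prop)
  have hmeas : Measurable fun z : E N × E N => spow (p - 2) (u z.1 - u z.2) * (φ z.1 - φ z.2) /
        ‖z.1 - z.2‖ ^ e := (hJ.mul (by fun_prop)).div (by fun_prop)
  refine ⟨hmeas.aestronglyMeasurable, ?_⟩
  rw [hasFiniteIntegral_iff_norm, lintegral_prod_self_eq (by fun_prop)]
  have hval : ∀ x y, ENNReal.ofReal ‖spow (p - 2) (u x - u y) * (φ x - φ y) / ‖x - y‖ ^ e‖ =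
      ENNReal.ofReal (|u x - u y| ^ (p - 1) * |φ x - φ y|) * ENNReal.ofReal (‖x - y‖ ^ (-e)) := by
    intro x y
    rw [norm_div, norm_mul, Real.norm_eq_abs, abs_spow (by linarith), Real.norm_eq_abs,
      Real.norm_of_nonneg (r := ‖x - y‖ ^ e) (by positivity),
      ofReal_div_rpow (by positivity) (norm_nonneg _), show p - 2 + 1 = p - 1 by ring]
  simp only [hval]
  have hcross : ∀ x ∈ ball x₀ R, ∀ y ∉ ball x₀ R,
      ENNReal.ofReal (|u x - u y| ^ (p - 1) * |φ x - φ y|) * ENNReal.ofReal (‖x - y‖ ^ (-e)) ≤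
      (closedBall x₀ ρ).indicator 1 x *
        ENNReal.ofReal (M * ((1 + |u y| ^ (p - 1)) * ‖x - y‖ ^ (-e))) := by
    intro x hx y hy
    rw [hφ0 y fun h => hy (hsub h), sub_zero]
    by_cases hx' : x ∈ closedBall x₀ ρ
    · rw [indicator_of_mem hx', Pi.one_apply, one_mul, ← ENNReal.ofReal_mul (by positivity)]
      apply ENNReal.ofReal_le_ofReal
      have h1 : |u x - u y| ^ (p - 1) ≤ 1 + |u y| ^ (p - 1) := by
        refine (abs_sub_rpow_le hp _ _).trans ?_
        gcongr
        exact Real.rpow_le_one (abs_nonneg _) (H.abs_le_one x hx) (by linarith)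
      calc _ ≤ (1 + |u y| ^ (p - 1)) * M * ‖x - y‖ ^ (-e) := by
            gcongr; exact hM x
        _ = _ := by ring
    · rw [hφ0 x hx']
      simp
  have hind : Measurable fun z : E N × E N => (closedBall x₀ ρ).indicator (1 : E N → ℝ≥0∞) z.1 :=
    (measurable_one.indicator measurableSet_closedBall).comp measurable_fst
  refine lt_of_le_of_lt (lintegral_pair_le_split (S := ball x₀ R) measurableSet_ball
    (F₁ := fun x y => ENNReal.ofReal (|u x - u y| ^ p) * ENNReal.ofReal (‖x - y‖ ^ (-e)) +
      ENNReal.ofReal (|φ x - φ y| ^ p) * ENNReal.ofReal (‖x - y‖ ^ (-e)))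
    (F₂ := fun x y => (closedBall x₀ ρ).indicator 1 x *
        ENNReal.ofReal (M * ((1 + |u y| ^ (p - 1)) * ‖x - y‖ ^ (-e))))
    (by unfold Function.uncurry; fun_prop) (hind.mul (by fun_prop)) ?_ hcross ?_ ?_) ?_
  · intro x hx y hy
    rw [← add_mul, ← ENNReal.ofReal_add (by positivity) (by positivity)]
    gcongr
    have := rpow_mul_rpow_le (abs_nonneg (u x - u y)) (abs_nonneg (φ x - φ y)) one_pos
      (m := p - 1) (n := 1) (by linarith) one_pos
    simpa using this
  · intro x hx y hy
    rw [abs_sub_comm, abs_sub_comm (φ y), norm_sub_rev]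
    exact hcross x hx y hy
  · intro x hx y hy
    rw [hφ0 y (fun h => hy (hsub h)), hφ0 x (fun h => hx (hsub h))]
    simp
  · refine ENNReal.add_lt_top.2 ⟨?_, ENNReal.mul_lt_top (by norm_num) ?_⟩
    · have h1 : ∀ x, ∫⁻ y in ball x₀ R, (ENNReal.ofReal (|u x - u y| ^ p) *
          ENNReal.ofReal (‖x - y‖ ^ (-e)) +
          ENNReal.ofReal (|φ x - φ y| ^ p) * ENNReal.ofReal (‖x - y‖ ^ (-e))) = _ := fun x =>
        lintegral_add_left (by fun_prop) _
      simp_rw [h1]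
      rw [lintegral_add_left (Measurable.lintegral_prod_right' (f := fun z : E N × E N =>
          ENNReal.ofReal (|u z.1 - u z.2| ^ p) * ENNReal.ofReal (‖z.1 - z.2‖ ^ (-e)))
            (by fun_prop))]
      exact ENNReal.add_lt_top.2 ⟨lt_of_le_of_lt H.energy ENNReal.one_lt_top,
        lt_of_le_of_lt (pairEnergy_mono_set (subset_univ _)) hE⟩
    · obtain ⟨C, hC, hCle⟩ := exists_tail_le hp1 heN
      rcases le_or_gt R 0 with hR0 | hR0
      · rw [ball_eq_empty.2 hR0]; simp
      set δ := min (R - ρ) 1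
      have hδ : 0 < δ := lt_min (by linarith) one_pos
      have hT : 0 ≤ R ^ (-(s * p)) := by positivity
      calc _ ≤ ∫⁻ x in ball x₀ R,
            ENNReal.ofReal M * ENNReal.ofReal (C * δ ^ (-e) * (1 + R ^ (-(s * p)))) := by
            refine setLIntegral_mono' measurableSet_ball fun x hx => ?_
            by_cases hx' : x ∈ closedBall x₀ ρ
            · simp only [indicator_of_mem hx', Pi.one_apply, one_mul]
              simp_rw [ENNReal.ofReal_mul hM0]
              rw [lintegral_const_mul _ (by fun_prop)]
              gcongr
              refine le_trans (lintegral_mono_set ?_) (hCle u x₀ R _ hT hR H.abs_le_one H.tail_le x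
                hx δ hδ (min_le_right _ _))
              intro y hy
              exact (min_le_left _ _).trans (le_norm_sub_of_mem_of_notMem hx' hy)
            · simp [indicator_of_notMem hx']
        _ < ∞ := by
            rw [setLIntegral_const]
            exact ENNReal.mul_lt_top (ENNReal.mul_lt_top ENNReal.ofReal_lt_top
              ENNReal.ofReal_lt_top) measure_ball_lt_top

/-- Integrate G ≤ T + (G-T)⁺ and use that T has integral zero. No integrability of G is required: if
the right-hand side is infinite there is nothing to prove. The energy estimate thus needs no prior
knowledge that the degenerate energy is finite. -/
lemma lintegral_ofReal_le_of_integral_eq_zero {α : Type*} [MeasurableSpace α] {μ : Measure α}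
    {G T : α → ℝ} (hG : Measurable G) (hG0 : ∀ z, 0 ≤ G z) (hT : Integrable T μ)
    (hT0 : ∫ z, T z ∂μ = 0) :
    ∫⁻ z, ENNReal.ofReal (G z) ∂μ ≤ ∫⁻ z, ENNReal.ofReal (G z - T z) ∂μ := by
  rcases eq_top_or_lt_top (∫⁻ z, ENNReal.ofReal (G z - T z) ∂μ) with h | h
  · rw [h]; exact le_top
  have hD : Integrable (fun z => max (G z - T z) 0) μ := by
    refine ⟨(hG.aestronglyMeasurable.sub hT.1).sup aestronglyMeasurable_const, ?_⟩
    refine (hasFiniteIntegral_iff_ofReal (Filter.Eventually.of_forall fun z => le_max_right _ _)).2 ?_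
    simpa [ENNReal.ofReal_max] using h
  calc ∫⁻ z, ENNReal.ofReal (G z) ∂μ ≤ ∫⁻ z, ENNReal.ofReal (T z + max (G z - T z) 0) ∂μ := by
        refine lintegral_mono fun z => ENNReal.ofReal_le_ofReal ?_
        linarith [le_max_left (G z - T z) 0]
    _ = ENNReal.ofReal (∫ z, (T z + max (G z - T z) 0) ∂μ) := by
        refine (ofReal_integral_eq_lintegral_ofReal (hT.add hD)
          (Filter.Eventually.of_forall fun z => ?_)).symm
        change 0 ≤ T z + max (G z - T z) 0
        linarith [le_max_left (G z - T z) 0, hG0 z]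
    _ = ENNReal.ofReal (∫ z, max (G z - T z) 0 ∂μ) := by
        rw [integral_add hT hD, hT0, zero_add]
    _ = ∫⁻ z, ENNReal.ofReal (max (G z - T z) 0) ∂μ :=
        ofReal_integral_eq_lintegral_ofReal hD
          (Filter.Eventually.of_forall fun z => le_max_right _ _)
    _ = _ := by simp [ENNReal.ofReal_max]

lemma integral_translate_eq (F : E N × E N → ℝ) (h : E N) :
    ∫ z : E N × E N, F (z.1 + h, z.2 + h) = ∫ z, F z :=
  integral_add_right_eq_self (μ := (volume : Measure (E N)).prod volume) F (h, h)

lemma integrable_translate {F : E N × E N → ℝ} (hF : Integrable F) (h : E N) :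
    Integrable fun z : E N × E N => F (z.1 + h, z.2 + h) :=
  Integrable.comp_add_right (μ := (volume : Measure (E N)).prod volume) hF (h, h)

lemma add_mem_ball_of_mem {x h : E N} {r : ℝ} (hx : x ∈ ball x₀ r) : x + h ∈ ball x₀ (r + ‖h‖) := by
  rw [mem_ball, dist_eq_norm] at *
  calc ‖x + h - x₀‖ = ‖(x - x₀) + h‖ := by congr 1; abel
    _ ≤ ‖x - x₀‖ + ‖h‖ := norm_add_le _ _
    _ < _ := by linarith

lemma NormSol.abs_diff_le (H : NormSol s₁ s p l x₀ R u Z) {h : E N} {r : ℝ} (hr : r + ‖h‖ ≤ R)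
    {x : E N} (hx : x ∈ ball x₀ r) : |u (x + h) - u x| ≤ 2 := by
  have h1 := H.abs_le_one _ (ball_subset_ball hr (add_mem_ball_of_mem (h := h) hx))
  have h2 := H.abs_le_one x (ball_subset_ball (by linarith [norm_nonneg h]) hx)
  exact (abs_sub _ _).trans (by linarith)

/-- The discrete differentiation of the equation, as an identity for an integrable function. -/
lemma NormSol.exists_diff_eq (H : NormSol s₁ s p l x₀ R u Z) (hp : p ∈ Ioo (1 : ℝ) 2)
    (hs : 0 < s) (hR : R ≤ 1) {ρ M : ℝ} {h : E N} (hρ : ρ + ‖h‖ < R)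
    {φ : E N → ℝ} (hφ : Measurable φ)
    (hM : ∀ x, |φ x| ≤ M) (hφ0 : ∀ x ∉ closedBall x₀ ρ, φ x = 0)
    (hE : pairEnergy (N + s * p) p φ univ < ∞) (hE₁ : pairEnergy (N + s₁ * 1) 1 φ univ < ∞) :
    ∃ T : E N × E N → ℝ, Integrable T ∧ ∫ z, T z = 0 ∧ ∀ z, T z =
      l * ((Z (z.1 + h, z.2 + h) - Z z) * ((φ z.1 - φ z.2) / ‖z.1 - z.2‖ ^ ((N : ℝ) + s₁))) +
      (spow (p - 2) (u (z.1 + h) - u (z.2 + h)) - spow (p - 2) (u z.1 - u z.2)) *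
        (φ z.1 - φ z.2) / ‖z.1 - z.2‖ ^ ((N : ℝ) + s * p) := by
  have hp1 := hp.1
  -- Testing with ψ and translating both variables by h gives the equation of u(· + h) tested with
  -- φ; the kernels depend on x - y only and do not change.
  set ψ : E N → ℝ := fun x => φ (x - h)
  have hψ : Measurable ψ := by fun_prop
  have hψM : ∀ x, |ψ x| ≤ M := fun x => hM _
  have hψ0 : ∀ x ∉ closedBall x₀ (ρ + ‖h‖), ψ x = 0 := by
    intro x hx
    apply hφ0
    intro hx'
    apply hx
    rw [mem_closedBall, dist_eq_norm] at *
    calc ‖x - x₀‖ = ‖(x - h - x₀) + h‖ := by congr 1; abel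
      _ ≤ ‖x - h - x₀‖ + ‖h‖ := norm_add_le _ _
      _ ≤ _ := by linarith
  have hψE : pairEnergy (N + s * p) p ψ univ < ∞ := by rwa [pairEnergy_translate]
  have hψE₁ : pairEnergy (N + s₁ * 1) 1 ψ univ < ∞ := by rwa [pairEnergy_translate]
  have hρ' : ρ < R := by linarith [norm_nonneg h]
  have w1 := H.weak φ (isTest_of_bounded hφ hM hφ0 hρ' (by linarith) hE₁ hE)
  have w2 := H.weak ψ (isTest_of_bounded hψ hψM hψ0 hρ (by linarith) hψE₁ hψE)
  have i1 := integrable_kernel_one H.measurable_Z H.abs_Z_le hφ hE₁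
  have i2 := integrable_translate (integrable_kernel_one H.measurable_Z H.abs_Z_le hψ hψE₁) h
  have j1 := H.integrable_kernel_p hp hs hR hρ' hφ hM hφ0 hE
  have j2 := integrable_translate (H.integrable_kernel_p hp hs hR hρ hψ hψM hψ0 hψE) h
  rw [← integral_translate_eq _ h, ← integral_translate_eq (fun z =>
    spow (p - 2) (u z.1 - u z.2) * (ψ z.1 - ψ z.2) / ‖z.1 - z.2‖ ^ ((N : ℝ) + s * p)) h] at w2
  refine ⟨_, ((i2.sub i1).const_mul l).add (j2.sub j1), ?_, ?_⟩
  · rw [integral_add' ((i2.sub i1).const_mul l) (j2.sub j1), integral_const_mul,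
      integral_sub' i2 i1, integral_sub' j2 j1]
    linarith
  · intro z
    simp only [Pi.add_apply, Pi.sub_apply, ψ, add_sub_cancel_right, add_sub_add_right_eq_sub]
    ring

/-- The energy inequality for the difference quotient, with the cutoff errors on the right. -/
lemma NormSol.energy_le (H : NormSol s₁ s p l x₀ R u Z) (hN : 1 ≤ N) (hp : p ∈ Ioo (1 : ℝ) 2)
    (hs : s ∈ Ioo (0 : ℝ) 1) (hs₁ : s₁ ∈ Ioo (0 : ℝ) 1) (hR : R ≤ 1) {ρ r L β : ℝ} {h : E N}
    (hρ : ρ < r) (hr : r + ‖h‖ ≤ R) (hβ : 1 ≤ β) {η : E N → ℝ} (hη : Measurable η) (hL : 0 ≤ L)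
    (hηL : ∀ x y, |η x - η y| ≤ L * ‖x - y‖) (hη1 : ∀ x, η x ≤ 1) (hηnn : ∀ x, 0 ≤ η x)
    (hη0 : ∀ x ∉ closedBall x₀ ρ, η x = 0) :
    ∫⁻ x in ball x₀ r, ∫⁻ y in ball x₀ r, ENNReal.ofReal ((p - 1) * 2 ^ (1 - β) *
      ((|u (x + h) - u (y + h)| + |u x - u y|) ^ (p - 2) *
        |(u (x + h) - u x) - (u (y + h) - u y)| ^ (β + 1)) * ((η x + η y) / 2)) *
        ENNReal.ofReal (‖x - y‖ ^ (-((N : ℝ) + s * p))) ≤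
    (∫⁻ x in ball x₀ r, ∫⁻ y in ball x₀ r,
      (ENNReal.ofReal ((|u (x + h) - u x| ^ β + |u (y + h) - u y| ^ β) * |η x - η y|) *
        ENNReal.ofReal (‖x - y‖ ^ (-((N : ℝ) + s₁))) +
      ENNReal.ofReal ((|u (x + h) - u (y + h)| ^ (p - 1) + |u x - u y| ^ (p - 1)) *
        (|u (x + h) - u x| ^ β + |u (y + h) - u y| ^ β) * (|η x - η y| / 2)) *
        ENNReal.ofReal (‖x - y‖ ^ (-((N : ℝ) + s * p))))) +
    2 * ∫⁻ x in ball x₀ r, ∫⁻ y in (ball x₀ r)ᶜ, ENNReal.ofReal (|u (x + h) - u x| ^ β * η x) *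
      (ENNReal.ofReal (2 * ‖x - y‖ ^ (-((N : ℝ) + s₁))) +
      ENNReal.ofReal ((|u (x + h) - u (y + h)| ^ (p - 1) + |u x - u y| ^ (p - 1)) *
        ‖x - y‖ ^ (-((N : ℝ) + s * p)))) := by
  have hu := H.measurable_u
  have hp1 := hp.1
  have hβ0 : 0 < β := by linarith
  obtain ⟨hl0, hl1⟩ := H.l_mem
  have hsub : closedBall x₀ ρ ⊆ ball x₀ r := closedBall_subset_ball hρ
  have hrR : ball x₀ r ⊆ ball x₀ R := ball_subset_ball (by linarith [norm_nonneg h])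
  have hsp := measurable_spow (β - 1)
  set A : E N → ℝ := fun x => u (x + h) - u x with hA
  have hAm : Measurable A := by fun_prop
  have hA2 : ∀ x ∈ ball x₀ r, |A x| ≤ 2 := fun x hx => H.abs_diff_le hr hx
  set f : E N → ℝ := fun x => spow (β - 1) (A x) with hf
  have hfm : Measurable f := hsp.comp hAm
  have hfM : ∀ x ∈ ball x₀ r, |f x| ≤ 2 ^ β := by
    intro x hx
    rw [hf]
    simp only
    rw [abs_spow (by linarith), sub_add_cancel]
    exact Real.rpow_le_rpow (abs_nonneg _) (hA2 x hx) hβ0.le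
  have hη1' : ∀ x, |η x| ≤ 1 := fun x => by rw [abs_of_nonneg (hηnn x)]; exact hη1 x
  set φ : E N → ℝ := fun x => f x * η x with hφ
  have hφm : Measurable φ := hfm.mul hη
  have hφ0 : ∀ x ∉ closedBall x₀ ρ, φ x = 0 := fun x hx => by rw [hφ]; simp [hη0 x hx]
  have hφM : ∀ x, |φ x| ≤ 2 ^ β := by
    intro x
    by_cases hx : x ∈ closedBall x₀ ρ
    · rw [hφ]
      simp only [abs_mul]
      calc |f x| * |η x| ≤ 2 ^ β * 1 := by gcongr; exacts [hfM x (hsub hx), hη1' x]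
        _ = _ := mul_one _
    · rw [hφ0 x hx]; simp; positivity
  -- Finiteness of both energies of u passes to the odd power of the difference quotient, and then,
  -- by the cutoff lemma, to φ.
  have hEf : ∀ e q : ℝ, 0 ≤ q → pairEnergy e q u (ball x₀ R) < ∞ →
      pairEnergy e q f (ball x₀ r) < ∞ := by
    intro e q hq hfin
    refine lt_of_le_of_lt (pairEnergy_comp_sub_le (f := fun x => u (x + h)) (g := u)
      (L := 2 * β * 2 ^ (β - 1)) (M := 2) hq (by positivity) (by fun_prop) hu measurableSet_ball hA2
      fun a b ha hb => abs_spow_sub_le_lipschitz hβ hb ha) ?_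
    refine ENNReal.mul_lt_top ENNReal.ofReal_lt_top (ENNReal.add_lt_top.2 ⟨?_, ?_⟩)
    · exact lt_of_le_of_lt ((pairEnergy_shift_le _ _ _ _ _ _).trans
        (pairEnergy_mono_set (ball_subset_ball hr))) hfin
    · exact lt_of_le_of_lt (pairEnergy_mono_set hrR) hfin
  have hE : pairEnergy (N + s * p) p φ univ < ∞ :=
    pairEnergy_mul_cutoff_lt_top hN hs hp1.le hfm hη hfM
      (hEf _ _ (by linarith) (lt_of_le_of_lt H.energy ENNReal.one_lt_top)) hL hηL hη1' hη0 hρ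
  have hE₁ : pairEnergy (N + s₁ * 1) 1 φ univ < ∞ :=
    pairEnergy_mul_cutoff_lt_top hN hs₁ le_rfl hfm hη hfM
      (hEf _ _ zero_le_one H.energy_one) hL hηL hη1' hη0 hρ
  obtain ⟨T, hTi, hT0, hT⟩ := H.exists_diff_eq hp hs.1 hR (h := h) (by linarith) hφm hφM hφ0 hE hE₁
  have hJ := measurable_spow (p - 2)
  have hZ := H.measurable_Z
  set e : ℝ := (N : ℝ) + s * p with he
  set e₁ : ℝ := (N : ℝ) + s₁ with he₁
  set g : E N → E N → ℝ := fun x y => (p - 1) * 2 ^ (1 - β) *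
      ((|u (x + h) - u (y + h)| + |u x - u y|) ^ (p - 2) *
        |A x - A y| ^ (β + 1)) * ((η x + η y) / 2) with hg
  have hgm : Measurable fun z : E N × E N => g z.1 z.2 := by fun_prop
  have hg0 : ∀ x y, 0 ≤ g x y := by
    intro x y
    have := hηnn x
    have := hηnn y
    have : 0 ≤ p - 1 := by linarith
    positivity
  -- The coercive density is kept only on the square of the ball, so outside that square G - T
  -- reduces to -T.
  set G : E N × E N → ℝ := (ball x₀ r ×ˢ ball x₀ r).indicator
    fun z => g z.1 z.2 * ‖z.1 - z.2‖ ^ (-e) with hG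
  have hGm : Measurable G :=
    Measurable.indicator (by fun_prop) (measurableSet_ball.prod measurableSet_ball)
  have hTm : Measurable T := by
    have : T = fun z => l * ((Z (z.1 + h, z.2 + h) - Z z) *
      ((φ z.1 - φ z.2) / ‖z.1 - z.2‖ ^ e₁)) +
      (spow (p - 2) (u (z.1 + h) - u (z.2 + h)) - spow (p - 2) (u z.1 - u z.2)) *
        (φ z.1 - φ z.2) / ‖z.1 - z.2‖ ^ e := funext hT
    rw [this]
    have m1 : Measurable fun z : E N × E N => spow (p - 2) (u (z.1 + h) - u (z.2 + h)) :=
      hJ.comp (by fun_prop)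
    have m2 : Measurable fun z : E N × E N => spow (p - 2) (u z.1 - u z.2) :=
      hJ.comp (by fun_prop)
    fun_prop
  have hmain := lintegral_ofReal_le_of_integral_eq_zero hGm (fun z => by
    rw [hG]
    exact indicator_nonneg (fun z _ => mul_nonneg (hg0 _ _) (by positivity)) z) hTi hT0
  have hLHS : ∫⁻ z, ENNReal.ofReal (G z) = ∫⁻ x in ball x₀ r, ∫⁻ y in ball x₀ r,
      ENNReal.ofReal (g x y) * ENNReal.ofReal (‖x - y‖ ^ (-e)) := by
    have : ∀ z, ENNReal.ofReal (G z) = (ball x₀ r ×ˢ ball x₀ r).indicator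
        (fun z => ENNReal.ofReal (g z.1 z.2) * ENNReal.ofReal (‖z.1 - z.2‖ ^ (-e))) z := by
      intro z
      rw [hG]
      by_cases hz : z ∈ ball x₀ r ×ˢ ball x₀ r
      · rw [indicator_of_mem hz, indicator_of_mem hz, ENNReal.ofReal_mul (hg0 _ _)]
      · rw [indicator_of_notMem hz, indicator_of_notMem hz, ENNReal.ofReal_zero]
    simp_rw [this]
    rw [lintegral_indicator (measurableSet_ball.prod measurableSet_ball),
      setLIntegral_prod_eq (by fun_prop)]
  rw [hLHS] at hmain
  refine hmain.trans ?_
  rw [lintegral_prod_self_eq (by fun_prop)]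
  have hZle : ∀ z w, |Z z - Z w| ≤ 2 := fun z w =>
    (abs_sub _ _).trans (by linarith [H.abs_Z_le z, H.abs_Z_le w])
  -- Across the boundary of the ball no sign is used: the sign graph contributes at most 2, and the
  -- p-part is bounded by absolute values.
  have hcrossT : ∀ x y, ∀ c : ℝ, |φ x - φ y| = c →
      |T (x, y)| ≤ c * (2 * ‖x - y‖ ^ (-e₁)) + c *
        ((|u (x + h) - u (y + h)| ^ (p - 1) + |u x - u y| ^ (p - 1)) * ‖x - y‖ ^ (-e)) := by
    intro x y c hc
    rw [hT]
    simp only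
    refine (abs_add_le _ _).trans ?_
    rw [abs_mul, abs_mul, abs_div, abs_div, abs_mul, hc, abs_of_nonneg hl0,
      abs_of_nonneg (a := ‖x - y‖ ^ e₁) (by positivity),
      abs_of_nonneg (a := ‖x - y‖ ^ e) (by positivity), Real.rpow_neg (norm_nonneg _),
      Real.rpow_neg (norm_nonneg _)]
    have hc0 : 0 ≤ c := hc ▸ abs_nonneg _
    refine add_le_add ?_ ?_
    · calc l * (|Z (x + h, y + h) - Z (x, y)| * (c / ‖x - y‖ ^ e₁))
          ≤ 1 * (2 * (c / ‖x - y‖ ^ e₁)) := by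
            gcongr
            exact hZle _ _
        _ = _ := by ring
    · calc _ ≤ (|u (x + h) - u (y + h)| ^ (p - 1) + |u x - u y| ^ (p - 1)) * c / ‖x - y‖ ^ e := by
            gcongr
            exact abs_spow_sub_le hp1 _ _
        _ = _ := by ring
  have habsφ : ∀ x, |φ x| = |A x| ^ β * η x := by
    intro x
    rw [hφ, hf]
    simp only
    rw [abs_mul, abs_spow (by linarith), sub_add_cancel, abs_of_nonneg (hηnn x)]
  have hoff : ∀ x, ∀ y ∉ ball x₀ r, G (x, y) = 0 ∧ G (y, x) = 0 := by
    intro x y hy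
    rw [hG]
    exact ⟨indicator_of_notMem (fun h => hy h.2) _, indicator_of_notMem (fun h => hy h.1) _⟩
  refine lintegral_pair_le_split measurableSet_ball
    (F := fun x y => ENNReal.ofReal (G (x, y) - T (x, y))) (by unfold Function.uncurry; fun_prop)
    (F₂ := fun x y => ENNReal.ofReal (|A x| ^ β * η x) *
      (ENNReal.ofReal (2 * ‖x - y‖ ^ (-e₁)) +
      ENNReal.ofReal ((|u (x + h) - u (y + h)| ^ (p - 1) + |u x - u y| ^ (p - 1)) *
        ‖x - y‖ ^ (-e)))) (by unfold Function.uncurry; fun_prop) ?_ ?_ ?_ ?_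
  · intro x hx y hy
    rw [← ENNReal.ofReal_mul (mul_nonneg (by positivity) (abs_nonneg _)),
      ← ENNReal.ofReal_mul (by positivity), ← ENNReal.ofReal_add (by positivity) (by positivity)]
    apply ENNReal.ofReal_le_ofReal
    rw [hG, indicator_of_mem (show (x, y) ∈ ball x₀ r ×ˢ ball x₀ r from ⟨hx, hy⟩), hT]
    simp only
    have k1 := spow_mul_ge (p := p) (β := β) (a := u (x + h) - u (y + h)) (b := u x - u y)
      (A := A x) (B := A y) hp hβ (by simp only [hA]; ring) (hηnn x) (hηnn y)
    have k2 := sgn_mul_ge (β := β) (a := u (x + h) - u (y + h)) (b := u x - u y)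
      (A := A x) (B := A y) hβ (by simp only [hA]; ring) (H.sgn (x + h, y + h)) (H.sgn (x, y))
      (hηnn x) (hηnn y)
    have d0 : 0 ≤ ‖x - y‖ ^ (-e) := by positivity
    have d1 : 0 ≤ ‖x - y‖ ^ (-e₁) := by positivity
    have k1' := mul_le_mul_of_nonneg_right k1 d0
    have k2' := mul_le_mul_of_nonneg_right k2 d1
    -- The lower bound for the sign graph is nonpositive, so multiplying its right-hand side by l ∈
    -- [0,1] preserves it. This is what makes the estimate uniform in l.
    have k3 : -((|A x| ^ β + |A y| ^ β) * |η x - η y|) * ‖x - y‖ ^ (-e₁) ≤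
        l * ((Z (x + h, y + h) - Z (x, y)) *
          (spow (β - 1) (A x) * η x - spow (β - 1) (A y) * η y) * ‖x - y‖ ^ (-e₁)) := by
      have : 0 ≤ (|A x| ^ β + |A y| ^ β) * |η x - η y| * ‖x - y‖ ^ (-e₁) := by positivity
      nlinarith
    rw [div_eq_mul_inv, div_eq_mul_inv, ← Real.rpow_neg (norm_nonneg _),
      ← Real.rpow_neg (norm_nonneg _)]
    simp only [hφ, hf, hg]
    linarith
  · intro x hx y hy
    have hy0 : φ y = 0 := hφ0 y fun h => hy (hsub h)
    have := hcrossT x y (|A x| ^ β * η x) (by rw [hy0, sub_zero, habsφ])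
    have hη' := hηnn x
    rw [← ENNReal.ofReal_add (by positivity) (by positivity), ← ENNReal.ofReal_mul (by positivity),
      (hoff x y hy).1, zero_sub]
    apply ENNReal.ofReal_le_ofReal
    linarith [neg_abs_le (T (x, y))]
  · intro x hx y hy
    have hy0 : φ y = 0 := hφ0 y fun h => hy (hsub h)
    have := hcrossT y x (|A x| ^ β * η x) (by rw [hy0, zero_sub, abs_neg, habsφ])
    have hη' := hηnn x
    rw [← ENNReal.ofReal_add (by positivity) (by positivity), ← ENNReal.ofReal_mul (by positivity),
      (hoff x y hy).2, zero_sub]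
    apply ENNReal.ofReal_le_ofReal
    rw [norm_sub_rev y, abs_sub_comm (u (y + h)), abs_sub_comm (u y)] at this
    linarith [neg_abs_le (T (y, x))]
  · intro x hx y hy
    have := hcrossT x y 0 (by
      rw [hφ0 x fun h => hx (hsub h), hφ0 y fun h => hy (hsub h)]; simp)
    rw [zero_mul, zero_mul, add_zero] at this
    rw [(hoff x y hy).1, abs_nonpos_iff.1 this]
    simp

/-! ### Estimates of the cutoff errors -/

lemma setLIntegral_weight_le {W : ℝ → ℝ≥0∞} {r : ℝ} (hr : r ≤ 1) {x : E N}
    (hx : x ∈ ball x₀ r) :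
    ∫⁻ y in ball x₀ r, W ‖x - y‖ ≤ ∫⁻ k in ball (0 : E N) 2, W ‖k‖ := by
  rw [← lintegral_indicator measurableSet_ball, ← lintegral_indicator measurableSet_ball,
    ← lintegral_sub_left_eq_self _ x]
  refine lintegral_mono fun y => ?_
  by_cases hy : x - y ∈ ball x₀ r
  · have : y ∈ ball (0 : E N) 2 := by
      rw [mem_ball, dist_eq_norm] at *
      calc ‖y - 0‖ = ‖(x - x₀) - (x - y - x₀)‖ := by congr 1; abel
        _ ≤ _ := norm_sub_le _ _
        _ < _ := by linarith
    rw [indicator_of_mem hy, indicator_of_mem this, sub_sub_cancel]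
  · rw [indicator_of_notMem hy]
    positivity

lemma setLIntegral_pair_add_le {f : E N → ℝ≥0∞} (hf : Measurable f) {W : ℝ → ℝ≥0∞}
    (hW : Measurable W) {r : ℝ} (hr : r ≤ 1) :
    ∫⁻ x in ball x₀ r, ∫⁻ y in ball x₀ r, (f x + f y) * W ‖x - y‖ ≤
      2 * ((∫⁻ x in ball x₀ r, f x) * ∫⁻ k in ball (0 : E N) 2, W ‖k‖) := by
  have hm : Measurable fun z : E N × E N => f z.1 * W ‖z.1 - z.2‖ := by fun_prop
  have h1 : ∀ x, ∫⁻ y in ball x₀ r, (f x + f y) * W ‖x - y‖ =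
      (∫⁻ y in ball x₀ r, f x * W ‖x - y‖) + ∫⁻ y in ball x₀ r, f y * W ‖x - y‖ := by
    intro x
    simp_rw [add_mul]
    exact lintegral_add_left (by fun_prop) _
  have h2 : ∫⁻ x in ball x₀ r, ∫⁻ y in ball x₀ r, f y * W ‖x - y‖ =
      ∫⁻ x in ball x₀ r, ∫⁻ y in ball x₀ r, f x * W ‖x - y‖ := by
    rw [lintegral_lintegral_swap (by
      refine Measurable.aemeasurable ?_
      unfold Function.uncurry; fun_prop)]
    simp_rw [norm_sub_rev]
  have h3 : ∫⁻ x in ball x₀ r, ∫⁻ y in ball x₀ r, f x * W ‖x - y‖ ≤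
      (∫⁻ x in ball x₀ r, f x) * ∫⁻ k in ball (0 : E N) 2, W ‖k‖ := by
    rw [← lintegral_mul_const _ hf]
    refine setLIntegral_mono' measurableSet_ball fun x hx => ?_
    rw [lintegral_const_mul _ (by fun_prop)]
    exact mul_le_mul_right (setLIntegral_weight_le hr hx) _
  simp_rw [h1]
  rw [lintegral_add_left (Measurable.lintegral_prod_right' hm), h2, two_mul]
  exact add_le_add h3 h3

lemma Nik.lintegral_shift_le {θ q K r r' : ℝ} {h : E N} (hu : Nik u (ball x₀ r) θ q K)
    (hr : r' + ‖h‖ ≤ r) :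
    ∫⁻ x in ball x₀ r', ENNReal.ofReal (|u (x + h) - u x| ^ q) ≤
      ENNReal.ofReal (K * ‖h‖ ^ (θ * q)) := by
  have h1 : ball x₀ r' ⊆ ball x₀ r := ball_subset_ball (by linarith [norm_nonneg h])
  have h2 : ball x₀ r' ⊆ ball x₀ r ∩ {x | x + h ∈ ball x₀ r} := by
    intro x hx
    refine mem_inter (h1 hx) ?_
    rw [mem_ofPred_eq]
    exact ball_subset_ball hr (add_mem_ball_of_mem hx)
  refine le_trans ?_ (hu h)
  exact lintegral_mono_set h2

lemma volume_ball_le_one (x₀ : E N) {r : ℝ} (hr : r ≤ 1) :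
    volume (ball x₀ r) ≤ ENNReal.ofReal (volume (ball (0 : E N) 1)).toReal := by
  rw [ENNReal.ofReal_toReal measure_ball_lt_top.ne, ← Measure.addHaar_ball_center volume x₀]
  exact measure_mono (ball_subset_ball hr)

/-- The difference is compared with its natural size τ = |h|^θ: where it is at most τ its power β is
at most τ^β, and elsewhere it is at most τ^{β-q} times the power q. Both parts integrate to
|h|^{θβ}, with linear dependence on K. -/
lemma Nik.lintegral_shift_rpow_le {θ q β K r r' : ℝ} {h : E N} (hum : Measurable u)
    (hu : Nik u (ball x₀ r) θ q K)
    (hK : 1 ≤ K) (hr : r' + ‖h‖ ≤ r) (hr1 : r' ≤ 1) (hh : h ≠ 0) (hβ : 0 ≤ β) (hβq : β ≤ q) :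
    ∫⁻ x in ball x₀ r', ENNReal.ofReal (|u (x + h) - u x| ^ β) ≤
      ENNReal.ofReal (((volume (ball (0 : E N) 1)).toReal + 1) * K * ‖h‖ ^ (θ * β)) := by
  have hh0 : 0 < ‖h‖ := norm_pos_iff.2 hh
  set V := (volume (ball (0 : E N) 1)).toReal
  have hV : 0 ≤ V := ENNReal.toReal_nonneg
  set τ := ‖h‖ ^ θ
  have hτ : 0 < τ := by positivity
  calc ∫⁻ x in ball x₀ r', ENNReal.ofReal (|u (x + h) - u x| ^ β)
      ≤ ∫⁻ x in ball x₀ r', (ENNReal.ofReal (τ ^ β) +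
          ENNReal.ofReal (τ ^ (β - q)) * ENNReal.ofReal (|u (x + h) - u x| ^ q)) := by
        refine lintegral_mono fun x => ?_
        rw [← ENNReal.ofReal_mul (by positivity), ← ENNReal.ofReal_add (by positivity)
          (by positivity)]
        exact ENNReal.ofReal_le_ofReal (rpow_le_scale (abs_nonneg _) hτ hβ hβq)
    _ = ENNReal.ofReal (τ ^ β) * volume (ball x₀ r') + ENNReal.ofReal (τ ^ (β - q)) *
          ∫⁻ x in ball x₀ r', ENNReal.ofReal (|u (x + h) - u x| ^ q) := by
        rw [lintegral_add_left (by fun_prop), setLIntegral_const,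
          lintegral_const_mul _ (by fun_prop)]
    _ ≤ ENNReal.ofReal (τ ^ β) * ENNReal.ofReal V + ENNReal.ofReal (τ ^ (β - q)) *
          ENNReal.ofReal (K * ‖h‖ ^ (θ * q)) := by
        gcongr
        · exact volume_ball_le_one x₀ hr1
        · exact hu.lintegral_shift_le hr
    _ = ENNReal.ofReal ((V + K) * ‖h‖ ^ (θ * β)) := by
        rw [← ENNReal.ofReal_mul (by positivity), ← ENNReal.ofReal_mul (by positivity),
          ← ENNReal.ofReal_add (by positivity) (by positivity)]
        congr 1
        have : ‖h‖ ^ (θ * β) = τ ^ (β - q) * ‖h‖ ^ (θ * q) := by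
          rw [← Real.rpow_mul hh0.le, ← Real.rpow_add hh0]; ring_nf
        have h' : ‖h‖ ^ (θ * β) = τ ^ β := Real.rpow_mul hh0.le _ _
        rw [add_mul, ← h']
        nth_rewrite 3 [this]
        ring
    _ ≤ _ := by
        apply ENNReal.ofReal_le_ofReal
        gcongr
        nlinarith

lemma rpow_neg_le_rpow_neg {d a b : ℝ} (hd : 0 < d) (hd1 : d ≤ 1) (hab : a ≤ b) :
    d ^ (-a) ≤ d ^ (-b) := Real.rpow_le_rpow_of_exponent_ge hd hd1 (by linarith)

lemma one_le_rpow_neg {d a : ℝ} (hd : 0 < d) (hd1 : d ≤ 1) (ha : 0 ≤ a) : 1 ≤ d ^ (-a) :=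
  Real.one_le_rpow_of_pos_of_le_one_of_nonpos hd hd1 (by linarith)

/-- The nonlocal part of the cutoff error. -/
lemma exists_cross_le (N : ℕ) (hp : p ∈ Ioo (1 : ℝ) 2) (hs : 0 < s) (hs₁ : 0 < s₁) :
    ∃ C κ : ℝ, 0 ≤ C ∧ 0 ≤ κ ∧ ∀ (l : ℝ) (x₀ : E N) (R : ℝ) (u : E N → ℝ) (Z : E N × E N → ℝ),
      NormSol s₁ s p l x₀ R u Z → R ≤ 1 → ∀ (x h : E N) (δ : ℝ), 0 < δ → δ ≤ R → x ∈ ball x₀ R →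
      x + h ∈ ball x₀ R →
      ∫⁻ y in {y | δ ≤ ‖x - y‖}, (ENNReal.ofReal (2 * ‖x - y‖ ^ (-((N : ℝ) + s₁))) +
      ENNReal.ofReal ((|u (x + h) - u (y + h)| ^ (p - 1) + |u x - u y| ^ (p - 1)) *
        ‖x - y‖ ^ (-((N : ℝ) + s * p)))) ≤ ENNReal.ofReal (C * δ ^ (-κ)) := by
  have hp1 := hp.1
  have heN : (N : ℝ) < N + s * p := by nlinarith
  obtain ⟨C₁, hC₁, hC₁le⟩ := exists_lintegral_compl_ball_rpow_le (N := N) (e := (N : ℝ) + s₁)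
    (by linarith)
  obtain ⟨C₂, hC₂, hC₂le⟩ := exists_tail_le (N := N) hp1 heN
  set e : ℝ := (N : ℝ) + s * p with he
  set e₁ : ℝ := (N : ℝ) + s₁ with he₁
  have hN0 : (0 : ℝ) ≤ N := Nat.cast_nonneg _
  have hsp : 0 < s * p := by nlinarith
  -- A single exponent dominating all powers of 1/δ that occur; R^{-sp} is absorbed because δ ≤ R.
  refine ⟨2 * C₁ + 4 * C₂, e + e₁ + s * p, by positivity, by positivity, ?_⟩
  intro l x₀ R u Z H hR x h δ hδ hδR hx hxh
  have hu := H.measurable_u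
  have hδ1 : δ ≤ 1 := hδR.trans hR
  have hR0 : 0 < R := hδ.trans_le hδR
  set S : Set (E N) := {y | δ ≤ ‖x - y‖} with hSdef
  have hS : MeasurableSet S := measurableSet_le measurable_const (by fun_prop)
  have hT : (0 : ℝ) ≤ R ^ (-(s * p)) := by positivity
  have k0 := hC₁le δ hδ hδ1 x
  have k1 := hC₂le u x₀ R _ hT hR H.abs_le_one H.tail_le x hx δ hδ hδ1
  -- After translating y, the tail of the shifted function seen from x is the tail of u seen from x
  -- + h.
  have k2 : ∫⁻ y in S, ENNReal.ofReal ((1 + |u (y + h)| ^ (p - 1)) * ‖x - y‖ ^ (-e)) ≤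
      ENNReal.ofReal (C₂ * δ ^ (-e) * (1 + R ^ (-(s * p)))) := by
    refine le_trans (le_of_eq ?_)
      (hC₂le u x₀ R _ hT hR H.abs_le_one H.tail_le (x + h) hxh δ hδ hδ1)
    have hS' : MeasurableSet {y | δ ≤ ‖x + h - y‖} :=
      measurableSet_le measurable_const (by fun_prop)
    rw [← lintegral_indicator hS, ← lintegral_indicator hS']
    rw [← lintegral_add_right_eq_self ({y | δ ≤ ‖x + h - y‖}.indicator _) h]
    refine lintegral_congr fun y => ?_
    simp only [indicator, hSdef, mem_ofPred_eq, add_sub_add_right_eq_sub]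
  calc _ ≤ ∫⁻ y in S, (2 * ENNReal.ofReal (‖x - y‖ ^ (-e₁)) +
        (ENNReal.ofReal ((1 + |u (y + h)| ^ (p - 1)) * ‖x - y‖ ^ (-e)) +
        ENNReal.ofReal ((1 + |u y| ^ (p - 1)) * ‖x - y‖ ^ (-e)))) := by
        refine lintegral_mono fun y => ?_
        refine add_le_add (le_of_eq (two_mul_ofReal _).symm) ?_
        rw [← ENNReal.ofReal_add (by positivity) (by positivity), ← add_mul]
        gcongr
        · refine (abs_sub_rpow_le hp _ _).trans ?_
          gcongr
          exact Real.rpow_le_one (abs_nonneg _) (H.abs_le_one _ hxh) (by linarith)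
        · refine (abs_sub_rpow_le hp _ _).trans ?_
          gcongr
          exact Real.rpow_le_one (abs_nonneg _) (H.abs_le_one _ hx) (by linarith)
    _ = 2 * (∫⁻ y in S, ENNReal.ofReal (‖x - y‖ ^ (-e₁))) +
        ((∫⁻ y in S, ENNReal.ofReal ((1 + |u (y + h)| ^ (p - 1)) * ‖x - y‖ ^ (-e))) +
        ∫⁻ y in S, ENNReal.ofReal ((1 + |u y| ^ (p - 1)) * ‖x - y‖ ^ (-e))) := by
        rw [lintegral_add_left (by fun_prop), lintegral_const_mul _ (by fun_prop),
          lintegral_add_left (by fun_prop)]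
    _ ≤ 2 * ENNReal.ofReal (C₁ * δ ^ (-e₁)) +
        (ENNReal.ofReal (C₂ * δ ^ (-e) * (1 + R ^ (-(s * p)))) +
        ENNReal.ofReal (C₂ * δ ^ (-e) * (1 + R ^ (-(s * p))))) := by gcongr
    _ ≤ _ := by
        rw [two_mul_ofReal, ← ENNReal.ofReal_add (by positivity) (by positivity),
          ← ENNReal.ofReal_add (by positivity) (by positivity)]
        apply ENNReal.ofReal_le_ofReal
        have he₁0 : 0 ≤ e₁ := by positivity
        have he0 : 0 ≤ e := by positivity
        have i1 : δ ^ (-e₁) ≤ δ ^ (-(e + e₁ + s * p)) :=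
          rpow_neg_le_rpow_neg hδ hδ1 (by linarith)
        have i2 : R ^ (-(s * p)) ≤ δ ^ (-(s * p)) :=
          Real.rpow_le_rpow_of_nonpos hδ hδR (by linarith)
        have i3 : 1 ≤ δ ^ (-(s * p)) := one_le_rpow_neg hδ hδ1 hsp.le
        have i4 : δ ^ (-e) * δ ^ (-(s * p)) ≤ δ ^ (-(e + e₁ + s * p)) := by
          rw [← Real.rpow_add hδ]
          exact Real.rpow_le_rpow_of_exponent_ge hδ hδ1 (by linarith)
        have i5 : δ ^ (-e) * (1 + R ^ (-(s * p))) ≤ 2 * δ ^ (-(e + e₁ + s * p)) := by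
          calc _ ≤ δ ^ (-e) * (δ ^ (-(s * p)) + δ ^ (-(s * p))) := by gcongr
            _ = 2 * (δ ^ (-e) * δ ^ (-(s * p))) := by ring
            _ ≤ _ := by gcongr
        calc _ = 2 * C₁ * δ ^ (-e₁) + 2 * C₂ * (δ ^ (-e) * (1 + R ^ (-(s * p)))) := by ring
          _ ≤ 2 * C₁ * δ ^ (-(e + e₁ + s * p)) + 2 * C₂ * (2 * δ ^ (-(e + e₁ + s * p))) := by
            gcongr
          _ = _ := by ring

/-! ### From second to first differences -/

/-- With 1 + ε = μ^{1/q}, either y ≤ εx and y is absorbed by μx^q, or x < y/ε and everything is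
controlled by y. A coefficient arbitrarily close to 1 in front of x^q is what lets the doubling
iteration contract. -/
lemma exists_add_rpow_le {q μ : ℝ} (hq : 0 < q) (hμ : 1 < μ) :
    ∃ c : ℝ, 0 ≤ c ∧ ∀ x y : ℝ, 0 ≤ x → 0 ≤ y → (x + y) ^ q ≤ μ * x ^ q + c * y ^ q := by
  set ε := μ ^ (1 / q) - 1
  have hε : 0 < ε := sub_pos.2 (Real.one_lt_rpow hμ (by positivity))
  refine ⟨(1 / ε + 1) ^ q, by positivity, fun x y hx hy => ?_⟩
  have hx' : 0 ≤ μ * x ^ q := by positivity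
  have hy' : 0 ≤ (1 / ε + 1) ^ q * y ^ q := by positivity
  rcases le_or_gt y (ε * x) with h | h
  · have : (x + y) ^ q ≤ μ * x ^ q := by
      calc (x + y) ^ q ≤ (μ ^ (1 / q) * x) ^ q := by
            gcongr
            have : μ ^ (1 / q) = ε + 1 := by simp [ε]
            rw [this]; linarith
        _ = μ * x ^ q := by
            rw [Real.mul_rpow (by positivity) hx, ← Real.rpow_mul (by linarith),
              one_div_mul_cancel hq.ne', Real.rpow_one]
    linarith
  · have : (x + y) ^ q ≤ (1 / ε + 1) ^ q * y ^ q := by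
      rw [← Real.mul_rpow (by positivity) hy]
      gcongr
      have : x ≤ y / ε := by rw [le_div_iff₀ hε]; linarith
      rw [add_mul, one_mul, one_div_mul_eq_div]
      linarith
    linarith

/-- An `L^q` modulus for second differences of order less than one controls first differences. -/
lemma exists_first_difference_le (N : ℕ) {q θ : ℝ} (hq : 0 < q) (hθ0 : 0 ≤ θ) (hθ : θ < 1) :
    ∃ C : ℝ, 0 ≤ C ∧ ∀ (u : E N → ℝ) (B : Set (E N)) (K K₀ δ : ℝ), Measurable u → 0 ≤ K →
      0 ≤ K₀ → 0 < δ →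
      (∀ h : E N, h ≠ 0 → ‖h‖ < δ →
        ∫⁻ x in B, ENNReal.ofReal (|(u (x + h + h) - u (x + h)) - (u (x + h) - u x)| ^ q) ≤
          ENNReal.ofReal (K * ‖h‖ ^ (θ * q))) →
      (∀ h : E N, ‖h‖ < 2 * δ →
        ∫⁻ x in B, ENNReal.ofReal (|u (x + h) - u x| ^ q) ≤ ENNReal.ofReal K₀) →
      ∀ h : E N, ‖h‖ < δ → ∫⁻ x in B, ENNReal.ofReal (|u (x + h) - u x| ^ q) ≤
        ENNReal.ofReal (C * (K + K₀ * δ ^ (-(θ * q))) * ‖h‖ ^ (θ * q)) := by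
  -- Doubling h multiplies the target bound by 2^{θq}, while halving the difference gains 2^{-q}.
  -- The factor μ spends half of the surplus 2^{q(1-θ)}, and the contraction ratio ν below is the
  -- other half; here θ < 1 is essential.
  set μ : ℝ := 2 ^ (q * (1 - θ) / 2)
  have hμ : 1 < μ := Real.one_lt_rpow (by norm_num) (by
    have : 0 < 1 - θ := by linarith
    positivity)
  set ν : ℝ := 2 ^ (-(q * (1 - θ) / 2))
  have hν : ν < 1 := Real.rpow_lt_one_of_one_lt_of_neg (by norm_num) (by
    have : 0 < 1 - θ := by linarith
    have : 0 < q * (1 - θ) / 2 := by positivity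
    linarith)
  have hν' : 0 < 1 - ν := by linarith
  have hμν : 2 ^ (-q) * μ * 2 ^ (θ * q) = ν := by
    rw [← Real.rpow_add (by norm_num), ← Real.rpow_add (by norm_num)]
    congr 1; ring
  obtain ⟨c, hc, hcle⟩ := exists_add_rpow_le hq hμ
  -- The value 1 serves increments with |h| ≥ δ, where only K₀ is available; the other value bounds
  -- the second-difference term by (1-ν)M.
  set C := max 1 (2 ^ (-q) * c / (1 - ν))
  have hC0 : 0 ≤ C := zero_le_one.trans (le_max_left _ _)
  refine ⟨C, hC0, ?_⟩
  intro u B K K₀ δ hu hK hK₀ hδ h2 h0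
  set M := C * (K + K₀ * δ ^ (-(θ * q)))
  have hM : 0 ≤ M := by positivity
  have hMK₀ : K₀ * δ ^ (-(θ * q)) ≤ M := by
    calc K₀ * δ ^ (-(θ * q)) ≤ 1 * (K + K₀ * δ ^ (-(θ * q))) := by linarith
      _ ≤ M := by
        refine mul_le_mul_of_nonneg_right (le_max_left _ _) (by positivity)
  have hMK : 2 ^ (-q) * c * K ≤ (1 - ν) * M := by
    have h1 : 2 ^ (-q) * c / (1 - ν) ≤ C := le_max_right _ _
    rw [div_le_iff₀ hν'] at h1
    calc 2 ^ (-q) * c * K ≤ C * (1 - ν) * K := by gcongr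
      _ ≤ C * (1 - ν) * (K + K₀ * δ ^ (-(θ * q))) := by
        gcongr
        have : 0 ≤ K₀ * δ ^ (-(θ * q)) := by positivity
        linarith
      _ = _ := by simp only [M]; ring
  have hbig : ∀ h : E N, δ ≤ ‖h‖ → ‖h‖ < 2 * δ →
      ∫⁻ x in B, ENNReal.ofReal (|u (x + h) - u x| ^ q) ≤ ENNReal.ofReal (M * ‖h‖ ^ (θ * q)) := by
    intro h hh hh2
    refine (h0 h hh2).trans (ENNReal.ofReal_le_ofReal ?_)
    calc K₀ = K₀ * δ ^ (-(θ * q)) * δ ^ (θ * q) := by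
          rw [mul_assoc, ← Real.rpow_add hδ]; simp
      _ ≤ M * ‖h‖ ^ (θ * q) := by gcongr
  -- Induction on a number of doublings that brings |h| up to δ. The induction hypothesis is used at
  -- 2h, and the bound reproduces itself because νM + (1-ν)M = M.
  have key : ∀ n : ℕ, ∀ h : E N, δ ≤ 2 ^ n * ‖h‖ → ‖h‖ < 2 * δ →
      ∫⁻ x in B, ENNReal.ofReal (|u (x + h) - u x| ^ q) ≤ ENNReal.ofReal (M * ‖h‖ ^ (θ * q)) := by
    intro n
    induction n with
    | zero =>
      intro h hh hh2
      exact hbig h (by simpa using hh) hh2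
    | succ n ih =>
      intro h hh hh2
      rcases le_or_gt δ ‖h‖ with hc1 | hc1
      · exact hbig h hc1 hh2
      have hne : h ≠ 0 := by
        rintro rfl
        simp at hh
        linarith
      have hn2 : ‖h + h‖ = 2 * ‖h‖ := by rw [← two_smul ℝ h, norm_smul]; simp
      have i1 := ih (h + h) (by rw [hn2]; calc δ ≤ _ := hh
                                  _ = _ := by ring) (by rw [hn2]; linarith)
      have i2 := h2 h hne hc1
      calc ∫⁻ x in B, ENNReal.ofReal (|u (x + h) - u x| ^ q)
          ≤ ∫⁻ x in B, (ENNReal.ofReal (2 ^ (-q) * μ) *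
              ENNReal.ofReal (|u (x + (h + h)) - u x| ^ q) + ENNReal.ofReal (2 ^ (-q) * c) *
              ENNReal.ofReal (|(u (x + h + h) - u (x + h)) - (u (x + h) - u x)| ^ q)) := by
            refine lintegral_mono fun x => ?_
            rw [← ENNReal.ofReal_mul (by positivity), ← ENNReal.ofReal_mul (by positivity),
              ← ENNReal.ofReal_add (by positivity) (by positivity)]
            apply ENNReal.ofReal_le_ofReal
            set X := |u (x + (h + h)) - u x|
            set Y := |(u (x + h + h) - u (x + h)) - (u (x + h) - u x)|
            -- Twice the first difference at step h is the first difference at step 2h minus the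
            -- second difference.
            have hXY : |u (x + h) - u x| ≤ 2⁻¹ * (X + Y) := by
              have e1 : u (x + h) - u x = 2⁻¹ * ((u (x + (h + h)) - u x) -
                  ((u (x + h + h) - u (x + h)) - (u (x + h) - u x))) := by
                rw [← add_assoc]; ring
              rw [e1, abs_mul, abs_of_pos (by norm_num : (0 : ℝ) < 2⁻¹)]
              gcongr
              exact abs_sub _ _
            calc |u (x + h) - u x| ^ q ≤ (2⁻¹ * (X + Y)) ^ q := by gcongr
              _ = 2 ^ (-q) * (X + Y) ^ q := by
                rw [Real.mul_rpow (by norm_num) (by positivity), Real.inv_rpow (by norm_num),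
                  Real.rpow_neg (by norm_num)]
              _ ≤ 2 ^ (-q) * (μ * X ^ q + c * Y ^ q) := by
                gcongr
                exact hcle X Y (abs_nonneg _) (abs_nonneg _)
              _ = _ := by ring
        _ = ENNReal.ofReal (2 ^ (-q) * μ) *
              (∫⁻ x in B, ENNReal.ofReal (|u (x + (h + h)) - u x| ^ q)) +
            ENNReal.ofReal (2 ^ (-q) * c) * ∫⁻ x in B,
              ENNReal.ofReal (|(u (x + h + h) - u (x + h)) - (u (x + h) - u x)| ^ q) := by
            rw [lintegral_add_left (by fun_prop), lintegral_const_mul _ (by fun_prop),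
              lintegral_const_mul _ (by fun_prop)]
        _ ≤ ENNReal.ofReal (2 ^ (-q) * μ) * ENNReal.ofReal (M * ‖h + h‖ ^ (θ * q)) +
            ENNReal.ofReal (2 ^ (-q) * c) * ENNReal.ofReal (K * ‖h‖ ^ (θ * q)) := by gcongr
        _ ≤ _ := by
            rw [← ENNReal.ofReal_mul (by positivity), ← ENNReal.ofReal_mul (by positivity),
              ← ENNReal.ofReal_add (by positivity) (by positivity), hn2,
              Real.mul_rpow (by norm_num) (norm_nonneg _)]
            apply ENNReal.ofReal_le_ofReal
            have hX : 0 ≤ ‖h‖ ^ (θ * q) := by positivity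
            calc _ = (2 ^ (-q) * μ * 2 ^ (θ * q) * M + 2 ^ (-q) * c * K) * ‖h‖ ^ (θ * q) := by ring
              _ ≤ (ν * M + (1 - ν) * M) * ‖h‖ ^ (θ * q) := by rw [hμν]; gcongr
              _ = _ := by ring
  intro h hh
  rcases eq_or_ne h 0 with rfl | hne
  · simp [Real.zero_rpow hq.ne']
  · obtain ⟨n, hn⟩ := pow_unbounded_of_one_lt (δ / ‖h‖) (by norm_num : (1 : ℝ) < 2)
    rw [div_lt_iff₀ (norm_pos_iff.2 hne)] at hn
    exact key n h hn.le (by linarith)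

/-- Young's inequality at the scale τ = (h/d)^θ, the ratio of the expected sizes h^θ of δ_h u and
d^θ of u(x) - u(y). With this choice, and once the modulus of order θ is inserted, both resulting
terms have size h^{θ(q+1-p)} and weight d^{-(e-1-θ(p-1))}. -/
lemma cutoff_error_le {p q θ a b A B d h e L : ℝ} (hp : 1 < p) (hq : p ≤ q)
    (ha : 0 ≤ a) (hb : 0 ≤ b) (hA : 0 ≤ A) (hB : 0 ≤ B) (hd : 0 ≤ d) (hh : 0 < h) (hL : 0 ≤ L) :
    (a ^ (p - 1) + b ^ (p - 1)) * (A ^ (q + 1 - p) + B ^ (q + 1 - p)) * (L * d / 2) * d ^ (-e) ≤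
      L * h ^ (θ * (q + 1 - p)) * ((a ^ q + b ^ q) * d ^ (-(e - 1 + θ * (q + 1 - p)))) +
      L * h ^ (-(θ * (p - 1))) * ((A ^ q + B ^ q) * d ^ (-(e - 1 - θ * (p - 1)))) := by
  rcases hd.eq_or_lt with rfl | hd
  · rw [mul_zero, zero_div, mul_zero, zero_mul]
    positivity
  set τ := (h / d) ^ θ
  have hτ : 0 < τ := by positivity
  set β := q + 1 - p with hβ
  have hY : ∀ x y : ℝ, 0 ≤ x → 0 ≤ y →
      x ^ (p - 1) * y ^ β ≤ τ ^ β * x ^ q + τ ^ (-(p - 1)) * y ^ q := by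
    intro x y hx hy
    have := rpow_mul_rpow_le hx hy hτ (m := p - 1) (n := β) (by linarith) (by linarith)
    rwa [show p - 1 + β = q by simp [hβ]] at this
  have e1 : τ ^ β * (d * d ^ (-e)) = h ^ (θ * β) * d ^ (-(e - 1 + θ * β)) := by
    have : d * d ^ (-e) = d ^ (1 - e) := by rw [sub_eq_add_neg, Real.rpow_add hd, Real.rpow_one]
    rw [this, ← Real.rpow_mul (by positivity), Real.div_rpow hh.le hd.le, div_eq_mul_inv,
      ← Real.rpow_neg hd.le, mul_assoc, ← Real.rpow_add hd]
    ring_nf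
  have e2 : τ ^ (-(p - 1)) * (d * d ^ (-e)) =
      h ^ (-(θ * (p - 1))) * d ^ (-(e - 1 - θ * (p - 1))) := by
    have : d * d ^ (-e) = d ^ (1 - e) := by rw [sub_eq_add_neg, Real.rpow_add hd, Real.rpow_one]
    rw [this, ← Real.rpow_mul (by positivity), Real.div_rpow hh.le hd.le, div_eq_mul_inv,
      ← Real.rpow_neg hd.le, mul_assoc, ← Real.rpow_add hd]
    ring_nf
  have h1 := hY a A ha hA
  have h2 := hY a B ha hB
  have h3 := hY b A hb hA
  have h4 := hY b B hb hB
  have hw : 0 ≤ L / 2 * (d * d ^ (-e)) := by positivity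
  calc _ = (a ^ (p - 1) * A ^ β + a ^ (p - 1) * B ^ β + b ^ (p - 1) * A ^ β +
        b ^ (p - 1) * B ^ β) * (L / 2 * (d * d ^ (-e))) := by ring
    _ ≤ (2 * (τ ^ β * (a ^ q + b ^ q)) + 2 * (τ ^ (-(p - 1)) * (A ^ q + B ^ q))) *
        (L / 2 * (d * d ^ (-e))) := by
        refine mul_le_mul_of_nonneg_right ?_ hw
        linarith
    _ = L * (a ^ q + b ^ q) * (τ ^ β * (d * d ^ (-e))) +
        L * (A ^ q + B ^ q) * (τ ^ (-(p - 1)) * (d * d ^ (-e))) := by ring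
    _ = _ := by rw [e1, e2]; ring

/-- A Lipschitz cutoff between two concentric balls. -/
lemma exists_cutoff (x₀ : E N) {r t : ℝ} (h : r < t) :
    ∃ η : E N → ℝ, Measurable η ∧ (∀ x y, |η x - η y| ≤ 1 / (t - r) * ‖x - y‖) ∧
      (∀ x, η x ≤ 1) ∧ (∀ x, 0 ≤ η x) ∧ (∀ x ∉ closedBall x₀ t, η x = 0) ∧
      ∀ x ∈ ball x₀ r, η x = 1 := by
  have htr : 0 < t - r := by linarith
  refine ⟨fun x => max (min ((t - ‖x - x₀‖) / (t - r)) 1) 0, by fun_prop, ?_, ?_, ?_, ?_, ?_⟩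
  · intro x y
    refine (abs_max_sub_max_le_abs _ _ _).trans ?_
    refine (abs_min_sub_min_le_max _ _ _ _).trans ?_
    rw [sub_self, abs_zero, max_eq_left (abs_nonneg _), ← sub_div, abs_div, abs_of_pos htr,
      one_div_mul_eq_div]
    gcongr
    rw [show t - ‖x - x₀‖ - (t - ‖y - x₀‖) = ‖y - x₀‖ - ‖x - x₀‖ by ring, norm_sub_rev x y]
    refine (abs_norm_sub_norm_le _ _).trans (le_of_eq ?_)
    congr 1; abel
  · intro x
    exact max_le (min_le_right _ _) zero_le_one
  · intro x
    exact le_max_right _ _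
  · intro x hx
    rw [mem_closedBall, dist_eq_norm, not_le] at hx
    refine max_eq_right ((min_le_left _ _).trans ?_)
    exact div_nonpos_of_nonpos_of_nonneg (by linarith) htr.le
  · intro x hx
    rw [mem_ball, dist_eq_norm] at hx
    simp only
    rw [min_eq_right, max_eq_left zero_le_one]
    rw [le_div_iff₀ htr]; linarith

lemma setLIntegral_pair_add {S T : Set (E N)} {f g : E N → E N → ℝ≥0∞}
    (hf : Measurable (Function.uncurry f)) :
    ∫⁻ x in S, ∫⁻ y in T, (f x y + g x y) =
      (∫⁻ x in S, ∫⁻ y in T, f x y) + ∫⁻ x in S, ∫⁻ y in T, g x y := by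
  have h1 : ∀ x, ∫⁻ y in T, (f x y + g x y) = (∫⁻ y in T, f x y) + ∫⁻ y in T, g x y :=
    fun x => lintegral_add_left hf.of_uncurry_left _
  simp_rw [h1]
  exact lintegral_add_left hf.lintegral_prod_right' _

lemma setLIntegral_pair_const_mul {S T : Set (E N)} {f : E N → E N → ℝ≥0∞} (c : ℝ) :
    ∫⁻ x in S, ∫⁻ y in T, ENNReal.ofReal c * f x y =
      ENNReal.ofReal c * ∫⁻ x in S, ∫⁻ y in T, f x y := by
  simp_rw [lintegral_const_mul' _ _ ENNReal.ofReal_ne_top]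

lemma Nik.pairEnergy_le {θ q K r e : ℝ} (hu : Nik u (ball x₀ r) θ q K)
    (hum : Measurable u) (hr : r ≤ 1) (hK : 0 ≤ K) (hq : 0 ≤ θ * q) :
    pairEnergy e q u (ball x₀ r) ≤ ENNReal.ofReal K *
      ∫⁻ k in ball (0 : E N) 2, ENNReal.ofReal (‖k‖ ^ (-(e - θ * q))) := by
  refine (hu.lintegral_pair_le hum hr (W := fun t => ENNReal.ofReal (t ^ (-e)))
    (by fun_prop)).trans ?_
  rw [← lintegral_const_mul _ (by fun_prop)]
  refine lintegral_mono fun k => ?_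
  rw [ENNReal.ofReal_mul hK, mul_assoc]
  gcongr
  rw [← ENNReal.ofReal_mul (by positivity)]
  apply ENNReal.ofReal_le_ofReal
  -- Exponents cannot be added at k = 0, where 0^0 = 1 and 0^t = 0 for t ≠ 0 have to be treated
  -- separately.
  rcases (norm_nonneg k).eq_or_lt with h0 | h0
  · rw [← h0]
    rcases eq_or_ne e 0 with he | he
    · rcases hq.eq_or_lt with h | h
      · rw [← h, he]; simp
      · rw [Real.zero_rpow h.ne', zero_mul]; positivity
    · rw [Real.zero_rpow (neg_ne_zero.2 he), mul_zero]; positivity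
  · rw [← Real.rpow_add h0]
    apply le_of_eq; ring_nf

set_option maxHeartbeats 1600000 in
/-- The energy of the difference quotient, localised to a smaller ball. -/
lemma exists_energy_bound (hN : 1 ≤ N) (hp : p ∈ Ioo (1 : ℝ) 2)
    (hs : s ∈ Ioo (0 : ℝ) 1) (hs₁ : s₁ ∈ Ioo (0 : ℝ) 1) {q θ : ℝ} (hq : p ≤ q) (hθ : 0 ≤ θ)
    (hsθ : s * p - 1 < θ * (p - 1)) :
    ∃ C κ : ℝ, 0 ≤ C ∧ 0 ≤ κ ∧ ∀ (l : ℝ) (x₀ : E N) (R : ℝ) (u : E N → ℝ) (Z : E N × E N → ℝ),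
      NormSol s₁ s p l x₀ R u Z → R ≤ 1 → ∀ (r K : ℝ), 0 < r → r < R → 1 ≤ K →
      Nik u (ball x₀ (r + (R - r) / 2)) θ q K → ∀ h : E N, h ≠ 0 → ‖h‖ < (R - r) / 16 →
      ∫⁻ x in ball x₀ (r + (R - r) / 8), ∫⁻ y in ball x₀ (r + (R - r) / 8),
        ENNReal.ofReal ((|u (x + h) - u (y + h)| + |u x - u y|) ^ (p - 2) *
        |(u (x + h) - u x) - (u (y + h) - u y)| ^ (q + 2 - p)) *
        ENNReal.ofReal (‖x - y‖ ^ (-((N : ℝ) + s * p))) ≤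
      ENNReal.ofReal (C * K * (R - r) ^ (-κ) * ‖h‖ ^ (θ * (q + 1 - p))) := by
  have hp1 := hp.1
  set β := q + 1 - p with hβ
  have hβ1 : 1 ≤ β := by linarith
  set e : ℝ := (N : ℝ) + s * p with he
  set e₁ : ℝ := (N : ℝ) + s₁ with he₁
  -- The weight exponent left by the cutoff error of the p-part; e' < N is the hypothesis sp - 1 <
  -- θ(p-1).
  set e' : ℝ := e - 1 - θ * (p - 1) with he'
  obtain ⟨C₃, κ₃, hC₃, hκ₃, hcross⟩ := exists_cross_le N hp hs.1 hs₁.1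
  have hM₁fin := lintegral_ball_rpow_lt_top hN (e := e₁ - 1) (by rw [he₁]; linarith [hs₁.2]) 2
  have hM₂fin := lintegral_ball_rpow_lt_top hN (e := e') (by rw [he', he]; linarith) 2
  set M₁ := (∫⁻ k in ball (0 : E N) 2, ENNReal.ofReal (‖k‖ ^ (-(e₁ - 1)))).toReal with hM₁
  set M₂ := (∫⁻ k in ball (0 : E N) 2, ENNReal.ofReal (‖k‖ ^ (-e'))).toReal with hM₂
  have hM₁0 : 0 ≤ M₁ := ENNReal.toReal_nonneg
  have hM₂0 : 0 ≤ M₂ := ENNReal.toReal_nonneg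
  set V := (volume (ball (0 : E N) 1)).toReal + 1 with hV
  have hV0 : 0 ≤ V := by positivity
  set c₀ : ℝ := (p - 1) * 2 ^ (1 - β) with hc₀
  have hc₀0 : 0 < c₀ := mul_pos (by linarith) (by positivity)
  refine ⟨(16 * V * M₁ + 32 * M₂ + 2 * C₃ * 8 ^ κ₃ * V) / c₀, 1 + κ₃, by positivity, by positivity,
    ?_⟩
  intro l x₀ R u Z H hR r K hr hrR hK hNik h hh hhD
  have hu := H.measurable_u
  have hh0 : 0 < ‖h‖ := norm_pos_iff.2 hh
  set D := R - r with hD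
  have hD0 : 0 < D := by linarith
  have hD1 : D ≤ 1 := by linarith
  -- The cutoff equals 1 up to radius r + D/8 and vanishes beyond r + D/4, so its support has
  -- distance at least D/8 from the complement of the ball of radius r'. Since |h| < D/16, shifts of
  -- that ball stay within radius r + D/2, where the modulus is assumed.
  set r' := r + 3 * D / 8 with hr'
  have hr'1 : r' ≤ 1 := by linarith
  have hr'h : r' + ‖h‖ ≤ r + D / 2 := by linarith
  have hr'R : r' + ‖h‖ ≤ R := by linarith
  have hK0 : 0 ≤ K := by linarith
  obtain ⟨η, hηm, hηL, hη1, hη0, hηout, hηin⟩ := exists_cutoff x₀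
    (r := r + D / 8) (t := r + D / 4) (by linarith)
  have hDL : 1 / (r + D / 4 - (r + D / 8)) = 8 / D := by
    rw [show r + D / 4 - (r + D / 8) = D / 8 by ring, one_div_div]
  rw [hDL] at hηL
  have henergy := H.energy_le hN hp hs hs₁ hR (ρ := r + D / 4) (r := r') (by linarith)
    hr'R hβ1 hηm (by positivity : (0 : ℝ) ≤ 8 / D) hηL hη1 hη0 hηout
  set A : E N → ℝ := fun x => u (x + h) - u x with hA
  have hAm : Measurable A := by fun_prop
  set Hβ := ‖h‖ ^ (θ * β) with hHβ
  have hHβ0 : 0 ≤ Hβ := by positivity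
  have hIA : ∫⁻ x in ball x₀ r', ENNReal.ofReal (|A x| ^ β) ≤ ENNReal.ofReal (V * K * Hβ) :=
    hNik.lintegral_shift_rpow_le hu hK hr'h hr'1 hh (by linarith) (by linarith)
  have hIq : ∫⁻ x in ball x₀ r', ENNReal.ofReal (|A x| ^ q) ≤
      ENNReal.ofReal (K * ‖h‖ ^ (θ * q)) := hNik.lintegral_shift_le hr'h
  -- the contribution of the sign graph
  have hT1 : ∫⁻ x in ball x₀ r', ∫⁻ y in ball x₀ r',
      ENNReal.ofReal ((|A x| ^ β + |A y| ^ β) * |η x - η y|) *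
        ENNReal.ofReal (‖x - y‖ ^ (-e₁)) ≤ ENNReal.ofReal (16 * V * M₁ * (K * Hβ * D⁻¹)) := by
    calc _ ≤ ∫⁻ x in ball x₀ r', ∫⁻ y in ball x₀ r', ENNReal.ofReal (8 / D) *
          ((ENNReal.ofReal (|A x| ^ β) + ENNReal.ofReal (|A y| ^ β)) *
            ENNReal.ofReal (‖x - y‖ ^ (-(e₁ - 1)))) := by
          refine lintegral_mono fun x => lintegral_mono fun y => ?_
          rw [← ENNReal.ofReal_add (by positivity) (by positivity),
            ← ENNReal.ofReal_mul (by positivity), ← ENNReal.ofReal_mul (by positivity),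
            ← ENNReal.ofReal_mul (by positivity)]
          apply ENNReal.ofReal_le_ofReal
          rcases (norm_nonneg (x - y)).eq_or_lt with h0 | h0
          · have : x = y := sub_eq_zero.1 (norm_eq_zero.1 h0.symm)
            rw [this, sub_self, abs_zero, mul_zero, zero_mul]
            positivity
          · have : ‖x - y‖ ^ (-(e₁ - 1)) = ‖x - y‖ * ‖x - y‖ ^ (-e₁) := by
              rw [← Real.rpow_one_add' h0.le (by linarith [hs₁.1, hs₁.2, (Nat.one_le_cast (α := ℝ)).2 hN])]
              ring_nf
            rw [this]
            calc _ ≤ (|A x| ^ β + |A y| ^ β) * (8 / D * ‖x - y‖) * ‖x - y‖ ^ (-e₁) := by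
                  gcongr
                  exact hηL x y
              _ = _ := by ring
      _ = ENNReal.ofReal (8 / D) * ∫⁻ x in ball x₀ r', ∫⁻ y in ball x₀ r',
          ((ENNReal.ofReal (|A x| ^ β) + ENNReal.ofReal (|A y| ^ β)) *
            ENNReal.ofReal (‖x - y‖ ^ (-(e₁ - 1)))) := setLIntegral_pair_const_mul _
      _ ≤ ENNReal.ofReal (8 / D) * (2 * (ENNReal.ofReal (V * K * Hβ) * ENNReal.ofReal M₁)) := by
          refine mul_le_mul_right ((setLIntegral_pair_add_le (by fun_prop)
            (W := fun t => ENNReal.ofReal (t ^ (-(e₁ - 1)))) (by fun_prop) hr'1).trans ?_) _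
          rw [hM₁, ENNReal.ofReal_toReal hM₁fin.ne]
          gcongr
      _ = _ := by
          rw [← ENNReal.ofReal_mul (by positivity), two_mul_ofReal,
            ← ENNReal.ofReal_mul (by positivity)]
          congr 1
          field_simp; ring
  -- The modulus supplies |k|^{θq}, and e - 1 + θβ - θq = e', so u and its translate both lead to
  -- the integrable weight.
  have hpair : ∀ v : E N → ℝ, pairEnergy (e - 1 + θ * β) q v (ball x₀ r') ≤
      pairEnergy (e - 1 + θ * β) q u (ball x₀ (r + D / 2)) →
      pairEnergy (e - 1 + θ * β) q v (ball x₀ r') ≤ ENNReal.ofReal (K * M₂) := by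
    intro v hv
    refine (hv.trans (hNik.pairEnergy_le hu (by linarith) hK0 ?_)).trans (le_of_eq ?_)
    · exact mul_nonneg hθ (by linarith)
    · rw [ENNReal.ofReal_mul hK0, hM₂, ENNReal.ofReal_toReal hM₂fin.ne,
        show e - 1 + θ * β - θ * q = e' by rw [he', hβ]; ring]
  have hT2 : ∫⁻ x in ball x₀ r', ∫⁻ y in ball x₀ r',
      ENNReal.ofReal ((|u (x + h) - u (y + h)| ^ (p - 1) + |u x - u y| ^ (p - 1)) *
        (|A x| ^ β + |A y| ^ β) * (|η x - η y| / 2)) * ENNReal.ofReal (‖x - y‖ ^ (-e)) ≤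
      ENNReal.ofReal (32 * M₂ * (K * Hβ * D⁻¹)) := by
    calc _ ≤ ∫⁻ x in ball x₀ r', ∫⁻ y in ball x₀ r', (ENNReal.ofReal (8 / D * Hβ) *
          ((ENNReal.ofReal (|u (x + h) - u (y + h)| ^ q) *
              ENNReal.ofReal (‖x - y‖ ^ (-(e - 1 + θ * β)))) +
            (ENNReal.ofReal (|u x - u y| ^ q) *
              ENNReal.ofReal (‖x - y‖ ^ (-(e - 1 + θ * β))))) +
          ENNReal.ofReal (8 / D * ‖h‖ ^ (-(θ * (p - 1)))) *
          ((ENNReal.ofReal (|A x| ^ q) + ENNReal.ofReal (|A y| ^ q)) *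
            ENNReal.ofReal (‖x - y‖ ^ (-e')))) := by
          refine lintegral_mono fun x => lintegral_mono fun y => ?_
          rw [← add_mul, ← ENNReal.ofReal_add (by positivity) (by positivity),
            ← ENNReal.ofReal_add (by positivity) (by positivity),
            ← ENNReal.ofReal_mul (by positivity), ← ENNReal.ofReal_mul (by positivity),
            ← ENNReal.ofReal_mul (by positivity), ← ENNReal.ofReal_mul (by positivity),
            ← ENNReal.ofReal_mul (by positivity), ← ENNReal.ofReal_add (by positivity)
            (by positivity)]
          apply ENNReal.ofReal_le_ofReal
          refine le_trans ?_ (cutoff_error_le (e := e) (θ := θ) hp1 hq (abs_nonneg _) (abs_nonneg _)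
            (abs_nonneg _) (abs_nonneg _) (norm_nonneg (x - y)) hh0 (by positivity : 0 ≤ 8 / D))
          gcongr
          exact hηL x y
      _ = ENNReal.ofReal (8 / D * Hβ) * (pairEnergy (e - 1 + θ * β) q (fun x => u (x + h))
            (ball x₀ r') + pairEnergy (e - 1 + θ * β) q u (ball x₀ r')) +
          ENNReal.ofReal (8 / D * ‖h‖ ^ (-(θ * (p - 1)))) *
            ∫⁻ x in ball x₀ r', ∫⁻ y in ball x₀ r',
            ((ENNReal.ofReal (|A x| ^ q) + ENNReal.ofReal (|A y| ^ q)) *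
            ENNReal.ofReal (‖x - y‖ ^ (-e'))) := by
          rw [setLIntegral_pair_add (by unfold Function.uncurry; fun_prop),
            setLIntegral_pair_const_mul, setLIntegral_pair_const_mul,
            setLIntegral_pair_add (by unfold Function.uncurry; fun_prop)]
          rfl
      _ ≤ ENNReal.ofReal (8 / D * Hβ) * (ENNReal.ofReal (K * M₂) + ENNReal.ofReal (K * M₂)) +
          ENNReal.ofReal (8 / D * ‖h‖ ^ (-(θ * (p - 1)))) *
            (2 * (ENNReal.ofReal (K * ‖h‖ ^ (θ * q)) * ENNReal.ofReal M₂)) := by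
          refine add_le_add (mul_le_mul_right (add_le_add (hpair _ ?_) (hpair _ ?_)) _)
            (mul_le_mul_right ((setLIntegral_pair_add_le (by fun_prop)
            (W := fun t => ENNReal.ofReal (t ^ (-e'))) (by fun_prop) hr'1).trans ?_) _)
          · exact (pairEnergy_shift_le _ _ _ _ _ _).trans
              (pairEnergy_mono_set (ball_subset_ball hr'h))
          · exact pairEnergy_mono_set (ball_subset_ball (by linarith))
          · rw [hM₂, ENNReal.ofReal_toReal hM₂fin.ne]
            gcongr
      _ = _ := by
          have hpow : ‖h‖ ^ (-(θ * (p - 1))) * ‖h‖ ^ (θ * q) = Hβ := by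
            rw [← Real.rpow_add hh0, hHβ, hβ]; ring_nf
          rw [← ENNReal.ofReal_mul (by positivity), two_mul_ofReal,
            ← ENNReal.ofReal_add (by positivity) (by positivity),
            ← ENNReal.ofReal_mul (by positivity), ← ENNReal.ofReal_mul (by positivity),
            ← ENNReal.ofReal_add (by positivity) (by positivity)]
          congr 1
          calc _ = 8 / D * Hβ * (K * M₂ + K * M₂) + 8 / D * (2 * (K * M₂)) *
                (‖h‖ ^ (-(θ * (p - 1))) * ‖h‖ ^ (θ * q)) := by ring
            _ = _ := by rw [hpow]; field_simp; ring
  have hT3 : ∫⁻ x in ball x₀ r', ∫⁻ y in (ball x₀ r')ᶜ, ENNReal.ofReal (|A x| ^ β * η x) *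
      (ENNReal.ofReal (2 * ‖x - y‖ ^ (-e₁)) +
      ENNReal.ofReal ((|u (x + h) - u (y + h)| ^ (p - 1) + |u x - u y| ^ (p - 1)) *
        ‖x - y‖ ^ (-e))) ≤ ENNReal.ofReal (C₃ * 8 ^ κ₃ * V * (K * Hβ * D ^ (-κ₃))) := by
    calc _ ≤ ∫⁻ x in ball x₀ r', ENNReal.ofReal (|A x| ^ β) *
          ENNReal.ofReal (C₃ * (D / 8) ^ (-κ₃)) := by
          refine setLIntegral_mono' measurableSet_ball fun x hx => ?_
          rw [lintegral_const_mul' _ _ ENNReal.ofReal_ne_top]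
          by_cases hx' : x ∈ closedBall x₀ (r + D / 4)
          · gcongr
            · exact mul_le_of_le_one_right (by positivity) (hη1 x)
            · refine le_trans (lintegral_mono_set ?_) (hcross l x₀ R u Z H hR x h (D / 8)
                (by positivity) (by linarith) (ball_subset_ball (by linarith) hx)
                (ball_subset_ball hr'R (add_mem_ball_of_mem hx)))
              intro y hy
              have := le_norm_sub_of_mem_of_notMem hx' hy
              rw [mem_ofPred_eq]
              linarith
          · rw [hηout x hx']
            simp
      _ = (∫⁻ x in ball x₀ r', ENNReal.ofReal (|A x| ^ β)) *
          ENNReal.ofReal (C₃ * (D / 8) ^ (-κ₃)) := lintegral_mul_const _ (by fun_prop)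
      _ ≤ ENNReal.ofReal (V * K * Hβ) * ENNReal.ofReal (C₃ * (D / 8) ^ (-κ₃)) := by gcongr
      _ = _ := by
          rw [← ENNReal.ofReal_mul (by positivity)]
          congr 1
          rw [Real.div_rpow hD0.le (by norm_num), Real.rpow_neg (by norm_num : (0 : ℝ) ≤ 8)]
          field_simp
  have hsum := henergy.trans (add_le_add
    ((setLIntegral_pair_add (by unfold Function.uncurry; fun_prop)).le.trans (add_le_add hT1 hT2))
    (mul_le_mul_right hT3 2))
  have hlow : ENNReal.ofReal c₀ * ∫⁻ x in ball x₀ (r + D / 8), ∫⁻ y in ball x₀ (r + D / 8),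
        ENNReal.ofReal ((|u (x + h) - u (y + h)| + |u x - u y|) ^ (p - 2) *
        |A x - A y| ^ (q + 2 - p)) * ENNReal.ofReal (‖x - y‖ ^ (-e)) ≤
      ∫⁻ x in ball x₀ r', ∫⁻ y in ball x₀ r', ENNReal.ofReal (c₀ *
      ((|u (x + h) - u (y + h)| + |u x - u y|) ^ (p - 2) * |A x - A y| ^ (β + 1)) *
        ((η x + η y) / 2)) * ENNReal.ofReal (‖x - y‖ ^ (-e)) := by
    have hss : ball x₀ (r + D / 8) ⊆ ball x₀ r' := ball_subset_ball (by linarith)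
    rw [← setLIntegral_pair_const_mul]
    refine le_trans (setLIntegral_mono' measurableSet_ball fun x hx => ?_) (lintegral_mono_set hss)
    refine le_trans (setLIntegral_mono' measurableSet_ball fun y hy => ?_) (lintegral_mono_set hss)
    rw [← mul_assoc, ← ENNReal.ofReal_mul hc₀0.le, hηin x hx, hηin y hy,
      show (1 + 1 : ℝ) / 2 = 1 by norm_num, mul_one, show β + 1 = q + 2 - p by rw [hβ]; ring]
  have hfinal := hlow.trans hsum
  rw [two_mul_ofReal, ← ENNReal.ofReal_add (by positivity) (by positivity),
    ← ENNReal.ofReal_add (by positivity) (by positivity)] at hfinal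
  have hcne : ENNReal.ofReal c₀ ≠ 0 := (ENNReal.ofReal_pos.2 hc₀0).ne'
  rw [mul_comm, ← ENNReal.le_div_iff_mul_le (Or.inl hcne) (Or.inl ENNReal.ofReal_ne_top),
    ← ENNReal.ofReal_div_of_pos hc₀0] at hfinal
  refine hfinal.trans (ENNReal.ofReal_le_ofReal ?_)
  have i1 : D⁻¹ ≤ D ^ (-(1 + κ₃)) := by
    rw [← Real.rpow_neg_one]
    exact rpow_neg_le_rpow_neg hD0 hD1 (by linarith)
  have i2 : D ^ (-κ₃) ≤ D ^ (-(1 + κ₃)) := rpow_neg_le_rpow_neg hD0 hD1 (by linarith)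
  rw [div_le_iff₀ hc₀0]
  calc _ ≤ 16 * V * M₁ * (K * Hβ * D ^ (-(1 + κ₃))) + 32 * M₂ * (K * Hβ * D ^ (-(1 + κ₃))) +
        2 * (C₃ * 8 ^ κ₃ * V * (K * Hβ * D ^ (-(1 + κ₃)))) := by gcongr
    _ = _ := by field_simp

/-! ### Improvement of the differentiability exponent -/

lemma setLIntegral_pair_shift_le (F : E N → E N → ℝ≥0∞) (x₀ h : E N) (r : ℝ) :
    ∫⁻ x in ball x₀ r, ∫⁻ y in ball x₀ r, F (x + h) (y + h) ≤
      ∫⁻ x in ball x₀ (r + ‖h‖), ∫⁻ y in ball x₀ (r + ‖h‖), F x y :=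
  (lintegral_mono fun x => setLIntegral_ball_add_le (F (x + h)) x₀ h r).trans
    (setLIntegral_ball_add_le (fun x => ∫⁻ y in ball x₀ (r + ‖h‖), F x y) x₀ h r)

lemma setLIntegral_pair_mono_set (F : E N → E N → ℝ≥0∞) {S T : Set (E N)} (h : S ⊆ T) :
    ∫⁻ x in S, ∫⁻ y in S, F x y ≤ ∫⁻ x in T, ∫⁻ y in T, F x y :=
  (lintegral_mono_set h).trans (lintegral_mono fun _ => lintegral_mono_set h)

lemma Nik.lintegral_near_le {θ q K r ρ : ℝ} (hNik : Nik u (ball x₀ r) θ q K)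
    (hu : Measurable u) (hr : r ≤ 1) (hK : 0 ≤ K) (hθq : 0 ≤ θ * q) :
    ∫⁻ x in ball x₀ r, ∫⁻ y in ball x₀ r, ENNReal.ofReal (|u x - u y| ^ q) *
      (Iio ρ).indicator 1 ‖x - y‖ ≤
      ENNReal.ofReal (K * ρ ^ (θ * q)) * volume (ball (0 : E N) ρ) := by
  have hind : Measurable ((Iio ρ).indicator (1 : ℝ → ℝ≥0∞)) :=
    measurable_one.indicator measurableSet_Iio
  refine (hNik.lintegral_pair_le hu hr hind).trans ?_
  refine (setLIntegral_le_lintegral _ _).trans ?_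
  calc _ ≤ ∫⁻ k : E N, (ball (0 : E N) ρ).indicator
        (fun _ => ENNReal.ofReal (K * ρ ^ (θ * q))) k := by
        refine lintegral_mono fun k => ?_
        by_cases hk : ‖k‖ < ρ
        · rw [indicator_of_mem (mem_Iio.2 hk), indicator_of_mem (mem_ball_zero_iff.2 hk),
            Pi.one_apply, mul_one]
          gcongr
        · rw [indicator_of_notMem (by simpa using hk), mul_zero]
          positivity
    _ = _ := by rw [lintegral_indicator measurableSet_ball, setLIntegral_const]

/-- The gain in differentiability, for second differences. -/
lemma exists_second_difference_le (hN : 1 ≤ N) (hp : p ∈ Ioo (1 : ℝ) 2)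
    (hs : s ∈ Ioo (0 : ℝ) 1) (hs₁ : s₁ ∈ Ioo (0 : ℝ) 1) {q θ δ : ℝ} (hq : p ≤ q) (hθ : 0 ≤ θ)
    (hsθ : s * p - 1 < θ * (p - 1)) (hδ : δ * (q + 2 - p) ≤ s * p - θ * (p - 1)) :
    ∃ C κ : ℝ, 0 ≤ C ∧ 0 ≤ κ ∧ ∀ (l : ℝ) (x₀ : E N) (R : ℝ) (u : E N → ℝ) (Z : E N × E N → ℝ),
      NormSol s₁ s p l x₀ R u Z → R ≤ 1 → ∀ (r K : ℝ), 0 < r → r < R → 1 ≤ K →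
      Nik u (ball x₀ (r + (R - r) / 2)) θ q K → ∀ h : E N, h ≠ 0 → ‖h‖ < (R - r) / 16 →
      ∫⁻ x in ball x₀ r, ENNReal.ofReal (|(u (x + h + h) - u (x + h)) - (u (x + h) - u x)| ^ q) ≤
      ENNReal.ofReal (C * K * (R - r) ^ (-κ) * ‖h‖ ^ ((θ + δ) * q)) := by
  have hp1 := hp.1
  have hp2 := hp.2
  have hq0 : 0 < q := by linarith
  obtain ⟨C₀, κ, hC₀, hκ, henergy⟩ := exists_energy_bound hN hp hs hs₁ hq hθ hsθ
  set V := (volume (ball (0 : E N) 1)).toReal with hV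
  have hV0 : 0 < V := ENNReal.toReal_pos (measure_ball_pos _ _ one_pos).ne' measure_ball_lt_top.ne
  set e : ℝ := (N : ℝ) + s * p with he
  refine ⟨2 ^ q * 2 * (2 ^ e * C₀ / V + 2 ^ q * 2 * 2 ^ (θ * q) * 2 ^ N), κ, by positivity, hκ, ?_⟩
  intro l x₀ R u Z H hR r K hr hrR hK hNik h hh hhD
  have hu := H.measurable_u
  have hh0 : 0 < ‖h‖ := norm_pos_iff.2 hh
  have hen := henergy l x₀ R u Z H hR r K hr hrR hK hNik h hh hhD
  set D := R - r with hD
  have hD0 : 0 < D := by linarith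
  have hD1 : D ≤ 1 := by linarith
  have hh1 : ‖h‖ ≤ 1 := by linarith
  have hK0 : 0 ≤ K := by linarith
  set A : E N → ℝ := fun x => u (x + h) - u x with hA
  have hAm : Measurable A := by fun_prop
  -- Relative threshold for the degenerate weight: differences below τ(|a|+|b|) already gain
  -- |h|^{δq}, and for larger ones the weight costs only τ^{p-2}.
  set τ := ‖h‖ ^ δ with hτ
  have hτ0 : 0 < τ := by positivity
  set c₁ := τ ^ (p - 2) * (2 * ‖h‖) ^ e with hc₁
  set c₂ := τ ^ q * 2 ^ q with hc₂
  set ind : ℝ → ℝ≥0∞ := (Iio (2 * ‖h‖)).indicator 1 with hinddef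
  have hind : Measurable ind := measurable_one.indicator measurableSet_Iio
  set W₀ := volume (ball (0 : E N) ‖h‖) with hW₀
  have hW₀eq : W₀ = ENNReal.ofReal (‖h‖ ^ (N : ℝ) * V) := by
    rw [hW₀, Measure.addHaar_ball_of_pos volume (0 : E N) hh0,
      ENNReal.ofReal_mul (by positivity), hV,
      ENNReal.ofReal_toReal measure_ball_lt_top.ne]
    simp
  have hvol2 : volume (ball (0 : E N) (2 * ‖h‖)) = ENNReal.ofReal (2 ^ N) * W₀ := by
    rw [Measure.addHaar_ball_mul_of_pos volume (0 : E N) (by norm_num : (0 : ℝ) < 2)]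
    simp [hW₀]
  -- The second difference of u is the first difference of A = δ_h u, and it is estimated by nearby
  -- pairs, on which the kernel is at least (2|h|)^{-e}.
  have hAL := lintegral_diff_le_pair hAm x₀ h r hq0.le
  have hθq : 0 ≤ θ * q := by positivity
  have hnear := hNik.lintegral_near_le (ρ := 2 * ‖h‖) hu (by linarith) hK0 hθq
  have hpair : ∫⁻ x in ball x₀ (r + ‖h‖), ∫⁻ y in ball x₀ (r + ‖h‖),
      ENNReal.ofReal (|A x - A y| ^ q) * ind ‖x - y‖ ≤
      ENNReal.ofReal c₁ * ENNReal.ofReal (C₀ * K * D ^ (-κ) * ‖h‖ ^ (θ * (q + 1 - p))) +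
      ENNReal.ofReal c₂ * (2 * (ENNReal.ofReal (K * (2 * ‖h‖) ^ (θ * q)) *
        volume (ball (0 : E N) (2 * ‖h‖)))) := by
    calc _ ≤ ∫⁻ x in ball x₀ (r + ‖h‖), ∫⁻ y in ball x₀ (r + ‖h‖), (ENNReal.ofReal c₁ *
          (ENNReal.ofReal ((|u (x + h) - u (y + h)| + |u x - u y|) ^ (p - 2) *
            |A x - A y| ^ (q + 2 - p)) * ENNReal.ofReal (‖x - y‖ ^ (-e))) +
          ENNReal.ofReal c₂ * (ENNReal.ofReal (|u (x + h) - u (y + h)| ^ q) * ind ‖x - y‖ +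
            ENNReal.ofReal (|u x - u y| ^ q) * ind ‖x - y‖)) := by
          refine lintegral_mono fun x => lintegral_mono fun y => ?_
          by_cases hxy : ‖x - y‖ < 2 * ‖h‖
          · rw [hinddef, indicator_of_mem (mem_Iio.2 hxy), Pi.one_apply, mul_one, mul_one, mul_one,
              ← ENNReal.ofReal_add (by positivity) (by positivity),
              ← ENNReal.ofReal_mul (by positivity), ← ENNReal.ofReal_mul (by positivity),
              ← ENNReal.ofReal_mul (by positivity), ← ENNReal.ofReal_add (by positivity)
              (by positivity)]
            apply ENNReal.ofReal_le_ofReal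
            rcases (norm_nonneg (x - y)).eq_or_lt with h0 | h0
            · have : x = y := sub_eq_zero.1 (norm_eq_zero.1 h0.symm)
              rw [this, sub_self (A y), abs_zero, Real.zero_rpow hq0.ne']
              positivity
            set a := |u (x + h) - u (y + h)|
            set b := |u x - u y|
            have hAB : |A x - A y| ≤ a + b := by
              rw [show A x - A y = (u (x + h) - u (y + h)) - (u x - u y) by simp only [hA]; ring]
              exact abs_sub _ _
            have k1 := rpow_le_energy (abs_nonneg (A x - A y)) hAB hτ0 hp2 hq0
            have k2 : (a + b) ^ q ≤ 2 ^ q * (a ^ q + b ^ q) :=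
              add_rpow_le_two_rpow (abs_nonneg _) (abs_nonneg _) hq0.le
            have k3 : 1 ≤ (2 * ‖h‖) ^ e * ‖x - y‖ ^ (-e) := by
              rw [Real.rpow_neg h0.le, ← div_eq_mul_inv, one_le_div (by positivity)]
              have : 0 ≤ s * p := mul_nonneg hs.1.le (by linarith)
              exact Real.rpow_le_rpow h0.le hxy.le (by positivity)
            calc _ ≤ τ ^ (p - 2) * ((a + b) ^ (p - 2) * |A x - A y| ^ (q + 2 - p)) * 1 +
                  τ ^ q * (a + b) ^ q := by linarith
              _ ≤ τ ^ (p - 2) * ((a + b) ^ (p - 2) * |A x - A y| ^ (q + 2 - p)) *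
                  ((2 * ‖h‖) ^ e * ‖x - y‖ ^ (-e)) + τ ^ q * (2 ^ q * (a ^ q + b ^ q)) := by
                  gcongr
              _ = _ := by simp only [hc₁, hc₂]; ring
          · rw [hinddef, indicator_of_notMem (by simpa using hxy), mul_zero]
            positivity
      _ = ENNReal.ofReal c₁ * (∫⁻ x in ball x₀ (r + ‖h‖), ∫⁻ y in ball x₀ (r + ‖h‖),
          (ENNReal.ofReal ((|u (x + h) - u (y + h)| + |u x - u y|) ^ (p - 2) *
            |A x - A y| ^ (q + 2 - p)) * ENNReal.ofReal (‖x - y‖ ^ (-e)))) +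
          ENNReal.ofReal c₂ * ((∫⁻ x in ball x₀ (r + ‖h‖), ∫⁻ y in ball x₀ (r + ‖h‖),
            ENNReal.ofReal (|u (x + h) - u (y + h)| ^ q) * ind ‖x - y‖) +
            ∫⁻ x in ball x₀ (r + ‖h‖), ∫⁻ y in ball x₀ (r + ‖h‖),
            ENNReal.ofReal (|u x - u y| ^ q) * ind ‖x - y‖) := by
          rw [setLIntegral_pair_add (by unfold Function.uncurry; fun_prop),
            setLIntegral_pair_const_mul, setLIntegral_pair_const_mul,
            setLIntegral_pair_add (by unfold Function.uncurry; fun_prop)]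
      _ ≤ _ := by
          rw [two_mul]
          refine add_le_add (mul_le_mul_right ((setLIntegral_pair_mono_set _ ?_).trans hen) _)
            (mul_le_mul_right (add_le_add (le_trans ?_ hnear)
              ((setLIntegral_pair_mono_set _ ?_).trans hnear)) _)
          · exact ball_subset_ball (by linarith)
          · have hF : ∀ x y : E N, ENNReal.ofReal (|u (x + h) - u (y + h)| ^ q) * ind ‖x - y‖ =
                ENNReal.ofReal (|u (x + h) - u (y + h)| ^ q) * ind ‖(x + h) - (y + h)‖ := by
              intro x y
              rw [add_sub_add_right_eq_sub]
            simp_rw [hF]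
            exact (setLIntegral_pair_shift_le (fun x y => ENNReal.ofReal (|u x - u y| ^ q) *
              ind ‖x - y‖) x₀ h _).trans
              (setLIntegral_pair_mono_set _ (ball_subset_ball (by linarith)))
          · exact ball_subset_ball (by linarith)
  -- The comparison of exponents is precisely δ(q+2-p) ≤ sp - θ(p-1), together with |h| ≤ 1.
  have hexp : ‖h‖ ^ (δ * (p - 2) + s * p + θ * (q + 1 - p)) ≤ ‖h‖ ^ ((θ + δ) * q) := by
    apply Real.rpow_le_rpow_of_exponent_ge hh0 hh1
    nlinarith
  have hc₁eq : c₁ * (C₀ * K * D ^ (-κ) * ‖h‖ ^ (θ * (q + 1 - p))) =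
      2 ^ e * C₀ / V * K * D ^ (-κ) * ‖h‖ ^ (δ * (p - 2) + s * p + θ * (q + 1 - p)) *
        (‖h‖ ^ (N : ℝ) * V) := by
    have : ‖h‖ ^ (δ * (p - 2) + s * p + θ * (q + 1 - p)) * ‖h‖ ^ (N : ℝ) =
        τ ^ (p - 2) * ‖h‖ ^ e * ‖h‖ ^ (θ * (q + 1 - p)) := by
      rw [hτ, ← Real.rpow_mul hh0.le, ← Real.rpow_add hh0, ← Real.rpow_add hh0,
        ← Real.rpow_add hh0, he]
      ring_nf
    calc _ = 2 ^ e * C₀ * K * D ^ (-κ) * (τ ^ (p - 2) * ‖h‖ ^ e * ‖h‖ ^ (θ * (q + 1 - p))) := by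
          rw [hc₁, Real.mul_rpow (by norm_num) hh0.le]; ring
      _ = _ := by rw [← this]; field_simp
  have hc₂eq : c₂ * (2 * (K * (2 * ‖h‖) ^ (θ * q) * 2 ^ N)) =
      2 ^ q * 2 * 2 ^ (θ * q) * 2 ^ N * K * ‖h‖ ^ ((θ + δ) * q) := by
    have : ‖h‖ ^ ((θ + δ) * q) = τ ^ q * ‖h‖ ^ (θ * q) := by
      rw [hτ, ← Real.rpow_mul hh0.le, ← Real.rpow_add hh0]; ring_nf
    rw [this, hc₂, Real.mul_rpow (by norm_num) hh0.le]; ring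
  have hW₀0 : W₀ ≠ 0 := (measure_ball_pos _ _ hh0).ne'
  have hW₀t : W₀ ≠ ∞ := measure_ball_lt_top.ne
  -- Averaging produced the volume of a ball of radius |h|; cancelling it removes the N from e = N +
  -- sp.
  rw [← ENNReal.mul_le_mul_iff_right hW₀0 hW₀t]
  refine hAL.trans ?_
  refine (mul_le_mul_right (mul_le_mul_right hpair 2) _).trans ?_
  have hDκ : 1 ≤ D ^ (-κ) := one_le_rpow_neg hD0 hD1 hκ
  calc _ = ENNReal.ofReal (2 ^ q) * (2 * (ENNReal.ofReal (c₁ * (C₀ * K * D ^ (-κ) *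
          ‖h‖ ^ (θ * (q + 1 - p)))) +
        ENNReal.ofReal (c₂ * (2 * (K * (2 * ‖h‖) ^ (θ * q) * 2 ^ N))) * W₀)) := by
        rw [hvol2, ENNReal.ofReal_mul (p := c₁) (by positivity),
          ENNReal.ofReal_mul (p := c₂) (by positivity), ENNReal.ofReal_mul (p := 2) (by norm_num),
          ENNReal.ofReal_mul (q := 2 ^ N) (by positivity), ENNReal.ofReal_ofNat]
        ring
    _ = ENNReal.ofReal (2 ^ q) * (2 * (ENNReal.ofReal (2 ^ e * C₀ / V * K * D ^ (-κ) *
          ‖h‖ ^ (δ * (p - 2) + s * p + θ * (q + 1 - p))) +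
        ENNReal.ofReal (2 ^ q * 2 * 2 ^ (θ * q) * 2 ^ N * K * ‖h‖ ^ ((θ + δ) * q)))) * W₀ := by
        rw [hc₁eq, hc₂eq, ENNReal.ofReal_mul (q := ‖h‖ ^ (N : ℝ) * V) (by positivity), ← hW₀eq]
        ring
    _ ≤ _ := by
        rw [mul_comm W₀, ← ENNReal.ofReal_add (by positivity) (by positivity), two_mul_ofReal,
          ← ENNReal.ofReal_mul (by positivity)]
        refine mul_le_mul_left (ENNReal.ofReal_le_ofReal ?_) _
        calc _ ≤ 2 ^ q * (2 * (2 ^ e * C₀ / V * K * D ^ (-κ) * ‖h‖ ^ ((θ + δ) * q) +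
              2 ^ q * 2 * 2 ^ (θ * q) * 2 ^ N * K * ‖h‖ ^ ((θ + δ) * q) * D ^ (-κ))) := by
              exact mul_le_mul_of_nonneg_left (mul_le_mul_of_nonneg_left (add_le_add
                (mul_le_mul_of_nonneg_left hexp (by positivity))
                (le_mul_of_one_le_right (by positivity) hDκ)) (by norm_num)) (by positivity)
          _ = _ := by ring

/-- The a priori bound of order `θ` in `L^q` for all normalised solutions. -/
def NikBound (N : ℕ) (s₁ s p q θ : ℝ) : Prop :=
  ∃ C κ : ℝ, 0 ≤ C ∧ 0 ≤ κ ∧ ∀ (l : ℝ) (x₀ : E N) (R : ℝ) (u : E N → ℝ) (Z : E N × E N → ℝ),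
    NormSol s₁ s p l x₀ R u Z → R ≤ 1 → ∀ r : ℝ, 0 < r → r < R →
      Nik u (ball x₀ r) θ q (C * (R - r) ^ (-κ))

lemma Nik.mono_const {B : Set (E N)} {θ q K K' : ℝ} (h : Nik u B θ q K) (hK : K ≤ K') :
    Nik u B θ q K' := fun k => (h k).trans (ENNReal.ofReal_le_ofReal (by gcongr))

lemma setLIntegral_ball_rpow_le {q r : ℝ} (hq : 0 ≤ q) (hr : r ≤ 1) {S : Set (E N)} {f : E N → ℝ}
    (hS : S ⊆ ball x₀ r) (hSm : MeasurableSet S) (hf : ∀ x ∈ S, |f x| ≤ 2) :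
    ∫⁻ x in S, ENNReal.ofReal (|f x| ^ q) ≤
      ENNReal.ofReal (2 ^ q * (volume (ball (0 : E N) 1)).toReal) := by
  calc _ ≤ ∫⁻ x in S, ENNReal.ofReal (2 ^ q) :=
        setLIntegral_mono' hSm fun x hx => ENNReal.ofReal_le_ofReal
          (Real.rpow_le_rpow (abs_nonneg _) (hf x hx) hq)
    _ = ENNReal.ofReal (2 ^ q) * volume S := setLIntegral_const _ _
    _ ≤ ENNReal.ofReal (2 ^ q) * ENNReal.ofReal (volume (ball (0 : E N) 1)).toReal := by
        gcongr
        exact (measure_mono hS).trans (volume_ball_le_one x₀ hr)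
    _ = _ := by rw [ENNReal.ofReal_mul (by positivity)]

/-- A modulus for small increments extends to all increments by boundedness. -/
lemma NormSol.nik_of_small (H : NormSol s₁ s p l x₀ R u Z) (hR : R ≤ 1) {r θ q K δ : ℝ}
    (hr : r ≤ R) (hq : 0 < q) (hθ : 0 ≤ θ) (hδ : 0 < δ) (hK : 0 ≤ K)
    (h : ∀ h : E N, ‖h‖ < δ → ∫⁻ x in ball x₀ r, ENNReal.ofReal (|u (x + h) - u x| ^ q) ≤
      ENNReal.ofReal (K * ‖h‖ ^ (θ * q))) :
    Nik u (ball x₀ r) θ q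
      (K + 2 ^ q * (volume (ball (0 : E N) 1)).toReal * δ ^ (-(θ * q))) := by
  intro k
  set V := (volume (ball (0 : E N) 1)).toReal
  have hV : 0 ≤ V := ENNReal.toReal_nonneg
  rcases lt_or_ge ‖k‖ δ with hk | hk
  · refine (lintegral_mono_set inter_subset_left).trans ((h k hk).trans ?_)
    apply ENNReal.ofReal_le_ofReal
    gcongr
    exact le_add_of_nonneg_right (by positivity)
  · have hsub : ball x₀ r ⊆ ball x₀ R := ball_subset_ball hr
    have hm : MeasurableSet (ball x₀ r ∩ {x | x + k ∈ ball x₀ r}) :=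
      measurableSet_ball.inter ((measurable_id.add_const k) measurableSet_ball)
    refine (setLIntegral_ball_rpow_le (f := fun x => u (x + k) - u x) hq.le (hr.trans hR)
      inter_subset_left hm ?_).trans (ENNReal.ofReal_le_ofReal ?_)
    · intro x hx
      exact (abs_sub _ _).trans (by
        linarith [H.abs_le_one _ (hsub hx.1), H.abs_le_one _ (hsub hx.2)])
    · calc 2 ^ q * V = 2 ^ q * V * δ ^ (-(θ * q)) * δ ^ (θ * q) := by
            rw [mul_assoc, ← Real.rpow_add hδ]; simp
        _ ≤ (K + 2 ^ q * V * δ ^ (-(θ * q))) * ‖k‖ ^ (θ * q) := by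
            gcongr
            exact le_add_of_nonneg_left hK

/-- One round of the bootstrap: the coercive estimate gains δ for second differences, the doubling
argument passes to first differences because θ + δ < 1, and boundedness of u covers large
increments. The assumed bound is used halfway between r and R, so only the power of R - r
deteriorates. -/
lemma NikBound.step (hN : 1 ≤ N) (hp : p ∈ Ioo (1 : ℝ) 2)
    (hs : s ∈ Ioo (0 : ℝ) 1) (hs₁ : s₁ ∈ Ioo (0 : ℝ) 1) {q θ δ : ℝ} (hq : p ≤ q) (hθ : 0 ≤ θ)
    (hsθ : s * p - 1 < θ * (p - 1)) (hδ0 : 0 ≤ δ) (hδ : δ * (q + 2 - p) ≤ s * p - θ * (p - 1))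
    (hθδ : θ + δ < 1) (h : NikBound N s₁ s p q θ) : NikBound N s₁ s p q (θ + δ) := by
  have hp1 := hp.1
  have hq0 : 0 < q := by linarith
  obtain ⟨C, κ, hC, hκ, hNik⟩ := h
  obtain ⟨C₂, κ₂, hC₂, hκ₂, h2⟩ := exists_second_difference_le hN hp hs hs₁ hq hθ hsθ hδ
  obtain ⟨C₁, hC₁, h1⟩ := exists_first_difference_le N hq0 (by linarith : 0 ≤ θ + δ) hθδ
  set V := (volume (ball (0 : E N) 1)).toReal with hV
  have hV0 : 0 ≤ V := ENNReal.toReal_nonneg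
  set t := (θ + δ) * q with ht
  have ht0 : 0 ≤ t := by positivity
  refine ⟨C₁ * (C₂ * ((C + 1) * 2 ^ κ) + 2 ^ q * V * 16 ^ t) + 2 ^ q * V * 16 ^ t, κ + κ₂ + t,
    by positivity, by positivity, ?_⟩
  intro l x₀ R u Z H hR r hr hrR
  have hu := H.measurable_u
  set D := R - r with hD
  have hD0 : 0 < D := by linarith
  have hD1 : D ≤ 1 := by linarith
  -- C + 1 in place of C guarantees K ≥ 1.
  set K := (C + 1) * (D / 2) ^ (-κ) with hK
  have hDκ : 1 ≤ (D / 2) ^ (-κ) := one_le_rpow_neg (by linarith) (by linarith) hκ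
  have hK1 : 1 ≤ K := by nlinarith
  have hn : Nik u (ball x₀ (r + D / 2)) θ q K := by
    have := hNik l x₀ R u Z H hR (r + D / 2) (by linarith) (by linarith)
    rw [show R - (r + D / 2) = D / 2 by rw [hD]; ring] at this
    refine this.mono_const ?_
    rw [hK]
    gcongr
    linarith
  have hsmall := h1 u (ball x₀ r) (C₂ * K * D ^ (-κ₂)) (2 ^ q * V) (D / 16) hu (by positivity)
    (by positivity) (by positivity)
    (fun h hh hhD => h2 l x₀ R u Z H hR r K hr hrR hK1 hn h hh hhD)
    (fun h hh => setLIntegral_ball_rpow_le (f := fun x => u (x + h) - u x) hq0.le (by linarith)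
      Subset.rfl measurableSet_ball fun x hx => H.abs_diff_le (by linarith) hx)
  refine (H.nik_of_small hR hrR.le hq0 (by linarith) (by positivity) (by positivity)
    hsmall).mono_const ?_
  have e1 : (D / 16) ^ (-t) = 16 ^ t * D ^ (-t) := by
    rw [Real.div_rpow hD0.le (by norm_num), Real.rpow_neg (by norm_num : (0 : ℝ) ≤ 16)]
    field_simp
  have e2 : (D / 2) ^ (-κ) = 2 ^ κ * D ^ (-κ) := by
    rw [Real.div_rpow hD0.le (by norm_num), Real.rpow_neg (by norm_num : (0 : ℝ) ≤ 2)]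
    field_simp
  have i1 : D ^ (-t) ≤ D ^ (-(κ + κ₂ + t)) := rpow_neg_le_rpow_neg hD0 hD1 (by linarith)
  have i2 : D ^ (-κ) * D ^ (-κ₂) ≤ D ^ (-(κ + κ₂ + t)) := by
    rw [← Real.rpow_add hD0]
    exact Real.rpow_le_rpow_of_exponent_ge hD0 hD1 (by linarith)
  rw [e1, hK, e2]
  calc _ = C₁ * (C₂ * ((C + 1) * 2 ^ κ) * (D ^ (-κ) * D ^ (-κ₂)) +
        2 ^ q * V * 16 ^ t * D ^ (-t)) + 2 ^ q * V * 16 ^ t * D ^ (-t) := by ring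
    _ ≤ C₁ * (C₂ * ((C + 1) * 2 ^ κ) * D ^ (-(κ + κ₂ + t)) +
        2 ^ q * V * 16 ^ t * D ^ (-(κ + κ₂ + t))) + 2 ^ q * V * 16 ^ t * D ^ (-(κ + κ₂ + t)) := by
        gcongr
    _ = _ := by ring

/-! ### Iteration -/

/-- Nearby pairs see a kernel of at least (2|h|)^{-N-sp}, so the normalised energy bounds their p-th
power differences; averaging over a ball of radius |h| divides by |h|^N. -/
lemma NikBound.base (hp : p ∈ Ioo (1 : ℝ) 2) (hs : s ∈ Ioo (0 : ℝ) 1) :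
    NikBound N s₁ s p p s := by
  have hp0 : 0 < p := by linarith [hp.1]
  have hs0 := hs.1
  set V := (volume (ball (0 : E N) 1)).toReal with hV
  have hV0 : 0 < V := ENNReal.toReal_pos (measure_ball_pos _ _ one_pos).ne' measure_ball_lt_top.ne
  set e : ℝ := (N : ℝ) + s * p with he
  refine ⟨2 ^ p * 2 * 2 ^ e / V + 2 ^ p * V * 2 ^ (s * p), s * p, by positivity, by positivity, ?_⟩
  intro l x₀ R u Z H hR r hr hrR
  have hu := H.measurable_u
  set D := R - r with hD
  have hD0 : 0 < D := by linarith
  have hD1 : D ≤ 1 := by linarith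
  have hsmall : ∀ h : E N, ‖h‖ < D / 2 → ∫⁻ x in ball x₀ r, ENNReal.ofReal (|u (x + h) - u x| ^ p) ≤
      ENNReal.ofReal (2 ^ p * 2 * 2 ^ e / V * ‖h‖ ^ (s * p)) := by
    intro h hh
    rcases eq_or_ne h 0 with rfl | hne
    · simp [Real.zero_rpow hp0.ne']
    have hh0 : 0 < ‖h‖ := norm_pos_iff.2 hne
    set W₀ := volume (ball (0 : E N) ‖h‖) with hW₀
    have hW₀eq : W₀ = ENNReal.ofReal (‖h‖ ^ (N : ℝ) * V) := by
      rw [hW₀, Measure.addHaar_ball_of_pos volume (0 : E N) hh0,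
        ENNReal.ofReal_mul (by positivity), hV, ENNReal.ofReal_toReal measure_ball_lt_top.ne]
      simp
    have hW₀0 : W₀ ≠ 0 := (measure_ball_pos _ _ hh0).ne'
    have hW₀t : W₀ ≠ ∞ := measure_ball_lt_top.ne
    rw [← ENNReal.mul_le_mul_iff_right hW₀0 hW₀t]
    refine (lintegral_diff_le_pair hu x₀ h r hp0.le).trans ?_
    have hpair : ∫⁻ x in ball x₀ (r + ‖h‖), ∫⁻ y in ball x₀ (r + ‖h‖),
        ENNReal.ofReal (|u x - u y| ^ p) * (Iio (2 * ‖h‖)).indicator 1 ‖x - y‖ ≤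
        ENNReal.ofReal ((2 * ‖h‖) ^ e) := by
      calc _ ≤ ∫⁻ x in ball x₀ (r + ‖h‖), ∫⁻ y in ball x₀ (r + ‖h‖), ENNReal.ofReal ((2 * ‖h‖) ^ e) *
            (ENNReal.ofReal (|u x - u y| ^ p) * ENNReal.ofReal (‖x - y‖ ^ (-e))) := by
            refine lintegral_mono fun x => lintegral_mono fun y => ?_
            by_cases hxy : ‖x - y‖ < 2 * ‖h‖
            · rw [indicator_of_mem (mem_Iio.2 hxy), Pi.one_apply, mul_one,
                ← ENNReal.ofReal_mul (by positivity), ← ENNReal.ofReal_mul (by positivity)]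
              apply ENNReal.ofReal_le_ofReal
              rcases (norm_nonneg (x - y)).eq_or_lt with h0 | h0
              · have : x = y := sub_eq_zero.1 (norm_eq_zero.1 h0.symm)
                rw [this, sub_self (u y), abs_zero, Real.zero_rpow hp0.ne']
                positivity
              have k3 : 1 ≤ (2 * ‖h‖) ^ e * ‖x - y‖ ^ (-e) := by
                rw [Real.rpow_neg h0.le, ← div_eq_mul_inv, one_le_div (by positivity)]
                exact Real.rpow_le_rpow h0.le hxy.le (by positivity)
              calc |u x - u y| ^ p ≤ |u x - u y| ^ p * ((2 * ‖h‖) ^ e * ‖x - y‖ ^ (-e)) :=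
                    le_mul_of_one_le_right (by positivity) k3
                _ = _ := by ring
            · rw [indicator_of_notMem (by simpa using hxy), mul_zero]
              positivity
        _ = ENNReal.ofReal ((2 * ‖h‖) ^ e) * pairEnergy e p u (ball x₀ (r + ‖h‖)) :=
            setLIntegral_pair_const_mul _
        _ ≤ ENNReal.ofReal ((2 * ‖h‖) ^ e) * 1 := by
            gcongr
            exact (pairEnergy_mono_set (ball_subset_ball (by linarith))).trans H.energy
        _ = _ := mul_one _
    refine (mul_le_mul_right (mul_le_mul_right hpair 2) _).trans (le_of_eq ?_)
    rw [two_mul_ofReal, hW₀eq, ← ENNReal.ofReal_mul (by positivity),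
      ← ENNReal.ofReal_mul (by positivity)]
    congr 1
    have : ‖h‖ ^ e = ‖h‖ ^ (N : ℝ) * ‖h‖ ^ (s * p) := by rw [← Real.rpow_add hh0]
    rw [Real.mul_rpow (by norm_num) hh0.le, this]
    field_simp
  refine (H.nik_of_small hR hrR.le hp0 hs0.le (by positivity) (by positivity)
    hsmall).mono_const ?_
  have e2 : (D / 2) ^ (-(s * p)) = 2 ^ (s * p) * D ^ (-(s * p)) := by
    rw [Real.div_rpow hD0.le (by norm_num), Real.rpow_neg (by norm_num : (0 : ℝ) ≤ 2)]
    field_simp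
  have h1 : 1 ≤ D ^ (-(s * p)) := one_le_rpow_neg hD0 hD1 (by positivity)
  rw [e2, add_mul]
  refine add_le_add (le_mul_of_one_le_right (by positivity) h1) (le_of_eq (by ring))

/-- At fixed q the admissible gain stays above a positive constant up to θ = 1, because sp - θ(p-1)
≥ sp - (p-1) > 0. The requirement sp - 1 < θ(p-1) of each step holds for all θ ≥ s since s < 1. -/
lemma NikBound.raise (hN : 1 ≤ N) (hp : p ∈ Ioo (1 : ℝ) 2) (hs : s ∈ Ioo (0 : ℝ) 1)
    (hsp : p - 1 < s * p) (hs₁ : s₁ ∈ Ioo (0 : ℝ) 1) {q : ℝ} (hq : p ≤ q)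
    (h : NikBound N s₁ s p q s) {θ : ℝ} (hθ : s ≤ θ) (hθ1 : θ < 1) : NikBound N s₁ s p q θ := by
  have hp1 := hp.1
  have hs0 := hs.1
  have hq2 : 0 < q + 2 - p := by linarith
  set d := (s * p - (p - 1)) / (q + 2 - p) with hd
  have hd0 : 0 < d := div_pos (by linarith) hq2
  have key : ∀ n : ℕ, ∀ θ : ℝ, s ≤ θ → θ < 1 → θ ≤ s + n * d → NikBound N s₁ s p q θ := by
    intro n
    induction n with
    | zero =>
      intro θ h1 _ h3
      have : θ = s := by
        simp at h3
        linarith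
      rwa [this]
    | succ n ih =>
      intro θ h1 h2 h3
      push_cast at h3
      -- The previous order lies at most d below the target, without falling under the starting
      -- order s.
      set θ' := max s (θ - d) with hθ'
      have h4 : s ≤ θ' := le_max_left _ _
      have h5 : θ' ≤ θ := max_le h1 (by linarith)
      have h6 : θ - θ' ≤ d := by linarith [le_max_right s (θ - d)]
      have h7 := ih θ' h4 (by linarith)
        (max_le (by have : 0 ≤ (n : ℝ) * d := by positivity
                    linarith) (by linarith))
      have h8 := h7.step hN hp hs hs₁ hq (by linarith)
        (by nlinarith [hs.2]) (δ := θ - θ') (by linarith) (by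
          have : (θ - θ') * (q + 2 - p) ≤ d * (q + 2 - p) := by gcongr
          rw [hd, div_mul_cancel₀ _ hq2.ne'] at this
          nlinarith) (by linarith)
      rwa [add_sub_cancel] at h8
  obtain ⟨n, hn⟩ := exists_nat_gt ((θ - s) / d)
  rw [div_lt_iff₀ hd0] at hn
  exact key n θ hθ hθ1 (by linarith)

/-- Differences of u are at most 2, so the additional q' - q powers cost a constant; the product of
order and exponent is unchanged. -/
lemma NikBound.change_exponent {q q' θ : ℝ} (hqq : q ≤ q') (hq' : 0 < q')
    (h : NikBound N s₁ s p q θ) : NikBound N s₁ s p q' (θ * q / q') := by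
  obtain ⟨C, κ, hC, hκ, hb⟩ := h
  refine ⟨2 ^ (q' - q) * C, κ, by positivity, hκ, ?_⟩
  intro l x₀ R u Z H hR r hr hrR k
  have hu := H.measurable_u
  have hsub : ball x₀ r ⊆ ball x₀ R := ball_subset_ball hrR.le
  have hm : MeasurableSet (ball x₀ r ∩ {x | x + k ∈ ball x₀ r}) :=
    measurableSet_ball.inter ((measurable_id.add_const k) measurableSet_ball)
  have hD : 0 ≤ R - r := by linarith
  rw [div_mul_cancel₀ _ hq'.ne', mul_assoc, mul_assoc, ENNReal.ofReal_mul (by positivity)]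
  have hk := hb l x₀ R u Z H hR r hr hrR k
  rw [mul_assoc] at hk
  refine le_trans ?_ (mul_le_mul_right hk _)
  rw [← lintegral_const_mul _ (by fun_prop)]
  refine setLIntegral_mono' hm fun x hx => ?_
  rw [← ENNReal.ofReal_mul (by positivity)]
  apply ENNReal.ofReal_le_ofReal
  have h2 : |u (x + k) - u x| ≤ 2 := (abs_sub _ _).trans (by
    linarith [H.abs_le_one _ (hsub hx.1), H.abs_le_one _ (hsub hx.2)])
  rcases (abs_nonneg (u (x + k) - u x)).eq_or_lt with h0 | h0
  · rw [← h0, Real.zero_rpow hq'.ne']; positivity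
  · calc |u (x + k) - u x| ^ q' = |u (x + k) - u x| ^ (q' - q) * |u (x + k) - u x| ^ q := by
          rw [← Real.rpow_add h0]; ring_nf
      _ ≤ _ := by
          gcongr

/-- All exponents are reached. -/
lemma nikBound_all (hN : 1 ≤ N) (hp : p ∈ Ioo (1 : ℝ) 2) (hs : s ∈ Ioo (0 : ℝ) 1)
    (hsp : p - 1 < s * p) (hs₁ : s₁ ∈ Ioo (0 : ℝ) 1) {q θ : ℝ} (hq : p ≤ q)
    (hθ : s ≤ θ) (hθ1 : θ < 1) : NikBound N s₁ s p q θ := by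
  have hp0 : 0 < p := by linarith [hp.1]
  obtain ⟨hs0, hs1⟩ := id hs
  -- Any ρ strictly between 1 and 1/s works: raising the order to at most sρ < 1 permits the
  -- exponent to grow by the factor ρ while order s is retained.
  obtain ⟨ρ, hρ1, hρs⟩ := exists_between (one_lt_one_div hs0 hs1)
  have hρ0 : 0 < ρ := by linarith
  have hρs' : ρ * s < 1 := (lt_div_iff₀ hs0).1 hρs
  have key : ∀ n : ℕ, ∀ q : ℝ, p ≤ q → q ≤ p * ρ ^ n → NikBound N s₁ s p q s := by
    intro n
    induction n with
    | zero =>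
      intro q h1 h2
      have : q = p := by
        simp at h2
        linarith
      rw [this]
      exact NikBound.base hp hs
    | succ n ih =>
      intro q h1 h2
      have hq0 : 0 < q := by linarith
      -- The induction hypothesis is applied at q₀; there the order is raised to sq/q₀ < 1 and then
      -- traded for order s at exponent q.
      set q₀ := max p (q / ρ) with hq₀
      have h3 : p ≤ q₀ := le_max_left _ _
      have hq₀0 : 0 < q₀ := by linarith
      have h4 : q₀ ≤ q := max_le h1 (div_le_self (by linarith) hρ1.le)
      have h5 : q ≤ q₀ * ρ := by
        have : q / ρ ≤ q₀ := le_max_right _ _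
        rwa [div_le_iff₀ hρ0] at this
      have h6 : q₀ ≤ p * ρ ^ n := by
        refine max_le (le_mul_of_one_le_right hp0.le (one_le_pow₀ hρ1.le)) ?_
        rw [div_le_iff₀ hρ0]
        calc q ≤ p * ρ ^ (n + 1) := h2
          _ = _ := by ring
      have h7 : s * q / q₀ < 1 := by
        rw [div_lt_one hq₀0]
        nlinarith
      have h8 : s ≤ s * q / q₀ := by
        rw [le_div_iff₀ hq₀0]
        gcongr
      have h9 := ((ih q₀ h3 h6).raise hN hp hs hsp hs₁ h3 h8 h7).change_exponent h4 hq0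
      rwa [div_mul_cancel₀ _ hq₀0.ne', mul_div_cancel_right₀ _ hq0.ne'] at h9
  obtain ⟨n, hn⟩ := pow_unbounded_of_one_lt (q / p) hρ1
  rw [div_lt_iff₀ hp0] at hn
  exact (key n q hq (by linarith)).raise hN hp hs hsp hs₁ hq hθ hθ1

open Filter Topology

/-! ### The Campanato–Morrey embedding -/

/-- The limit of the averages over dyadic balls. -/
def preciseRep (u : E N → ℝ) (x : E N) : ℝ :=
  limUnder atTop fun n : ℕ => ⨍ y in ball x ((1 / 2) ^ n), u y

lemma volume_mul_abs_sub_average_le {B : Set (E N)} {f : E N → ℝ} (hB0 : volume B ≠ 0)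
    (hB : volume B ≠ ∞) (hf : IntegrableOn f B) (c : ℝ) :
    volume B * ENNReal.ofReal |c - ⨍ y in B, f y| ≤ ∫⁻ y in B, ENNReal.ofReal |c - f y| := by
  have hc : IntegrableOn (fun _ => c) B := integrableOn_const hB
  have hv : volume.real B ≠ 0 := (ENNReal.toReal_pos hB0 hB).ne'
  have h1 : volume.real B * (c - ⨍ y in B, f y) = ∫ y in B, (c - f y) := by
    rw [integral_sub hc hf, setIntegral_const, setAverage_eq, smul_eq_mul, smul_eq_mul]
    field_simp
  calc volume B * ENNReal.ofReal |c - ⨍ y in B, f y|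
      = ENNReal.ofReal |∫ y in B, (c - f y)| := by
        rw [← h1, abs_mul, abs_of_nonneg measureReal_nonneg, ENNReal.ofReal_mul measureReal_nonneg,
          ofReal_measureReal hB]
    _ ≤ _ := by
        have := enorm_integral_le_lintegral_enorm (μ := volume.restrict B) fun y => c - f y
        simpa only [← ofReal_norm, Real.norm_eq_abs] using this

/-- The averages differ by at most the mean of |u(v)-u(w)|, which is bounded by ε +
ε^{1-q}|u(v)-u(w)|^q with ε = d^γ. The modulus of order γ + N/q bounds the mean of the q-th power by
a multiple of K d^{γq}, so both terms are of size d^γ. The factor 64^N comes from a, b ≥ d/8. -/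
lemma abs_average_sub_le {q γ K r d a b : ℝ} {z x y : E N}
    (hNik : Nik u (ball z r) (γ + N / q) q K) (hu : Measurable u)
    (hu1 : ∀ w ∈ ball z r, |u w| ≤ 1) (hr : r ≤ 1) (hK : 0 ≤ K) (hq : 1 ≤ q) (hγ : 0 ≤ γ)
    (hd : 0 < d) (ha : d / 8 ≤ a) (hb : d / 8 ≤ b) (hxa : ball x a ⊆ ball z r)
    (hyb : ball y b ⊆ ball z r) (hab : ∀ v ∈ ball x a, ∀ w ∈ ball y b, ‖v - w‖ < d) :
    |(⨍ v in ball x a, u v) - ⨍ w in ball y b, u w| ≤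
      (1 + K * 64 ^ N / (volume (ball (0 : E N) 1)).toReal) * d ^ γ := by
  have hq0 : 0 < q := by linarith
  set V := (volume (ball (0 : E N) 1)).toReal with hV
  have hV0 : 0 < V := ENNReal.toReal_pos (measure_ball_pos _ _ one_pos).ne' measure_ball_lt_top.ne
  have hint : ∀ S : Set (E N), S ⊆ ball z r → MeasurableSet S → IntegrableOn u S := by
    intro S hS hSm
    refine Measure.integrableOn_of_bounded (M := 1)
      ((measure_mono hS).trans_lt measure_ball_lt_top).ne hu.aestronglyMeasurable ?_
    filter_upwards [ae_restrict_mem hSm] with w hw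
    exact hu1 w (hS hw)
  have hvol : ∀ (w : E N) {t : ℝ}, 0 < t → volume (ball w t) = ENNReal.ofReal (t ^ N * V) := by
    intro w t ht
    rw [Measure.addHaar_ball_of_pos _ _ ht, finrank_euclideanSpace_fin,
      ENNReal.ofReal_mul (by positivity),
      hV, ENNReal.ofReal_toReal measure_ball_lt_top.ne]
  have ha0 : 0 < a := by linarith
  have hb0 : 0 < b := by linarith
  set m := ⨍ w in ball y b, u w with hm
  set M := ⨍ v in ball x a, u v with hM
  have h1 : volume (ball x a) * ENNReal.ofReal |M - m| ≤
      ∫⁻ v in ball x a, ENNReal.ofReal |u v - m| := by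
    have := volume_mul_abs_sub_average_le (measure_ball_pos volume x ha0).ne' measure_ball_lt_top.ne
      (hint _ hxa measurableSet_ball) m
    simpa only [abs_sub_comm m] using this
  have hm' : ∀ v, volume (ball y b) * ENNReal.ofReal |u v - m| ≤
      ∫⁻ w in ball y b, ENNReal.ofReal |u v - u w| := fun v =>
    volume_mul_abs_sub_average_le (measure_ball_pos volume y hb0).ne'
      measure_ball_lt_top.ne (hint _ hyb measurableSet_ball) (u v)
  clear_value m M
  set ε := d ^ γ with hε
  have hε0 : 0 < ε := by positivity
  set G : E N → E N → ℝ≥0∞ := fun v w => ENNReal.ofReal (|u v - u w| ^ q) *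
      (Iio d).indicator 1 ‖v - w‖ with hG
  have hind : Measurable ((Iio d).indicator (1 : ℝ → ℝ≥0∞)) :=
    measurable_one.indicator measurableSet_Iio
  have hGm : Measurable (Function.uncurry G) := by
    unfold Function.uncurry
    exact Measurable.mul (by fun_prop) (hind.comp (by fun_prop))
  have hinner : ∀ v ∈ ball x a, volume (ball y b) * ENNReal.ofReal |u v - m| ≤
      ENNReal.ofReal ε * volume (ball y b) + ENNReal.ofReal (ε ^ (1 - q)) *
        ∫⁻ w in ball y b, G v w := by
    intro v hv
    have hGv : Measurable (G v) := hGm.of_uncurry_left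
    have h7 : ∫⁻ w in ball y b, ENNReal.ofReal |u v - u w| ≤
        ∫⁻ w in ball y b, (ENNReal.ofReal ε + ENNReal.ofReal (ε ^ (1 - q)) * G v w) := by
      refine setLIntegral_mono' measurableSet_ball fun w hw => ?_
      have h8 : G v w = ENNReal.ofReal (|u v - u w| ^ q) := by
        rw [hG]
        simp only
        rw [indicator_of_mem (mem_Iio.2 (hab v hv w hw)), Pi.one_apply, mul_one]
      have h9 := rpow_le_scale (abs_nonneg (u v - u w)) hε0 zero_le_one hq
      rw [Real.rpow_one, Real.rpow_one] at h9
      rw [h8, ← ENNReal.ofReal_mul (by positivity), ← ENNReal.ofReal_add hε0.le (by positivity)]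
      exact ENNReal.ofReal_le_ofReal h9
    refine (hm' v).trans (h7.trans (le_of_eq ?_))
    rw [lintegral_add_left measurable_const, setLIntegral_const, lintegral_const_mul _ hGv]
  have h2 : volume (ball y b) * (volume (ball x a) * ENNReal.ofReal |M - m|) ≤
      ENNReal.ofReal ε * volume (ball y b) * volume (ball x a) + ENNReal.ofReal (ε ^ (1 - q)) *
        ∫⁻ v in ball x a, ∫⁻ w in ball y b, G v w := by
    calc _ ≤ volume (ball y b) * ∫⁻ v in ball x a, ENNReal.ofReal |u v - m| :=
          mul_le_mul_right h1 _
      _ = ∫⁻ v in ball x a, volume (ball y b) * ENNReal.ofReal |u v - m| :=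
          (lintegral_const_mul _ (by fun_prop)).symm
      _ ≤ ∫⁻ v in ball x a, (ENNReal.ofReal ε * volume (ball y b) + ENNReal.ofReal (ε ^ (1 - q)) *
            ∫⁻ w in ball y b, G v w) := by
          exact setLIntegral_mono' measurableSet_ball hinner
      _ = _ := by
          rw [lintegral_add_left measurable_const, setLIntegral_const, lintegral_const_mul]
          exact Measurable.lintegral_prod_right' hGm
  have h3 : ∫⁻ v in ball x a, ∫⁻ w in ball y b, G v w ≤
      ENNReal.ofReal (K * d ^ ((γ + N / q) * q) * (d ^ N * V)) := by
    rw [ENNReal.ofReal_mul (by positivity), ← hvol 0 hd]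
    refine le_trans ?_ (hNik.lintegral_near_le hu hr hK (by positivity))
    exact (lintegral_mono_set hxa).trans (lintegral_mono fun _ => lintegral_mono_set hyb)
  have h4 : b ^ N * V * (a ^ N * V * |M - m|) ≤ ε * (b ^ N * V) * (a ^ N * V) + ε ^ (1 - q) *
      (K * d ^ ((γ + N / q) * q) * (d ^ N * V)) := by
    rw [← ENNReal.ofReal_le_ofReal_iff (by positivity), ENNReal.ofReal_mul (by positivity),
      ENNReal.ofReal_mul (p := a ^ N * V) (by positivity), ← hvol x ha0, ← hvol y hb0]
    refine h2.trans ?_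
    rw [ENNReal.ofReal_add (by positivity) (by positivity), ENNReal.ofReal_mul (by positivity),
      ENNReal.ofReal_mul (p := ε) hε0.le, ENNReal.ofReal_mul (p := ε ^ (1 - q)) (by positivity),
      ← hvol x ha0, ← hvol y hb0]
    gcongr
  have h5 : ε ^ (1 - q) * (K * d ^ ((γ + N / q) * q) * (d ^ N * V)) =
      ε * (K * (d ^ N * d ^ N * V)) := by
    have : ε ^ (1 - q) * d ^ ((γ + N / q) * q) = ε * d ^ N := by
      rw [hε, ← Real.rpow_mul hd.le, ← Real.rpow_natCast, ← Real.rpow_add hd, ← Real.rpow_add hd]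
      congr 1
      field_simp
      ring
    calc _ = (ε ^ (1 - q) * d ^ ((γ + N / q) * q)) * (K * (d ^ N * V)) := by ring
      _ = _ := by rw [this]; ring
  rw [h5] at h4
  have h6 : d ^ N * d ^ N ≤ 64 ^ N * (a ^ N * b ^ N) := by
    have h7 : d ^ N ≤ 8 ^ N * a ^ N := by
      rw [← mul_pow]; gcongr; linarith
    have h8 : d ^ N ≤ 8 ^ N * b ^ N := by
      rw [← mul_pow]; gcongr; linarith
    calc d ^ N * d ^ N ≤ (8 ^ N * a ^ N) * (8 ^ N * b ^ N) := by gcongr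
      _ = (8 * 8) ^ N * (a ^ N * b ^ N) := by rw [mul_pow]; ring
      _ = _ := by norm_num
  have h9 : 0 < a ^ N * b ^ N * V * V := by positivity
  refine le_of_mul_le_mul_left ?_ h9
  calc a ^ N * b ^ N * V * V * |M - m| = b ^ N * V * (a ^ N * V * |M - m|) := by ring
    _ ≤ _ := h4
    _ ≤ ε * (b ^ N * V) * (a ^ N * V) + ε * (K * (64 ^ N * (a ^ N * b ^ N) * V)) := by gcongr
    _ = _ := by field_simp

lemma ball_subset_ball_of_add_le {x z : E N} {r t ρ : ℝ} (hx : x ∈ ball z r) (h : r + t ≤ ρ) :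
    ball x t ⊆ ball z ρ :=
  ball_subset_ball' (by have := mem_ball.1 hx; linarith)

/-- Averages over consecutive dyadic balls differ by a multiple of (2·2^{-k})^γ, a geometric
sequence. This gives convergence at every point of the smaller ball, not only almost everywhere, and
the rate is the sum of the series. -/
lemma tendsto_dyadic_average {q γ K r ρ : ℝ} {z x : E N}
    (hNik : Nik u (ball z ρ) (γ + N / q) q K) (hu : Measurable u)
    (hu1 : ∀ w ∈ ball z ρ, |u w| ≤ 1) (hρ : ρ ≤ 1) (hK : 0 ≤ K) (hq : 1 ≤ q) (hγ : 0 < γ)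
    (hx : x ∈ ball z r) {n : ℕ} (hn : r + (1 / 2) ^ n ≤ ρ) :
    Tendsto (fun n : ℕ => ⨍ y in ball x ((1 / 2) ^ n), u y) atTop (𝓝 (preciseRep u x)) ∧
    |(⨍ y in ball x ((1 / 2) ^ n), u y) - preciseRep u x| ≤
      (1 + K * 64 ^ N / (volume (ball (0 : E N) 1)).toReal) * (2 ^ γ / (1 - (1 / 2) ^ γ)) *
        ((1 / 2) ^ n) ^ γ := by
  set A := 1 + K * 64 ^ N / (volume (ball (0 : E N) 1)).toReal with hA
  set a : ℕ → ℝ := fun n => ⨍ y in ball x ((1 / 2) ^ n), u y with ha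
  have hlt1 : ((1 : ℝ) / 2) ^ γ < 1 := Real.rpow_lt_one (by norm_num) (by norm_num) hγ
  have hstep : ∀ k : ℕ, dist (a (k + n)) (a (k + 1 + n)) ≤
      (A * 2 ^ γ * ((1 / 2) ^ n) ^ γ) * ((1 / 2) ^ γ) ^ k := by
    intro k
    have hk : ((1 : ℝ) / 2) ^ (k + n) ≤ (1 / 2) ^ n :=
      pow_le_pow_of_le_one (by norm_num) (by norm_num) (by omega)
    have hk' : ((1 : ℝ) / 2) ^ (k + 1 + n) ≤ (1 / 2) ^ n :=
      pow_le_pow_of_le_one (by norm_num) (by norm_num) (by omega)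
    have hhalf : ((1 : ℝ) / 2) ^ (k + 1 + n) = (1 / 2) ^ (k + n) / 2 := by ring
    have hpos : (0 : ℝ) < (1 / 2) ^ (k + n) := by positivity
    have := abs_average_sub_le hNik hu hu1 hρ hK hq hγ.le (d := 2 * (1 / 2) ^ (k + n))
      (a := (1 / 2) ^ (k + n)) (b := (1 / 2) ^ (k + 1 + n)) (x := x) (y := x) (by positivity)
      (by linarith) (by linarith) (ball_subset_ball_of_add_le hx (by linarith))
      (ball_subset_ball_of_add_le hx (by linarith)) (by
        intro v hv w hw
        have h1 : dist v x < (1 / 2) ^ (k + n) := hv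
        have h2 : dist w x < (1 / 2) ^ (k + 1 + n) := hw
        have h3 := dist_triangle_right v w x
        rw [dist_eq_norm v w] at h3
        linarith)
    rw [Real.dist_eq]
    refine this.trans (le_of_eq ?_)
    rw [Real.mul_rpow (by norm_num) (by positivity), pow_add, Real.mul_rpow (by positivity)
      (by positivity), ← Real.rpow_natCast (((1 : ℝ) / 2) ^ γ), ← Real.rpow_natCast ((1 : ℝ) / 2) k,
      ← Real.rpow_mul (by norm_num), ← Real.rpow_mul (by norm_num), mul_comm γ (k : ℝ)]
    ring
  have hstep' : ∀ k : ℕ, dist ((fun k => a (k + n)) k) ((fun k => a (k + n)) (k + 1)) ≤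
      (A * 2 ^ γ * ((1 / 2) ^ n) ^ γ) * ((1 / 2) ^ γ) ^ k := hstep
  obtain ⟨L, hL⟩ := cauchySeq_tendsto_of_complete (cauchySeq_of_le_geometric _ _ hlt1 hstep')
  have hL' : Tendsto a atTop (𝓝 L) := (tendsto_add_atTop_iff_nat n).1 hL
  have hLv : preciseRep u x = L := hL'.limUnder_eq
  rw [hLv]
  refine ⟨hL', ?_⟩
  have := dist_le_of_le_geometric_of_tendsto₀ _ _ hlt1 hstep' hL
  simp only [zero_add, Real.dist_eq] at this
  refine this.trans (le_of_eq ?_)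
  ring

lemma abs_le_one_of_tendsto_average {r : ℝ} {z x : E N} {L : ℝ} (hu : Measurable u)
    (hu1 : ∀ w ∈ ball z r, |u w| ≤ 1) (hx : x ∈ ball z r)
    (hL : Tendsto (fun n : ℕ => ⨍ y in ball x ((1 / 2) ^ n), u y) atTop (𝓝 L)) : |L| ≤ 1 := by
  obtain ⟨ε, hε, hball⟩ := isOpen_iff.1 isOpen_ball x hx
  have h0 : Tendsto (fun n : ℕ => ((1 : ℝ) / 2) ^ n) atTop (𝓝 0) :=
    tendsto_pow_atTop_nhds_zero_of_lt_one (by norm_num) (by norm_num)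
  refine le_of_tendsto hL.abs ?_
  filter_upwards [h0.eventually_lt_const hε] with n hn
  have hsub : ball x ((1 / 2) ^ n) ⊆ ball z r := (ball_subset_ball hn.le).trans hball
  have hpos : (0 : ℝ) < (1 / 2) ^ n := by positivity
  have hv0 := (measure_ball_pos volume x hpos).ne'
  have hvt : volume (ball x ((1 / 2) ^ n)) ≠ ∞ := measure_ball_lt_top.ne
  have hint : IntegrableOn u (ball x ((1 / 2) ^ n)) := by
    refine Measure.integrableOn_of_bounded (M := 1) hvt hu.aestronglyMeasurable ?_
    filter_upwards [ae_restrict_mem measurableSet_ball] with w hw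
    exact hu1 w (hsub hw)
  have h1 := volume_mul_abs_sub_average_le hv0 hvt hint 0
  have h2 : ∫⁻ y in ball x ((1 / 2) ^ n), ENNReal.ofReal |0 - u y| ≤
      volume (ball x ((1 / 2) ^ n)) * 1 := by
    rw [mul_comm, ← setLIntegral_const]
    refine setLIntegral_mono' measurableSet_ball fun y hy => ?_
    rw [zero_sub, abs_neg]
    exact ENNReal.ofReal_le_one.2 (hu1 y (hsub hy))
  have h3 := (ENNReal.mul_le_mul_iff_right hv0 hvt).1 (h1.trans h2)
  rw [zero_sub, abs_neg] at h3
  exact ENNReal.ofReal_le_one.1 h3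

lemma exists_holder_bound_of_le (hN : 1 ≤ N) (hp : p ∈ Ioo (1 : ℝ) 2) (hs : s ∈ Ioo (0 : ℝ) 1)
    (hsp : p - 1 < s * p) (hs₁ : s₁ ∈ Ioo (0 : ℝ) 1) {γ : ℝ} (hsγ : s ≤ γ) (hγ1 : γ < 1) :
    ∃ C κ : ℝ, 0 ≤ C ∧ 0 ≤ κ ∧ ∀ (l : ℝ) (x₀ : E N) (R : ℝ) (u : E N → ℝ) (Z : E N × E N → ℝ),
      NormSol s₁ s p l x₀ R u Z → R ≤ 1 → ∀ r : ℝ, 0 < r → r < R →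
      (∀ x ∈ ball x₀ r, Tendsto (fun n : ℕ => ⨍ y in ball x ((1 / 2) ^ n), u y) atTop
        (𝓝 (preciseRep u x))) ∧
      ∀ x ∈ ball x₀ r, ∀ y ∈ ball x₀ r,
        |preciseRep u x - preciseRep u y| ≤ C * (R - r) ^ (-κ) * ‖x - y‖ ^ γ := by
  have hγ : 0 < γ := hs.1.trans_le hsγ
  have hγ' : 0 < 1 - γ := by linarith
  -- Chosen so that N/q < 1 - γ; the order γ + N/q required by the Morrey argument is then below 1.
  set q : ℝ := p + N / (1 - γ) with hq
  have hN0 : (0 : ℝ) ≤ N / (1 - γ) := by positivity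
  have hp1 := hp.1
  have hq0 : 0 < q := by linarith
  have hθ : γ + N / q < 1 := by
    have : N / q < 1 - γ := by
      rw [div_lt_iff₀ hq0, hq, mul_add, mul_div_cancel₀ _ hγ'.ne']
      have : 0 < (1 - γ) * p := by positivity
      linarith
    linarith
  obtain ⟨C, κ, hC, hκ, hb⟩ := nikBound_all hN hp hs hsp hs₁ (q := q) (θ := γ + N / q)
    (by linarith) (by have : 0 ≤ (N : ℝ) / q := by positivity
                      linarith) hθ
  set V := (volume (ball (0 : E N) 1)).toReal with hV
  have hV0 : 0 < V := ENNReal.toReal_pos (measure_ball_pos _ _ one_pos).ne' measure_ball_lt_top.ne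
  have hlt1 : ((1 : ℝ) / 2) ^ γ < 1 := Real.rpow_lt_one (by norm_num) (by norm_num) hγ
  set c := 2 ^ γ / (1 - (1 / 2 : ℝ) ^ γ) with hc
  have hc0 : 0 ≤ c := div_nonneg (by positivity) (by linarith)
  refine ⟨(1 + C * 2 ^ κ * 64 ^ N / V) * (2 * c + 4 ^ γ) + 4, κ + 1, by positivity, by positivity,
    ?_⟩
  intro l x₀ R u Z H hR r hr hrR
  have hu := H.measurable_u
  have hD : 0 < R - r := by linarith
  have hD1 : R - r ≤ 1 := by linarith
  set ρ := (R + r) / 2 with hρ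
  set K := C * (R - ρ) ^ (-κ) with hK
  have hRρ : R - ρ = (R - r) / 2 := by rw [hρ]; ring
  have hK0 : 0 ≤ K := mul_nonneg hC (Real.rpow_nonneg (by linarith) _)
  have hNik : Nik u (ball x₀ ρ) (γ + N / q) q K :=
    hb l x₀ R u Z H hR ρ (by linarith) (by linarith)
  have hu1 : ∀ w ∈ ball x₀ ρ, |u w| ≤ 1 := fun w hw =>
    H.abs_le_one w (ball_subset_ball (by linarith) hw)
  have hlim : ∀ x ∈ ball x₀ r, ∀ n : ℕ, ((1 : ℝ) / 2) ^ n ≤ (R - r) / 2 → _ := fun x hx n hn =>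
    tendsto_dyadic_average hNik hu hu1 (by linarith) hK0 (by linarith) hγ hx (n := n)
      (by linarith)
  have htend : ∀ x ∈ ball x₀ r, Tendsto (fun n : ℕ => ⨍ y in ball x ((1 / 2) ^ n), u y) atTop
        (𝓝 (preciseRep u x)) := by
    intro x hx
    obtain ⟨n, hn⟩ := exists_pow_lt_of_lt_one (show 0 < (R - r) / 2 by linarith)
      (show (1 : ℝ) / 2 < 1 by norm_num)
    exact (hlim x hx n hn.le).1
  refine ⟨htend, ?_⟩
  intro x hx y hy
  have hDκ : (R - r) ^ (-κ) ≤ (R - r) ^ (-(κ + 1)) :=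
    Real.rpow_le_rpow_of_exponent_ge hD hD1 (by linarith)
  have hDκ1 : 1 ≤ (R - r) ^ (-(κ + 1)) :=
    Real.one_le_rpow_of_pos_of_le_one_of_nonpos hD hD1 (by linarith)
  have hDγ : (R - r) ^ (-γ) ≤ (R - r) ^ (-(κ + 1)) :=
    Real.rpow_le_rpow_of_exponent_ge hD hD1 (by linarith)
  have hA : 1 + K * 64 ^ N / V ≤ (1 + C * 2 ^ κ * 64 ^ N / V) * (R - r) ^ (-(κ + 1)) := by
    have : K = C * 2 ^ κ * (R - r) ^ (-κ) := by
      rw [hK, hRρ, Real.div_rpow hD.le (by norm_num), Real.rpow_neg (by norm_num : (0 : ℝ) ≤ 2)]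
      field_simp
    rw [this, add_mul, one_mul]
    gcongr
    calc C * 2 ^ κ * (R - r) ^ (-κ) * 64 ^ N / V = C * 2 ^ κ * 64 ^ N / V * (R - r) ^ (-κ) := by ring
      _ ≤ _ := by gcongr
  rcases eq_or_ne x y with rfl | hxy
  · simp only [sub_self, abs_zero]; positivity
  have ht : 0 < ‖x - y‖ := norm_pos_iff.2 (sub_ne_zero.2 hxy)
  rcases lt_or_ge ‖x - y‖ ((R - r) / 2) with hlt | hge
  -- For close points the dyadic radius δ satisfies δ < |x-y| ≤ 2δ, so points of the two balls of
  -- radius δ lie within 4δ of each other. The difference passes through the two averages.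
  · obtain ⟨n, hn1, hn2⟩ := exists_nat_pow_near_of_lt_one ht (by linarith)
      (show (0 : ℝ) < 1 / 2 by norm_num) (by norm_num)
    have hhalf : ((1 : ℝ) / 2) ^ n = 2 * (1 / 2) ^ (n + 1) := by ring
    set δ : ℝ := (1 / 2) ^ (n + 1) with hδ
    have hδ0 : 0 < δ := by positivity
    have h1 := (hlim x hx (n + 1) (by linarith)).2
    have h2 := (hlim y hy (n + 1) (by linarith)).2
    have h3 := abs_average_sub_le hNik hu hu1 (by linarith) hK0 (by linarith) hγ.le (d := 4 * δ)
      (a := δ) (b := δ) (x := x) (y := y) (by positivity) (by linarith) (by linarith)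
      (ball_subset_ball_of_add_le hx (by linarith)) (ball_subset_ball_of_add_le hy (by linarith)) (by
        intro v hv w hw
        rw [mem_ball, dist_eq_norm] at hv hw
        calc ‖v - w‖ = ‖(v - x) + (x - y) - (w - y)‖ := by congr 1; abel
          _ ≤ ‖v - x‖ + ‖x - y‖ + ‖w - y‖ := (norm_sub_le _ _).trans (by
              gcongr; exact norm_add_le _ _)
          _ < 4 * δ := by linarith)
    rw [Real.mul_rpow (by norm_num) hδ0.le] at h3
    have h4 : |preciseRep u x - preciseRep u y| ≤
        (1 + K * 64 ^ N / V) * (2 * c + 4 ^ γ) * δ ^ γ := by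
      rw [abs_le] at *
      constructor <;> linarith
    refine h4.trans ?_
    have h5 : δ ^ γ ≤ ‖x - y‖ ^ γ := by gcongr
    calc _ ≤ (1 + C * 2 ^ κ * 64 ^ N / V) * (R - r) ^ (-(κ + 1)) * (2 * c + 4 ^ γ) *
          ‖x - y‖ ^ γ := by gcongr
      _ ≤ _ := by
        rw [mul_right_comm (1 + C * 2 ^ κ * 64 ^ N / V)]
        gcongr
        linarith
  -- For points at distance at least (R-r)/2 the bound |u| ≤ 1 suffices, at the cost of a power of
  -- 1/(R-r).
  · have h1 := abs_le_one_of_tendsto_average hu H.abs_le_one (ball_subset_ball hrR.le hx)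
      (htend x hx)
    have h2 := abs_le_one_of_tendsto_average hu H.abs_le_one (ball_subset_ball hrR.le hy)
      (htend y hy)
    have h3 : 1 ≤ 2 * ((R - r) ^ (-(κ + 1)) * ‖x - y‖ ^ γ) := by
      have h4 : (1 : ℝ) ≤ (2 * (‖x - y‖ / (R - r))) ^ γ := by
        refine Real.one_le_rpow ?_ hγ.le
        rw [← mul_div_assoc, le_div_iff₀ hD]
        linarith
      have h5 : (2 : ℝ) ^ γ ≤ 2 := by
        simpa using Real.rpow_le_rpow_of_exponent_le (by norm_num : (1 : ℝ) ≤ 2) hγ1.le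
      calc (1 : ℝ) ≤ _ := h4
        _ = 2 ^ γ * ((R - r) ^ (-γ) * ‖x - y‖ ^ γ) := by
          rw [Real.mul_rpow (by norm_num) (by positivity), Real.div_rpow ht.le hD.le,
            Real.rpow_neg hD.le]
          ring
        _ ≤ _ := by gcongr
    calc |preciseRep u x - preciseRep u y| ≤ 1 + 1 := (abs_sub _ _).trans (add_le_add h1 h2)
      _ ≤ 4 * (R - r) ^ (-(κ + 1)) * ‖x - y‖ ^ γ := by linarith
      _ ≤ _ := by
        gcongr
        have : 0 ≤ (1 + C * 2 ^ κ * 64 ^ N / V) * (2 * c + 4 ^ γ) := by positivity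
        linarith

/-- The Hölder estimate for normalised solutions. -/
lemma exists_holder_bound (hN : 1 ≤ N) (hp : p ∈ Ioo (1 : ℝ) 2) (hs : s ∈ Ioo (0 : ℝ) 1)
    (hsp : p - 1 < s * p) (hs₁ : s₁ ∈ Ioo (0 : ℝ) 1) {γ : ℝ} (hγ : γ ∈ Ioo (0 : ℝ) 1) :
    ∃ C κ : ℝ, 0 ≤ C ∧ 0 ≤ κ ∧ ∀ (l : ℝ) (x₀ : E N) (R : ℝ) (u : E N → ℝ) (Z : E N × E N → ℝ),
      NormSol s₁ s p l x₀ R u Z → R ≤ 1 → ∀ r : ℝ, 0 < r → r < R →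
      (∀ x ∈ ball x₀ r, Tendsto (fun n : ℕ => ⨍ y in ball x ((1 / 2) ^ n), u y) atTop
        (𝓝 (preciseRep u x))) ∧
      ∀ x ∈ ball x₀ r, ∀ y ∈ ball x₀ r,
        |preciseRep u x - preciseRep u y| ≤ C * (R - r) ^ (-κ) * ‖x - y‖ ^ γ := by
  -- For γ < s the estimate of order s is the stronger one, because distances inside the ball are at
  -- most 2.
  obtain ⟨C, κ, hC, hκ, hb⟩ := exists_holder_bound_of_le hN hp hs hsp hs₁ (γ := max s γ)
    (le_max_left _ _) (max_lt hs.2 hγ.2)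
  refine ⟨C * 2 ^ (max s γ - γ), κ, by positivity, hκ, ?_⟩
  intro l x₀ R u Z H hR r hr hrR
  obtain ⟨h1, h2⟩ := hb l x₀ R u Z H hR r hr hrR
  refine ⟨h1, fun x hx y hy => (h2 x hx y hy).trans ?_⟩
  have hD : 0 < R - r := by linarith
  have hmax : 0 ≤ max s γ - γ := by linarith [le_max_right s γ]
  rcases (norm_nonneg (x - y)).eq_or_lt with ht | ht
  · rw [← ht, Real.zero_rpow (lt_max_of_lt_left hs.1).ne', mul_zero]
    positivity
  have h3 : ‖x - y‖ ≤ 2 := by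
    have := dist_triangle_right x y x₀
    rw [mem_ball] at hx hy
    rw [dist_eq_norm x y] at this
    linarith
  calc C * (R - r) ^ (-κ) * ‖x - y‖ ^ max s γ =
        C * (R - r) ^ (-κ) * (‖x - y‖ ^ (max s γ - γ) * ‖x - y‖ ^ γ) := by
        rw [← Real.rpow_add ht]; ring_nf
    _ ≤ C * (R - r) ^ (-κ) * (2 ^ (max s γ - γ) * ‖x - y‖ ^ γ) := by gcongr
    _ = _ := by ring

/-! ### Reduction to normalised solutions -/

lemma MemLpLoc.locallyIntegrable {q : ℝ≥0∞} (hq : 1 ≤ q) (hu : MemLpLoc q u univ) :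
    LocallyIntegrable u := by
  intro x
  refine ⟨closedBall x 1, closedBall_mem_nhds x one_pos, ?_⟩
  have : IsFiniteMeasure ((volume : Measure (E N)).restrict (closedBall x 1)) :=
    isFiniteMeasure_restrict.2 measure_closedBall_lt_top.ne
  exact (hu _ (isCompact_closedBall x 1) (subset_univ _)).integrable hq

/-- Lebesgue differentiation along closed balls; spheres are null, so open balls have the same
averages. -/
lemma preciseRep_ae_eq (hu : LocallyIntegrable u) : preciseRep u =ᵐ[volume] u := by
  filter_upwards [(Besicovitch.vitaliFamily (volume : Measure (E N))).ae_tendsto_average hu]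
    with x hx
  have h0 : Tendsto (fun n : ℕ => ((1 : ℝ) / 2) ^ n) atTop (𝓝[>] 0) :=
    tendsto_nhdsWithin_iff.2 ⟨tendsto_pow_atTop_nhds_zero_of_lt_one (by norm_num) (by norm_num),
      Eventually.of_forall fun n => by simp⟩
  have h1 := hx.comp ((Besicovitch.tendsto_filterAt volume x).comp h0)
  refine Tendsto.limUnder_eq (h1.congr fun n => ?_)
  have hpos : (0 : ℝ) < (1 / 2) ^ n := by positivity
  refine (setAverage_congr (ae_eq_of_subset_of_measure_ge ball_subset_closedBall ?_
    measurableSet_ball.nullMeasurableSet measure_closedBall_lt_top.ne)).symm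
  rw [Measure.addHaar_closedBall _ _ hpos.le, Measure.addHaar_ball_of_pos _ _ hpos]

lemma ae_pair_of_ae {P : E N → Prop} (h : ∀ᵐ x, P x) : ∀ᵐ z : E N × E N, P z.1 ∧ P z.2 := by
  rw [Measure.volume_eq_prod]
  exact (Measure.quasiMeasurePreserving_fst.ae h).and (Measure.quasiMeasurePreserving_snd.ae h)

lemma le_rpow_of_rpow_one_div_le {a b : ℝ≥0∞} {q : ℝ} (hq : 0 < q) (h : a ^ (1 / q) ≤ b) :
    a ≤ b ^ q := by
  rw [one_div] at h
  calc a = (a ^ q⁻¹) ^ q := (ENNReal.rpow_inv_rpow hq.ne' a).symm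
    _ ≤ b ^ q := by gcongr

lemma pairEnergy_eq_of_ae_eq_const_mul {σ q c : ℝ} {w : E N → ℝ} (hw : Measurable w)
    (hc : 0 ≤ c) (hq : 0 < q) (hwu : ∀ᵐ x, w x = c * u x) (S : Set (E N)) :
    pairEnergy (N + σ * q) q w S = ENNReal.ofReal (c ^ q) * gagliardo σ q u S ^ q := by
  unfold gagliardo
  rw [← setLIntegral_gagliardo_eq hw, one_div, ENNReal.rpow_inv_rpow hq.ne',
    ← lintegral_const_mul' _ _ ENNReal.ofReal_ne_top]
  refine lintegral_congr_ae (ae_restrict_of_ae ?_)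
  filter_upwards [ae_pair_of_ae hwu] with z hz
  rw [hz.1, hz.2, ← mul_sub, abs_mul, abs_of_nonneg hc, Real.mul_rpow hc (abs_nonneg _),
    ← ENNReal.ofReal_mul (by positivity), mul_div_assoc]

lemma average_eq_of_ae_eq_const_mul {c : ℝ} {w : E N → ℝ} (hwu : ∀ᵐ x, w x = c * u x)
    (S : Set (E N)) : ⨍ y in S, w y = c * ⨍ y in S, u y := by
  rw [setAverage_eq, setAverage_eq, integral_congr_ae (ae_restrict_of_ae hwu),
    integral_const_mul, smul_eq_mul, smul_eq_mul]
  ring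

/-- Averages ignore null sets and scale linearly, so the relation, assumed only almost everywhere,
holds at each point where the averages converge. -/
lemma preciseRep_eq_of_tendsto {c : ℝ} (hc : c ≠ 0) {w : E N → ℝ} {x : E N}
    (hwu : ∀ᵐ x, w x = c * u x)
    (hw : Tendsto (fun n : ℕ => ⨍ y in ball x ((1 / 2) ^ n), w y) atTop (𝓝 (preciseRep w x))) :
    preciseRep u x = c⁻¹ * preciseRep w x := by
  refine Tendsto.limUnder_eq ((hw.const_mul c⁻¹).congr fun n => ?_)
  rw [average_eq_of_ae_eq_const_mul hwu, inv_mul_cancel_left₀ hc]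

lemma abs_max_min_le_one (t : ℝ) : |max (-1) (min 1 t)| ≤ 1 :=
  abs_le.2 ⟨le_max_left _ _, max_le (by norm_num) (min_le_left _ _)⟩

lemma max_min_eq_self {t : ℝ} (ht : |t| ≤ 1) : max (-1) (min 1 t) = t := by
  rw [min_eq_right (abs_le.1 ht).2, max_eq_right (abs_le.1 ht).1]

lemma IsTest.mono {Ω Ω' : Set (E N)} {φ : E N → ℝ} (h : IsTest s₁ s p Ω φ) (hΩ : Ω ⊆ Ω') :
    IsTest s₁ s p Ω' φ :=
  ⟨h.memW_one, h.memW, h.hasCompactSupport, h.tsupport_subset.trans hΩ⟩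

lemma isCompact_closure_ball (x₀ : E N) (R : ℝ) : IsCompact (closure (ball x₀ R)) :=
  (isCompact_closedBall x₀ R).of_isClosed_subset isClosed_closure closure_ball_subset_closedBall

/-- The sign is invariant under division by M while the p-part scales by M^{1-p}, so multiplying the
equation by this factor leaves it as the coefficient l ≤ 1 of the 1-Laplacian. The rest replaces
almost-everywhere data by Borel functions that satisfy the bounds everywhere. -/
lemma IsWeakSolution.exists_normSol (hp : p ∈ Ioo (1 : ℝ) 2) {Ω : Set (E N)}
    (H : IsWeakSolution s₁ s p Ω u) (hR : 0 < R) (hball : closedBall x₀ R ⊆ Ω) {M : ℝ}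
    (hM : 1 ≤ M) (hMu : eLpNorm u ∞ (volume.restrict (ball x₀ R)) ≤ ENNReal.ofReal M)
    (hMt : tail s p u x₀ R ≤ ENNReal.ofReal M)
    (hMg : gagliardo s p u (ball x₀ R) ≤ ENNReal.ofReal M) :
    ∃ (l : ℝ) (w : E N → ℝ) (Z : E N × E N → ℝ), NormSol s₁ s p l x₀ R w Z ∧
      ∀ᵐ x, w x = M⁻¹ * u x := by
  obtain ⟨hp1, hp2⟩ := id hp
  have hp0 : 0 < p := by linarith
  have hM0 : 0 < M := by linarith
  have hMinv : 0 < M⁻¹ := inv_pos.2 hM0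
  have hloc : LocallyIntegrable u :=
    H.memTailSpace.1.locallyIntegrable (ENNReal.one_le_ofReal.2 hp1.le)
  obtain ⟨ũ, hum, hu⟩ := hloc.aestronglyMeasurable
  obtain ⟨Z₀, hZ₀, hsgn, hweak⟩ := H.weak
  obtain ⟨Z₁, hZ₁m, hZ₁⟩ := hZ₀.1
  have hsubΩ : ball x₀ R ⊆ Ω := ball_subset_closedBall.trans hball
  classical
  -- Truncation in the ball alters w only on a null set and makes the bound by 1 hold at every
  -- point.
  set w : E N → ℝ := fun x =>
    if x ∈ ball x₀ R then max (-1) (min 1 (M⁻¹ * ũ x)) else M⁻¹ * ũ x with hw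
  have hũ : Measurable ũ := hum.measurable
  have hwm : Measurable w :=
    Measurable.ite measurableSet_ball (by fun_prop) (by fun_prop)
  have hub : ∀ᵐ x, x ∈ ball x₀ R → |u x| ≤ M := by
    rw [← ae_restrict_iff' measurableSet_ball]
    rw [eLpNorm_exponent_top] at hMu
    filter_upwards [ae_le_eLpNormEssSup (f := u) (μ := volume.restrict (ball x₀ R))] with x hx
    have := hx.trans hMu
    rw [← ofReal_norm, Real.norm_eq_abs] at this
    exact (ENNReal.ofReal_le_ofReal_iff hM0.le).1 this
  have hwu : ∀ᵐ x, w x = M⁻¹ * u x := by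
    filter_upwards [hu, hub] with x hx hxM
    simp only [hw]
    rw [← hx]
    split_ifs with h
    · refine max_min_eq_self ?_
      rw [abs_mul, abs_of_pos hMinv, inv_mul_le_iff₀ hM0, mul_one]
      exact hxM h
    · rfl
  have hdm : Measurable fun z : E N × E N => w z.1 - w z.2 := by fun_prop
  -- The sign is recomputed from w, and the given Z enters only where the difference vanishes, so
  -- that Z lies in the graph everywhere.
  set Z : E N × E N → ℝ := fun z => if 0 < w z.1 - w z.2 then 1 else
    if w z.1 - w z.2 < 0 then -1 else max (-1) (min 1 (Z₁ z)) with hZ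
  have hZm : Measurable Z :=
    Measurable.ite (measurableSet_lt measurable_const hdm) measurable_const
      (Measurable.ite (measurableSet_lt hdm measurable_const) measurable_const
        (measurable_const.max (measurable_const.min hZ₁m.measurable)))
  have hdiff : ∀ᵐ z : E N × E N, w z.1 - w z.2 = M⁻¹ * (u z.1 - u z.2) := by
    filter_upwards [ae_pair_of_ae hwu] with z hz
    rw [hz.1, hz.2, mul_sub]
  have hZZ : ∀ᵐ z : E N × E N, Z z = Z₀ z := by
    filter_upwards [hdiff, hsgn, hZ₁] with z hz hs hz₁
    simp only [hZ]
    rw [hz, ← hz₁]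
    split_ifs with h1 h2
    · exact (hs.1 (pos_of_mul_pos_right h1 hMinv.le)).symm
    · exact (hs.2.1 (by
        by_contra h3
        exact absurd h2 (not_lt.2 (mul_nonneg hMinv.le (not_lt.1 h3))))).symm
    · exact max_min_eq_self (abs_le.2 hs.2.2)
  refine ⟨M ^ (1 - p), w, Z, ?_, hwu⟩
  constructor
  · exact ⟨by positivity, Real.rpow_le_one_of_one_le_of_nonpos hM (by linarith)⟩
  · exact hwm
  · exact hZm
  · intro z
    simp only [hZ]
    refine ⟨fun h => if_pos h, fun h => ?_, ?_⟩
    · rw [if_neg (not_lt.2 h.le), if_pos h]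
    · split_ifs
      · norm_num
      · norm_num
      · exact abs_le.1 (abs_max_min_le_one _)
  · intro x hx
    simp only [hw]
    rw [if_pos hx]
    exact abs_max_min_le_one _
  · rw [pairEnergy_eq_of_ae_eq_const_mul hwm hMinv.le one_pos hwu, ENNReal.rpow_one]
    exact ENNReal.mul_lt_top ENNReal.ofReal_lt_top (H.memWLoc_one _ isOpen_ball
      (isCompact_closure_ball x₀ R) (closure_ball_subset_closedBall.trans hball)).2
  · rw [pairEnergy_eq_of_ae_eq_const_mul hwm hMinv.le hp0 hwu]
    calc _ ≤ ENNReal.ofReal (M⁻¹ ^ p) * ENNReal.ofReal M ^ p := by gcongr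
      _ = 1 := by
        rw [ENNReal.ofReal_rpow_of_nonneg hM0.le hp0.le, ← ENNReal.ofReal_mul (by positivity),
          ← Real.mul_rpow hMinv.le hM0.le, inv_mul_cancel₀ hM0.ne', Real.one_rpow,
          ENNReal.ofReal_one]
  · have h1 : ∫⁻ x in (ball x₀ R)ᶜ,
        ENNReal.ofReal (|w x| ^ (p - 1) / ‖x - x₀‖ ^ ((N : ℝ) + s * p)) =
        ENNReal.ofReal (M⁻¹ ^ (p - 1)) * ∫⁻ x in (ball x₀ R)ᶜ,
          ENNReal.ofReal (|u x| ^ (p - 1) / ‖x - x₀‖ ^ ((N : ℝ) + s * p)) := by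
      rw [← lintegral_const_mul' _ _ ENNReal.ofReal_ne_top]
      refine lintegral_congr_ae (ae_restrict_of_ae ?_)
      filter_upwards [hwu] with x hx
      rw [hx, abs_mul, abs_of_pos hMinv, Real.mul_rpow hMinv.le (abs_nonneg _),
        ← ENNReal.ofReal_mul (by positivity), mul_div_assoc]
    have h2 := le_rpow_of_rpow_one_div_le (by linarith) hMt
    rw [h1]
    set J := ∫⁻ x in (ball x₀ R)ᶜ,
          ENNReal.ofReal (|u x| ^ (p - 1) / ‖x - x₀‖ ^ ((N : ℝ) + s * p))
    -- The tail carries the factor R^{sp}; inserting R^{-sp} R^{sp} = 1 lets the tail bound be used,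
    -- and M^{p-1} cancels.
    calc _ = ENNReal.ofReal (R ^ (-(s * p))) * (ENNReal.ofReal (M⁻¹ ^ (p - 1)) *
          (ENNReal.ofReal (R ^ (s * p)) * J)) := by
          have : ENNReal.ofReal (R ^ (-(s * p))) * ENNReal.ofReal (R ^ (s * p)) = 1 := by
            rw [← ENNReal.ofReal_mul (by positivity), ← Real.rpow_add hR, neg_add_cancel,
              Real.rpow_zero, ENNReal.ofReal_one]
          rw [mul_left_comm (ENNReal.ofReal (M⁻¹ ^ (p - 1))), ← mul_assoc, this, one_mul]
      _ ≤ ENNReal.ofReal (R ^ (-(s * p))) * (ENNReal.ofReal (M⁻¹ ^ (p - 1)) *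
          ENNReal.ofReal M ^ (p - 1)) := by gcongr
      _ = _ := by
        rw [ENNReal.ofReal_rpow_of_nonneg hM0.le (by linarith),
          ← ENNReal.ofReal_mul (p := M⁻¹ ^ (p - 1)) (by positivity),
          ← Real.mul_rpow hMinv.le hM0.le, inv_mul_cancel₀ hM0.ne', Real.one_rpow,
          ENNReal.ofReal_one, mul_one]
  · intro φ hφ
    have h1 := hweak φ (hφ.mono hsubΩ)
    have h2 : ∫ z : E N × E N, Z z * ((φ z.1 - φ z.2) / ‖z.1 - z.2‖ ^ ((N : ℝ) + s₁)) =
        ∫ z : E N × E N, Z₀ z * ((φ z.1 - φ z.2) / ‖z.1 - z.2‖ ^ ((N : ℝ) + s₁)) := by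
      refine integral_congr_ae ?_
      filter_upwards [hZZ] with z hz
      rw [hz]
    have h3 : ∫ z : E N × E N, spow (p - 2) (w z.1 - w z.2) * (φ z.1 - φ z.2) /
          ‖z.1 - z.2‖ ^ ((N : ℝ) + s * p) = M ^ (1 - p) * ∫ z : E N × E N,
          |u z.1 - u z.2| ^ (p - 2) * (u z.1 - u z.2) * (φ z.1 - φ z.2) /
          ‖z.1 - z.2‖ ^ ((N : ℝ) + s * p) := by
      rw [← integral_const_mul]
      refine integral_congr_ae ?_
      filter_upwards [hdiff] with z hz
      have h4 : M⁻¹ ^ (p - 2) * M⁻¹ = M ^ (1 - p) := by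
        rw [Real.inv_rpow hM0.le, ← Real.rpow_neg hM0.le, ← Real.rpow_neg_one,
          ← Real.rpow_add hM0]
        ring_nf
      rw [hz, spow, abs_mul, abs_of_pos hMinv, Real.mul_rpow hMinv.le (abs_nonneg _), ← h4]
      ring
    rw [h2, h3, ← mul_add, ← h1, mul_zero]

/-- The Hölder estimate for weak solutions. -/
lemma exists_holder_bound_weakSolution (hN : 1 ≤ N) (hp : p ∈ Ioo (1 : ℝ) 2)
    (hs : s ∈ Ioo (0 : ℝ) 1) (hsp : p - 1 < s * p) (hs₁ : s₁ ∈ Ioo (0 : ℝ) 1) {γ : ℝ}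
    (hγ : γ ∈ Ioo (0 : ℝ) 1) :
    ∃ C κ : ℝ, 0 < C ∧ 0 < κ ∧ ∀ (Ω : Set (E N)) (u : E N → ℝ), IsWeakSolution s₁ s p Ω u →
      ∀ (x₀ : E N) (R r M : ℝ), R < 1 → closedBall x₀ R ⊆ Ω → 0 < r → r < R → 1 ≤ M →
      eLpNorm u ∞ (volume.restrict (ball x₀ R)) ≤ ENNReal.ofReal M →
      tail s p u x₀ R ≤ ENNReal.ofReal M → gagliardo s p u (ball x₀ R) ≤ ENNReal.ofReal M →
      ∀ x ∈ ball x₀ r, ∀ y ∈ ball x₀ r,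
        |preciseRep u x - preciseRep u y| ≤ C * M / (R - r) ^ κ * ‖x - y‖ ^ γ := by
  obtain ⟨C, κ, hC, hκ, hb⟩ := exists_holder_bound hN hp hs hsp hs₁ hγ
  -- The increments by 1 only make both constants strictly positive.
  refine ⟨C + 1, κ + 1, by linarith, by linarith, ?_⟩
  intro Ω u H x₀ R r M hR1 hball hr hrR hM hMu hMt hMg x hx y hy
  obtain ⟨l, w, Z, hw, hwu⟩ := H.exists_normSol hp (hr.trans hrR) hball hM hMu hMt hMg
  obtain ⟨h1, h2⟩ := hb l x₀ R w Z hw hR1.le r hr hrR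
  have hM0 : 0 < M := by linarith
  have hD : 0 < R - r := by linarith
  rw [preciseRep_eq_of_tendsto (inv_ne_zero hM0.ne') hwu (h1 x hx),
    preciseRep_eq_of_tendsto (inv_ne_zero hM0.ne') hwu (h1 y hy), inv_inv, ← mul_sub, abs_mul,
    abs_of_pos hM0]
  calc _ ≤ M * (C * (R - r) ^ (-κ) * ‖x - y‖ ^ γ) := by gcongr; exact h2 x hx y hy
    _ ≤ M * ((C + 1) * (R - r) ^ (-(κ + 1)) * ‖x - y‖ ^ γ) := by
      have : (R - r) ^ (-κ) ≤ (R - r) ^ (-(κ + 1)) :=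
        Real.rpow_le_rpow_of_exponent_ge hD (by linarith) (by linarith)
      gcongr
      linarith
    _ = _ := by rw [Real.rpow_neg hD.le]; ring

/-! ### Local Hölder continuity -/

/-- Compactness of K × K. Near a diagonal point the local bound applies; near a pair (a, b) with a ≠
b, the numerator is bounded and |x-y| stays above half of their distance. No chaining is used, so K
need not be convex. -/
lemma exists_holder_const_of_locally {v : E N → ℝ} {K : Set (E N)} (hK : IsCompact K) {γ : ℝ}
    (hγ : 0 < γ) (h : ∀ z ∈ K, ∃ δ C : ℝ, 0 < δ ∧ ∀ x ∈ ball z δ, ∀ y ∈ ball z δ,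
      |v x - v y| ≤ C * ‖x - y‖ ^ γ) :
    ∃ C : ℝ, 0 ≤ C ∧ ∀ x ∈ K, ∀ y ∈ K, |v x - v y| ≤ C * ‖x - y‖ ^ γ := by
  have key : ∃ C : ℝ, 0 ≤ C ∧ ∀ z ∈ K ×ˢ K, |v z.1 - v z.2| ≤ C * ‖z.1 - z.2‖ ^ γ := by
    refine (hK.prod hK).induction_on
      (p := fun S => ∃ C : ℝ, 0 ≤ C ∧ ∀ z ∈ S, |v z.1 - v z.2| ≤ C * ‖z.1 - z.2‖ ^ γ)
      ⟨0, le_rfl, fun z hz => absurd hz (notMem_empty z)⟩ ?_ ?_ ?_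
    · rintro S T hST ⟨C, hC, hT⟩
      exact ⟨C, hC, fun z hz => hT z (hST hz)⟩
    · rintro S T ⟨C, hC, hS⟩ ⟨C', hC', hT⟩
      refine ⟨max C C', hC.trans (le_max_left _ _), ?_⟩
      rintro z (hz | hz)
      · exact (hS z hz).trans (by gcongr; exact le_max_left _ _)
      · exact (hT z hz).trans (by gcongr; exact le_max_right _ _)
    · rintro ⟨a, b⟩ ⟨ha, hb⟩
      obtain ⟨δ, A, hδ, hA⟩ := h a ha
      rcases eq_or_ne a b with rfl | hab
      · refine ⟨ball a δ ×ˢ ball a δ, mem_nhdsWithin_of_mem_nhds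
          (prod_mem_nhds (ball_mem_nhds a hδ) (ball_mem_nhds a hδ)), |A|, abs_nonneg A, ?_⟩
        rintro z ⟨hz1, hz2⟩
        exact (hA _ hz1 _ hz2).trans (by gcongr; exact le_abs_self A)
      · obtain ⟨ε, B, hε, hB⟩ := h b hb
        have hd : 0 < dist a b := dist_pos.2 hab
        set d := dist a b
        have hbound : ∀ (c : E N) (δ A : ℝ), 0 < δ → (∀ x ∈ ball c δ, ∀ y ∈ ball c δ,
            |v x - v y| ≤ A * ‖x - y‖ ^ γ) → ∀ x ∈ ball c δ, |v x - v c| ≤ |A| * δ ^ γ := by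
          intro c δ A hδ hA x hx
          refine (hA x hx c (mem_ball_self hδ)).trans ?_
          rw [mem_ball, dist_eq_norm] at hx
          calc A * ‖x - c‖ ^ γ ≤ |A| * ‖x - c‖ ^ γ := by gcongr; exact le_abs_self A
            _ ≤ _ := by gcongr
        set m := |A| * δ ^ γ + |v a - v b| + |B| * ε ^ γ with hm
        have hm0 : 0 ≤ m := by positivity
        refine ⟨ball a (min δ (d / 4)) ×ˢ ball b (min ε (d / 4)), mem_nhdsWithin_of_mem_nhds
          (prod_mem_nhds (ball_mem_nhds a (by positivity)) (ball_mem_nhds b (by positivity))),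
          m / (d / 2) ^ γ, by positivity, ?_⟩
        rintro ⟨x, y⟩ ⟨hx, hy⟩
        simp only at hx hy ⊢
        have hxδ := ball_subset_ball (min_le_left _ _) hx
        have hyε := ball_subset_ball (min_le_left _ _) hy
        have hxd : dist x a < d / 4 := ball_subset_ball (min_le_right _ _) hx
        have hyd : dist y b < d / 4 := ball_subset_ball (min_le_right _ _) hy
        have h1 : |v x - v y| ≤ m := by
          have h2 := hbound a δ A hδ hA x hxδ
          have h3 := hbound b ε B hε hB y hyε
          calc |v x - v y| = |(v x - v a) + (v a - v b) - (v y - v b)| := by congr 1; ring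
            _ ≤ |v x - v a| + |v a - v b| + |v y - v b| := (abs_sub _ _).trans (by
                gcongr; exact abs_add_le _ _)
            _ ≤ m := by rw [hm]; gcongr
        have h4 : d / 2 ≤ ‖x - y‖ := by
          rw [← dist_eq_norm]
          have h5 := dist_triangle4 a x y b
          rw [dist_comm a x] at h5
          have h6 : d = dist a b := rfl
          linarith
        refine h1.trans ?_
        rw [div_mul_eq_mul_div, le_div_iff₀ (by positivity)]
        gcongr
  obtain ⟨C, hC, hb⟩ := key
  exact ⟨C, hC, fun x hx y hy => hb (x, y) ⟨hx, hy⟩⟩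

lemma holderSeminorm_le {γ A : ℝ} {v : E N → ℝ} {S : Set (E N)}
    (h : ∀ x ∈ S, ∀ y ∈ S, |v x - v y| ≤ A * ‖x - y‖ ^ γ) :
    holderSeminorm γ v S ≤ ENNReal.ofReal A := by
  refine iSup₂_le fun x hx => iSup₂_le fun y hy => iSup_le fun hxy => ENNReal.ofReal_le_ofReal ?_
  have : 0 < ‖x - y‖ := norm_pos_iff.2 (sub_ne_zero.2 hxy)
  rw [div_le_iff₀ (by positivity)]
  exact h x hx y hy

/-- Outside the ball 1 + |x| is at most a constant multiple of |x - x₀|, so the two weights are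
comparable. -/
lemma MemTailSpace.tail_lt_top (hp : 1 < p) (hs : 0 < s) (hu : MemTailSpace s p u) (hR : 0 < R) :
    tail s p u x₀ R < ∞ := by
  unfold tail
  set e : ℝ := (N : ℝ) + s * p with he
  have he0 : 0 < e := by positivity
  set A := (1 + ‖x₀‖) / R + 1 with hA
  have hA0 : 0 < A := by positivity
  refine ENNReal.rpow_lt_top_of_nonneg (one_div_nonneg.2 (by linarith))
    (ENNReal.mul_lt_top ENNReal.ofReal_lt_top ?_).ne
  calc ∫⁻ x in (ball x₀ R)ᶜ, ENNReal.ofReal (|u x| ^ (p - 1) / ‖x - x₀‖ ^ e)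
      ≤ ∫⁻ x in (ball x₀ R)ᶜ,
          ENNReal.ofReal (A ^ e) * ENNReal.ofReal (|u x| ^ (p - 1) / (1 + ‖x‖) ^ e) := by
        refine setLIntegral_mono' measurableSet_ball.compl fun x hx => ?_
        rw [← ENNReal.ofReal_mul (by positivity)]
        apply ENNReal.ofReal_le_ofReal
        have hx' : R ≤ ‖x - x₀‖ := by
          rw [mem_compl_iff, mem_ball, dist_eq_norm, not_lt] at hx
          exact hx
        have h1 : 1 + ‖x‖ ≤ A * ‖x - x₀‖ := by
          have h2 : ‖x‖ ≤ ‖x - x₀‖ + ‖x₀‖ := by simpa using norm_add_le (x - x₀) x₀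
          have h3 : 1 + ‖x₀‖ ≤ (1 + ‖x₀‖) / R * ‖x - x₀‖ := by
            rw [div_mul_eq_mul_div, le_div_iff₀ hR]
            gcongr
          rw [hA, add_mul, one_mul]
          linarith
        have h4 : (1 + ‖x‖) ^ e ≤ A ^ e * ‖x - x₀‖ ^ e := by
          rw [← Real.mul_rpow hA0.le (norm_nonneg _)]
          gcongr
        have h5 : 0 < ‖x - x₀‖ := hR.trans_le hx'
        rw [mul_div_assoc', div_le_div_iff₀ (by positivity) (by positivity)]
        calc |u x| ^ (p - 1) * (1 + ‖x‖) ^ e ≤ |u x| ^ (p - 1) * (A ^ e * ‖x - x₀‖ ^ e) := by gcongr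
          _ = _ := by ring
    _ ≤ ∫⁻ x, ENNReal.ofReal (A ^ e) * ENNReal.ofReal (|u x| ^ (p - 1) / (1 + ‖x‖) ^ e) :=
        setLIntegral_le_lintegral _ _
    _ < ∞ := by
        rw [lintegral_const_mul' _ _ ENNReal.ofReal_ne_top]
        exact ENNReal.mul_lt_top ENNReal.ofReal_lt_top hu.2

lemma MemLpLoc.eLpNorm_ball_lt_top {q : ℝ≥0∞} {Ω : Set (E N)} (hu : MemLpLoc q u Ω)
    (hball : closedBall x₀ R ⊆ Ω) : eLpNorm u q (volume.restrict (ball x₀ R)) < ∞ :=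
  (eLpNorm_mono_measure u (Measure.restrict_mono ball_subset_closedBall le_rfl)).trans_lt
    (hu _ (isCompact_closedBall x₀ R) hball).2

end FracOneP

end

/-! ### The theorem: passage from the quantitative bound to the precise representative -/

theorem corollary1p4 (N : ℕ) (hN : 2 ≤ N) (p s₁ s γ : ℝ)
    (hp : p ∈ Set.Ioo (1 : ℝ) 2) (hs₁ : s₁ ∈ Set.Ioo (0 : ℝ) 1)
    (hs : s ∈ Set.Ioo ((p - 1) / p) 1) (hγ : γ ∈ Set.Ioo (0 : ℝ) 1) :
    ∃ C κ : ℝ, 0 < C ∧ 0 < κ ∧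
      ∀ Ω : Set (E N), IsOpen Ω → IsConnected Ω → Bornology.IsBounded Ω →
        ∀ u : E N → ℝ, IsWeakSolution s₁ s p Ω u → MemLpLoc ∞ u Ω →
          ∃ v : E N → ℝ, v =ᵐ[volume.restrict Ω] u ∧ MemHolderLoc γ v Ω ∧
            ∀ (x₀ : E N) (R r : ℝ), R < 1 → Metric.closedBall x₀ R ⊆ Ω → 0 < r → r < R →
              holderSeminorm γ v (Metric.ball x₀ r) ≤
                ENNReal.ofReal C *
                  ((eLpNorm u ∞ (volume.restrict (Metric.ball x₀ R)) + tail s p u x₀ R) +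
                    gagliardo s p u (Metric.ball x₀ R) + 1) /
                  ENNReal.ofReal ((R - r) ^ κ) := by
  have hp0 : 0 < p := by linarith [hp.1]
  have hs0 : 0 < s := (div_pos (by linarith [hp.1]) hp0).trans hs.1
  have hsp : p - 1 < s * p := (div_lt_iff₀ hp0).1 hs.1
  obtain ⟨C, κ, hC, hκ, hb⟩ := exists_holder_bound_weakSolution (N := N) (by omega) hp
    ⟨hs0, hs.2⟩ hsp hs₁ hγ
  refine ⟨C, κ, hC, hκ, ?_⟩
  intro Ω hΩ _ _ u H hu
  have hmain : ∀ (x₀ : E N) (R r : ℝ), R < 1 → Metric.closedBall x₀ R ⊆ Ω → 0 < r → r < R →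
      ∀ T : ℝ≥0∞, T ≠ ∞ → T = (eLpNorm u ∞ (volume.restrict (Metric.ball x₀ R)) +
        tail s p u x₀ R) + gagliardo s p u (Metric.ball x₀ R) + 1 →
      ∀ x ∈ Metric.ball x₀ r, ∀ y ∈ Metric.ball x₀ r,
        |preciseRep u x - preciseRep u y| ≤ C * T.toReal / (R - r) ^ κ * ‖x - y‖ ^ γ := by
    intro x₀ R r hR1 hball hr hrR T hT hTeq
    have h1 : 1 ≤ T := hTeq ▸ le_add_self
    -- M is the whole sum T: each norm is one of its summands, and the summand 1 gives M ≥ 1.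
    refine hb Ω u H x₀ R r T.toReal hR1 hball hr hrR ?_ ?_ ?_ ?_
    · simpa using (ENNReal.toReal_le_toReal ENNReal.one_ne_top hT).2 h1
    all_goals rw [ENNReal.ofReal_toReal hT, hTeq, add_assoc, add_assoc]
    · exact le_self_add
    · exact le_add_left le_self_add
    · exact le_add_left (le_add_left le_self_add)
  refine ⟨preciseRep u, ae_restrict_of_ae (preciseRep_ae_eq
    (H.memTailSpace.1.locallyIntegrable (ENNReal.one_le_ofReal.2 hp.1.le))), ?_, ?_⟩
  · intro x₀ R hR hball
    -- Here the radius need not be below 1 and the estimate is wanted on the entire ball, so the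
    -- interior bound is used near each point of the closed ball and patched by compactness.
    obtain ⟨A, hA, hAb⟩ := exists_holder_const_of_locally (v := preciseRep u)
      (isCompact_closedBall x₀ R) hγ.1 (fun z hz => by
        obtain ⟨ε, hε, hεΩ⟩ := Metric.isOpen_iff.1 hΩ z (hball hz)
        set δ := min (ε / 2) (1 / 2) with hδ
        have hδ0 : 0 < δ := by positivity
        have hδ1 : δ < 1 := (min_le_right _ _).trans_lt (by norm_num)
        have hδΩ : Metric.closedBall z δ ⊆ Ω :=
          (Metric.closedBall_subset_ball ((min_le_left _ _).trans_lt (by linarith))).trans hεΩ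
        refine ⟨δ / 2, _, by positivity, hmain z δ (δ / 2) hδ1 hδΩ (by positivity) (by linarith) _
          (ENNReal.add_lt_top.2 ⟨ENNReal.add_lt_top.2 ⟨ENNReal.add_lt_top.2
            ⟨hu.eLpNorm_ball_lt_top hδΩ, H.memTailSpace.tail_lt_top hp.1 hs0 hδ0⟩,
            (H.memWLoc _ Metric.isOpen_ball (isCompact_closure_ball z δ)
              (Metric.closure_ball_subset_closedBall.trans hδΩ)).2⟩, ENNReal.one_lt_top⟩).ne rfl⟩)
    exact (holderSeminorm_le fun x hx y hy => hAb x (Metric.ball_subset_closedBall hx) y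
      (Metric.ball_subset_closedBall hy)).trans_lt ENNReal.ofReal_lt_top
  · intro x₀ R r hR1 hball hr hrR
    set T := (eLpNorm u ∞ (volume.restrict (Metric.ball x₀ R)) +
        tail s p u x₀ R) + gagliardo s p u (Metric.ball x₀ R) + 1 with hTeq
    -- If T is infinite the right-hand side is infinite, because C > 0 and the denominator is
    -- finite.
    rcases eq_or_ne T ∞ with hT | hT
    · rw [hT, ENNReal.mul_top (ENNReal.ofReal_pos.2 hC).ne',
        ENNReal.top_div_of_ne_top ENNReal.ofReal_ne_top]
      exact le_top
    · have hD : 0 < (R - r) ^ κ := Real.rpow_pos_of_pos (by linarith) κ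
      refine (holderSeminorm_le (hmain x₀ R r hR1 hball hr hrR T hT hTeq)).trans (le_of_eq ?_)
      rw [ENNReal.ofReal_div_of_pos hD, ENNReal.ofReal_mul hC.le, ENNReal.ofReal_toReal hT]
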